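/- Let $n\ge 2$. Let $\sigma$ be the round metric of $\mathbb S^{2n-1}\subset\mathbb C^n$, let $\xi$ be the Hopf vector field $\xi_z=iz$, and for $\mu>0$ let $e_\mu$ be the Berger metric on $\mathbb S^{2n-1}$ (equal to $\sigma$ on $\xi^\perp$, with $e_\mu(\xi,\xi)=\mu$ and $e_\mu(\xi,\xi^\perp)=0$). Let $\mathbb{CH}^n$ be $\mathbb R^{2n}=\mathbb C^n$ with the metric which in polar coordinates $(z,\rho)$, $z\in\mathbb S^{2n-1}$, $\rho>0$, is $\bar g=d\rho^2+\sinh^2(\rho)\,e_{\cosh^2(\rho)}$. A hypersurface is called star-shaped with radial function $\rho$ if it is $\{(z,\rho(z)) : z\in\mathbb S^{2n-1}\}$ for a smooth function $\rho:\mathbb S^{2n-1}\to(0,\infty)$, and it is $\mathbb S^1$-invariant if $\rho(e^{i\vartheta}z)=\rho(z)$ for all $\vartheta$ and $z$. Let $\mathcal M_0$ be a star-shaped, $\mathbb S^1$-invariant hypersurface of $\mathbb{CH}^n$ with radial function $\rho_0$, whose mean curvature with respect to the outward unit normal is everywhere positive. Then there is a constant $c>0$, depending only on $n$ and $\rho_0$,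 with the following property. Let $0<T\le\infty$ and let $F:\mathbb S^{2n-1}\times[0,T)\to\mathbb{CH}^n$ be any smooth family of immersions that solves the inverse mean curvature flow $$\frac{\partial F}{\partial t}=\frac1H\,\nu,\qquad F(z,0)=(z,\rho_0(z)),$$ where $\nu$ is the unit normal of $F(\cdot,t)$ (continuous in $(z,t)$ and outward at $t=0$) and $H\neq 0$ is the mean curvature with respect to $\nu$. Then for every $t\in[0,T)$ the hypersurface $\mathcal M_t=F(\mathbb S^{2n-1},t)$ is star-shaped and $\mathbb S^1$-invariant, and its radial function $\rho_t$ satisfies $$|\nabla_\sigma(\varphi\circ\rho_t)|_\sigma^2\le c\,e^{-t/n}\qquad\text{on }\mathbb S^{2n-1},$$ where $\varphi:(0,\infty)\to\mathbb R$ is any function with $\frac{d\varphi}{d\rho}=\frac1{\sinh\rho}$. -/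

import Mathlib

namespace CHFlow

open scoped ContDiff

noncomputable section

/-- `ℂⁿ = ℝ²ⁿ`, the underlying space of the model of complex hyperbolic space used here. -/
abbrev CSpace (n : ℕ) : Type := EuclideanSpace ℂ (Fin n)

/-- The unit sphere `𝕊²ⁿ⁻¹ ⊆ ℂⁿ`. -/
abbrev USphere (n : ℕ) : Type := Metric.sphere (0 : CSpace n) 1

/-- The Euclidean (real) inner product of `ℂⁿ = ℝ²ⁿ`; on tangent vectors of the unit sphere it is
the round metric `σ`. -/
def euc {n : ℕ} (u w : CSpace n) : ℝ := (inner ℂ u w).re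

/-! ### Analysis on the sphere -/

/-- The radial projection `ℂⁿ ∖ {0} → 𝕊²ⁿ⁻¹`. -/
def toSphere {n : ℕ} (y : CSpace n) (hy : y ≠ 0) : USphere n :=
  ⟨(‖y‖⁻¹ : ℝ) • y, by
    rw [mem_sphere_zero_iff_norm, norm_smul, norm_inv, norm_norm,
      inv_mul_cancel₀ (norm_ne_zero_iff.mpr hy)]⟩

open Classical in
/-- The extension of a map on the sphere to `ℂⁿ ∖ {0}` that is constant along rays
(with the irrelevant value `0` at the origin). The radial projection being a smooth submersion
that restricts to the identity on the sphere, `f` is smooth on the sphere iff `ext f` is smooth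
on `ℂⁿ ∖ {0}`, and the differential of `f` at `z` is the restriction of that of `ext f` to the
tangent space of the sphere at `z`. -/
def ext {n : ℕ} {W : Type*} [Zero W] (f : USphere n → W) (y : CSpace n) : W :=
  if hy : y = 0 then 0 else f (toSphere y hy)

/-- Smoothness (`C^∞`) of a function on the sphere. -/
def SmoothOnSphere {n : ℕ} {W : Type*} [NormedAddCommGroup W] [NormedSpace ℝ W]
    (f : USphere n → W) : Prop :=
  ContDiffOn ℝ ∞ (ext f) {0}ᶜ

/-- The tangent space of the sphere at `z`, as a real subspace of `ℂⁿ`. -/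
def sphereTangent {n : ℕ} (z : USphere n) : Submodule ℝ (CSpace n) where
  carrier := {X | euc (z : CSpace n) X = 0}
  add_mem' := by
    intro a b ha hb
    simp only [Set.mem_ofPred_eq, euc] at ha hb ⊢
    rw [inner_add_right, Complex.add_re, ha, hb, add_zero]
  zero_mem' := by simp [euc]
  smul_mem' := by
    intro c x hx
    simp only [Set.mem_ofPred_eq, euc] at hx ⊢
    rw [← Complex.coe_smul, inner_smul_right, Complex.re_ofReal_mul, hx, mul_zero]

/-- `|∇_σ f|²_σ` at `z`. The gradient of the extension that is constant along rays is tangent to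
the sphere, and it is the gradient of `f` for the round metric `σ`. -/
def gradNormSq {n : ℕ} (f : USphere n → ℝ) (z : USphere n) : ℝ :=
  ‖gradient (ext f) (z : CSpace n)‖ ^ 2

/-- Invariance of a function under the action `z ↦ e^{iϑ} z` of `𝕊¹` on the sphere. -/
def CircleInvariant {n : ℕ} (f : USphere n → ℝ) : Prop :=
  ∀ (a : ℂ) (z w : USphere n), ‖a‖ = 1 → (w : CSpace n) = a • (z : CSpace n) → f w = f z

/-! ### The complex hyperbolic space -/

/-- The Berger metric `e_μ` at the point `z` of the unit sphere: it agrees with `σ` on the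
orthogonal complement of the Hopf vector `ξ = i z`, which stays orthogonal to `ξ`,
and `e_μ(ξ, ξ) = μ`. -/
def bergerMetric {n : ℕ} (μ : ℝ) (z X Y : CSpace n) : ℝ :=
  euc X Y + (μ - 1) * (euc (Complex.I • z) X * euc (Complex.I • z) Y)

open Classical in
/-- The metric of complex hyperbolic space, on `ℂⁿ = ℝ²ⁿ` with polar coordinates `(z, ρ)`:
`dρ² + sinh²(ρ) e_{cosh²(ρ)}`. At the point `x = ρ z`, a vector `u` has radial component `⟨z, u⟩`,
and its component tangent to the unit sphere is `ρ⁻¹ (u - ⟨z, u⟩ z)`.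
The smooth extension of this metric to the origin is the Euclidean inner product there. -/
def hypMetric {n : ℕ} (x u w : CSpace n) : ℝ :=
  if x = 0 then euc u w
  else
    let ρ : ℝ := ‖x‖
    let z : CSpace n := (ρ⁻¹ : ℝ) • x
    euc z u * euc z w
      + Real.sinh ρ ^ 2 * bergerMetric (Real.cosh ρ ^ 2) z
          ((ρ⁻¹ : ℝ) • (u - (euc z u : ℝ) • z)) ((ρ⁻¹ : ℝ) • (w - (euc z w : ℝ) • z))

/-- Christoffel symbols of the first kind of the Levi-Civita connection `∇̄` of the metric,
in the linear coordinates of `ℝ²ⁿ`: for constant vector fields `u, w, q` this is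
`ḡ(∇̄_u w, q)` at `x` (Koszul formula). -/
def christoffel {n : ℕ} (x u w q : CSpace n) : ℝ :=
  (fderiv ℝ (fun y => hypMetric y w q) x u + fderiv ℝ (fun y => hypMetric y u q) x w
    - fderiv ℝ (fun y => hypMetric y u w) x q) / 2

/-! ### Hypersurfaces `F : 𝕊²ⁿ⁻¹ → ℂHⁿ` -/

/-- The differential of `F` at `z`, to be applied to tangent vectors of the sphere. -/
def pushforward {n : ℕ} (F : USphere n → CSpace n) (z : USphere n) (X : CSpace n) : CSpace n :=
  fderiv ℝ (ext F) (z : CSpace n) X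

/-- The differential of `F` is injective on every tangent space. -/
def IsImmersive {n : ℕ} (F : USphere n → CSpace n) : Prop :=
  ∀ z : USphere n, ∀ X ∈ sphereTangent z, pushforward F z X = 0 → X = 0

/-- `N` is a unit normal vector of the hypersurface `F` at `F z`. -/
def IsUnitNormal {n : ℕ} (F : USphere n → CSpace n) (z : USphere n) (N : CSpace n) : Prop :=
  hypMetric (F z) N N = 1 ∧ ∀ X ∈ sphereTangent z, hypMetric (F z) N (pushforward F z X) = 0

/-- The induced metric `g = F^* ḡ`. -/
def inducedMetric {n : ℕ} (F : USphere n → CSpace n) (z : USphere n) (X Y : CSpace n) : ℝ :=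
  hypMetric (F z) (pushforward F z X) (pushforward F z Y)

/-- The second fundamental form `h(X, Y) = - ḡ(∇̄_X (F_* Y), N)` with respect to the unit normal
vector `N` at `F z`. In the linear coordinates of `ℝ²ⁿ`,
`∇̄_X (F_* Y) = D²F(X, Y) + Γ(F_* X, F_* Y)` up to a vector tangent to the hypersurface, which does
not contribute. -/
def secondFundForm {n : ℕ} (F : USphere n → CSpace n) (N : CSpace n) (z : USphere n)
    (X Y : CSpace n) : ℝ :=
  -(hypMetric (F z) (fderiv ℝ (fun y => fderiv ℝ (ext F) y Y) (z : CSpace n) X) N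
    + christoffel (F z) (pushforward F z X) (pushforward F z Y) N)

/-- The mean curvature `H = h_{ij} g^{ji}` with respect to the unit normal vector `N` at `F z`,
computed in a basis of the tangent space of the sphere at `z` (its value does not depend on the
basis). -/
def meanCurvature {n : ℕ} (F : USphere n → CSpace n) (N : CSpace n) (z : USphere n) : ℝ :=
  let b := Module.finBasis ℝ (sphereTangent z)
  let g := Matrix.of fun i j => inducedMetric F z (b i : CSpace n) (b j : CSpace n)
  let h := Matrix.of fun i j => secondFundForm F N z (b i : CSpace n) (b j : CSpace n)
  (h * g⁻¹).trace

/-- The hypersurface given in polar coordinates by `z ↦ (z, ρ(z))`. -/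
def radialGraph {n : ℕ} (ρ : USphere n → ℝ) (z : USphere n) : CSpace n :=
  ρ z • (z : CSpace n)

/-- `ρ` is a radial function: a smooth function `𝕊²ⁿ⁻¹ → ℝ⁺`. -/
def IsRadialFunction {n : ℕ} (ρ : USphere n → ℝ) : Prop :=
  SmoothOnSphere ρ ∧ ∀ z, 0 < ρ z

/-- The hypersurface `F` is star-shaped (with respect to the origin), with radial function `ρ`. -/
def IsStarShaped {n : ℕ} (F : USphere n → CSpace n) (ρ : USphere n → ℝ) : Prop :=
  IsRadialFunction ρ ∧ Set.range F = Set.range (radialGraph ρ)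

/-- `N` is the outward unit normal at `F z` of a star-shaped hypersurface: the unit
normal that has positive product with the radial direction. -/
def IsOutwardNormal {n : ℕ} (F : USphere n → CSpace n) (z : USphere n) (N : CSpace n) : Prop :=
  IsUnitNormal F z N ∧ 0 < hypMetric (F z) N (F z)

/-- Mean convexity of the star-shaped hypersurface with radial function `ρ`: its mean curvature
with respect to the outward unit normal is positive everywhere. -/
def IsMeanConvexGraph {n : ℕ} (ρ : USphere n → ℝ) : Prop :=
  ∀ z, ∃ N, IsOutwardNormal (radialGraph ρ) z N ∧ 0 < meanCurvature (radialGraph ρ) N z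

/-! ### Inverse mean curvature flow -/

/-- The time interval `[0, T)`, with `T = ∞` allowed. -/
def timeInterval (T : EReal) : Set ℝ := {t | 0 ≤ t ∧ (t : EReal) < T}

/-- `F : 𝕊²ⁿ⁻¹ × [0, T) → ℂHⁿ` is a smooth solution of the inverse mean curvature flow
`∂F/∂t = ν / H`, starting at the star-shaped hypersurface with radial function `ρ₀`.
Here `ν` is the unit normal that depends continuously on the point and on the time and is outward
at the initial time. -/
structure IsIMCF {n : ℕ} (ρ₀ : USphere n → ℝ) (T : EReal)
    (F ν : ℝ → USphere n → CSpace n) : Prop where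
  smooth : ContDiffOn ℝ ∞ (fun p : ℝ × CSpace n => ext (F p.1) p.2) (timeInterval T ×ˢ {0}ᶜ)
  immersion : ∀ t ∈ timeInterval T, IsImmersive (F t)
  normal_continuous :
    ContinuousOn (fun p : ℝ × USphere n => ν p.1 p.2) (timeInterval T ×ˢ Set.univ)
  unit_normal : ∀ t ∈ timeInterval T, ∀ z, IsUnitNormal (F t) z (ν t z)
  initial : F 0 = radialGraph ρ₀
  outward : ∀ z, IsOutwardNormal (F 0) z (ν 0 z)
  curvature_ne_zero : ∀ t ∈ timeInterval T, ∀ z, meanCurvature (F t) (ν t z) z ≠ 0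
  flow : ∀ t ∈ timeInterval T, ∀ z,
    HasDerivWithinAt (fun s => F s z) ((meanCurvature (F t) (ν t z) z)⁻¹ • ν t z)
      (timeInterval T) t

end

end CHFlow

namespace CHFlow

open scoped ContDiff Topology
open Set Filter Function

/-! ### Calculus -/

/-! Write m = 2n and φ = log tanh(ρ/2), and let p and A be the Euclidean gradient and Hessian of φ,
extended to ℂⁿ∖{0} to be constant along rays. A star-shaped hypersurface is a level set of log
tanh(|x|/2) − φ. The ambient Hessian of this function, traced over the tangent hyperplane, gives H =
G/(sinh ρ √V); on the unit sphere V = 1 + |p|² − tanh²ρ f² with f = ⟨p, ix⟩, and G is affine in A.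
Hence inverse mean curvature flow becomes the scalar equation ∂φ/∂t = V/G
(`normal_and_meanCurvature`, `IsTransversalFlow.exists_graphSolution`).

Circle invariance means f = 0. At a spatial maximum of f² the second order terms of the equation for
f have a favourable sign, and the remaining ones are at most a multiple of f², locally uniformly in
time. The maximum principle therefore keeps f = 0 (`hopfDeriv_growth`,
`IsGraphSolution.hopfDeriv_eq_zero`).

Once f = 0, the gradient decays. At a maximum of |p|² on the sphere, the second order conditions
bound the derivative of G along p from below. Homogeneity forces Ax = −p and invariance forces A(ix)
= ip, so A is prescribed on the complex line of x, and |A|² ≥ (tr A)²/m improves by 4|p|²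
(`sum_norm_sq_ge`). This compensates the 4|p|² in the trace of the Hessian of |x|²|p|². With s = −tr
A, the derivative of G along p is at least m cosh²ρ |p|² + s²/m, while G ≤ m cosh ρ + s. Completing
a square yields d|p|²/dt ≤ −(2/m)|p|² = −|p|²/n (`gradSq_decay`).

The flow is not assumed to consist of graphs. While ⟨F, ν⟩ > 0, the degree-one extensions of F(·, t)
are diffeomorphisms of ℂⁿ∖{0}, so each hypersurface is a graph (`IsConeIsotopy.exists_inverse`). The
gradient estimate and the growth of ρ then bound ⟨F, ν⟩ = |F|/√V below by a constant depending only
on ρ₀, so there is no first time at which ⟨F, ν⟩ reaches zero (`IsIMCF.support_pos`). Positivity of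
H persists because H never vanishes. -/

/-- The second derivative at a local maximum is nonpositive. -/
theorem second_deriv_nonpos_of_isLocalMax {g g' : ℝ → ℝ} {c : ℝ}
    (hg : ∀ᶠ s in 𝓝 0, HasDerivAt g (g' s) s) (hg' : HasDerivAt g' c 0)
    (hmax : IsLocalMax g 0) : c ≤ 0 := by
  by_contra! hc
  have hd : deriv g =ᶠ[𝓝 0] g' := hg.mono fun s hs => hs.deriv
  have h1 : deriv (deriv g) 0 = c := by rw [hd.deriv_eq, hg'.deriv]
  have h2 : deriv g 0 = 0 := hmax.deriv_eq_zero
  -- Were c positive, 0 would be a local minimum too, so g would be constant nearby and c would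
  -- vanish.
  have hmin : IsLocalMin g 0 :=
    isLocalMin_of_deriv_deriv_pos (by rw [h1]; exact hc) h2 hg.self_of_nhds.continuousAt
  have hconst : g =ᶠ[𝓝 0] fun _ => g 0 := by
    filter_upwards [hmax, hmin] with s h1 h2 using le_antisymm h1 h2
  have h3 : deriv g =ᶠ[𝓝 0] fun _ => 0 := by
    have := hconst.deriv
    simpa using this
  have h4 : deriv (deriv g) 0 = 0 := by rw [h3.deriv_eq]; simp
  linarith

/-- A maximum principle: if `w ≤ 0` initially and `∂ₜ w ≤ C w` at every positive spatial maximum,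
then `w ≤ 0`. -/
theorem max_principle {X : Type*} [TopologicalSpace X] {K : Set X} (hK : IsCompact K)
    {w : ℝ → X → ℝ} {t₁ C : ℝ} (hcont : ContinuousOn (uncurry w) (Icc 0 t₁ ×ˢ K))
    (h0 : ∀ x ∈ K, w 0 x ≤ 0)
    (h : ∀ t ∈ Ioc 0 t₁, ∀ x ∈ K, 0 < w t x → (∀ y ∈ K, w t y ≤ w t x) →
      ∃ d, HasDerivAt (fun s => w s x) d t ∧ d ≤ C * w t x) :
    ∀ t ∈ Icc 0 t₁, ∀ x ∈ K, w t x ≤ 0 := by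
  intro t ht x hx
  by_contra! hpos
  -- The weight turns d ≤ C w into a strictly negative time derivative at a positive maximum, since
  -- d − (C + 1) w ≤ −w. Maximality against earlier times makes the left slopes nonnegative. Only
  -- left slopes are used, because the maximum may sit at t₁.
  set u : ℝ × X → ℝ := fun p => Real.exp (-(C + 1) * p.1) * uncurry w p with hu
  have hucont : ContinuousOn u (Icc 0 t₁ ×ˢ K) := by
    refine ContinuousOn.mul ?_ hcont
    exact (Real.continuous_exp.comp (continuous_const.mul continuous_fst)).continuousOn
  obtain ⟨⟨s, y⟩, ⟨hs, hy⟩, hmax⟩ :=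
    (isCompact_Icc.prod hK).exists_isMaxOn ⟨(t, x), ht, hx⟩ hucont
  have hmax' : ∀ s' ∈ Icc 0 t₁, ∀ y' ∈ K, u (s', y') ≤ u (s, y) :=
    fun s' hs' y' hy' => hmax (show (s', y') ∈ Icc 0 t₁ ×ˢ K from ⟨hs', hy'⟩)
  have hupos : 0 < u (s, y) :=
    lt_of_lt_of_le (mul_pos (Real.exp_pos _) hpos) (hmax' t ht x hx)
  have hw : 0 < w s y := by
    by_contra! hle
    exact absurd hupos (not_lt.mpr (mul_nonpos_of_nonneg_of_nonpos (Real.exp_pos _).le hle))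
  have hs0 : 0 < s := by
    rcases eq_or_lt_of_le (show 0 ≤ s from hs.1) with h | h
    · rw [← h] at hw
      exact absurd (h0 y hy) (not_le.mpr hw)
    · exact h
  obtain ⟨d, hd, hdle⟩ := h s ⟨hs0, hs.2⟩ y hy hw (fun y' hy' => by
    have := hmax' s hs y' hy'
    exact le_of_mul_le_mul_left this (Real.exp_pos _))
  have hdu : HasDerivAt (fun r => u (r, y))
      (Real.exp (-(C + 1) * s) * (-(C + 1)) * w s y + Real.exp (-(C + 1) * s) * d) s := by
    have he : HasDerivAt (fun r : ℝ => Real.exp (-(C + 1) * r))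
        (Real.exp (-(C + 1) * s) * (-(C + 1))) s := by
      have := ((hasDerivAt_id s).const_mul (-(C + 1))).exp
      simpa using this
    exact he.mul hd
  have hneg : Real.exp (-(C + 1) * s) * (-(C + 1)) * w s y + Real.exp (-(C + 1) * s) * d < 0 := by
    have : Real.exp (-(C + 1) * s) * (-(C + 1)) * w s y + Real.exp (-(C + 1) * s) * d
        = Real.exp (-(C + 1) * s) * (d - (C + 1) * w s y) := by ring
    rw [this]
    exact mul_neg_of_pos_of_neg (Real.exp_pos _) (by linarith)
  have hslope := hdu.tendsto_slope
  have hev : ∀ᶠ r in 𝓝[<] s, slope (fun r => u (r, y)) s r < 0 :=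
    (hslope.mono_left (nhdsWithin_mono _ fun r (hr : r < s) => hr.ne)).eventually
      (gt_mem_nhds hneg)
  have hIoo : ∀ᶠ r in 𝓝[<] s, r ∈ Ioo 0 s := Ioo_mem_nhdsLT hs0
  obtain ⟨r, hr, hr'⟩ := (hev.and hIoo).exists
  have hle := hmax' r ⟨hr'.1.le, hr'.2.le.trans hs.2⟩ y hy
  rw [slope_def_field] at hr
  have : 0 ≤ (u (r, y) - u (s, y)) / (r - s) :=
    div_nonneg_of_nonpos (by linarith) (by linarith [hr'.2])
  linarith

/-! ### Space derivatives of families that are smooth up to the initial time. -/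

section PartialDerivatives

variable {E F : Type*} [NormedAddCommGroup E] [NormedSpace ℝ E]
  [NormedAddCommGroup F] [NormedSpace ℝ F]

/-- At an endpoint of I the space-time map has only a derivative within the set, but its restriction
to the space directions is a genuine derivative because U is open. -/
theorem hasFDerivAt_snd_of_contDiffOn {g : ℝ → E → F} {I : Set ℝ} {U : Set E} (hU : IsOpen U)
    (hg : ContDiffOn ℝ ∞ (uncurry g) (I ×ˢ U)) {t : ℝ} {x : E} (ht : t ∈ I) (hx : x ∈ U) :
    HasFDerivAt (g t)
      ((fderivWithin ℝ (uncurry g) (I ×ˢ U) (t, x)).comp (ContinuousLinearMap.inr ℝ ℝ E)) x := by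
  have h1 : HasFDerivWithinAt (uncurry g) (fderivWithin ℝ (uncurry g) (I ×ˢ U) (t, x))
      (I ×ˢ U) (t, x) := (hg.differentiableOn (by simp) (t, x) ⟨ht, hx⟩).hasFDerivWithinAt
  have h2 : HasFDerivWithinAt (fun y : E => (t, y)) (ContinuousLinearMap.inr ℝ ℝ E) U x :=
    (hasFDerivAt_prodMk_right t x).hasFDerivWithinAt
  have h3 := h1.comp x h2 (fun y hy => ⟨ht, hy⟩)
  exact h3.hasFDerivAt (hU.mem_nhds hx)

theorem contDiffOn_fderiv_snd {g : ℝ → E → F} {I : Set ℝ} {U : Set E} (hI : UniqueDiffOn ℝ I)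
    (hU : IsOpen U) (hg : ContDiffOn ℝ ∞ (uncurry g) (I ×ˢ U)) :
    ContDiffOn ℝ ∞ (uncurry fun t x => fderiv ℝ (g t) x) (I ×ˢ U) := by
  have h1 : ContDiffOn ℝ ∞ (fderivWithin ℝ (uncurry g) (I ×ˢ U)) (I ×ˢ U) :=
    hg.fderivWithin (hI.prod hU.uniqueDiffOn) (by simp)
  have h2 := h1.clm_comp (contDiffOn_const (c := ContinuousLinearMap.inr ℝ ℝ E))
  refine h2.congr ?_
  rintro ⟨t, x⟩ ⟨ht, hx⟩
  exact (hasFDerivAt_snd_of_contDiffOn hU hg ht hx).fderiv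

theorem contDiffOn_slice {g : ℝ → E → F} {I : Set ℝ} {U : Set E}
    (hg : ContDiffOn ℝ ∞ (uncurry g) (I ×ˢ U)) {t : ℝ} (ht : t ∈ I) :
    ContDiffOn ℝ ∞ (g t) U :=
  hg.comp (contDiff_prodMk_right t).contDiffOn (fun _ hy => ⟨ht, hy⟩)

/-- Symmetry of the mixed second derivatives. -/
theorem hasDerivAt_fderiv_snd {g : ℝ → E → F} {t : ℝ} {x : E}
    (hg : ContDiffAt ℝ ∞ (uncurry g) (t, x)) :
    DifferentiableAt ℝ (fun y => deriv (fun s => g s y) t) x ∧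
      HasDerivAt (fun s => fderiv ℝ (g s) x)
        (fderiv ℝ (fun y => deriv (fun s => g s y) t) x) t := by
  obtain ⟨u, hu, hcd⟩ := (hg.of_le (m := 2) (by norm_cast)).contDiffOn le_rfl (by simp)
  obtain ⟨v, hvu, hv, hmem⟩ := mem_nhds_iff.mp hu
  have hcd := hcd.mono hvu
  have hdiff : ∀ p ∈ v, HasFDerivAt (uncurry g) (fderiv ℝ (uncurry g) p) p := fun p hp =>
    ((hcd.contDiffAt (hv.mem_nhds hp)).differentiableAt (by simp)).hasFDerivAt
  have h2 : HasFDerivAt (fderiv ℝ (uncurry g)) (fderiv ℝ (fderiv ℝ (uncurry g)) (t, x)) (t, x) :=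
    ((hg.fderiv_right (m := ∞) (by simp)).differentiableAt (by simp)).hasFDerivAt
  have hsymm := hg.isSymmSndFDerivAt (by simp; norm_cast)
  have hxs : ∀ s y, (s, y) ∈ v →
      HasFDerivAt (g s) ((fderiv ℝ (uncurry g) (s, y)).comp (ContinuousLinearMap.inr ℝ ℝ E)) y :=
    fun s y hp => (hdiff _ hp).comp y (hasFDerivAt_prodMk_right s y)
  have hts : ∀ s y, (s, y) ∈ v →
      HasDerivAt (fun s => g s y) (fderiv ℝ (uncurry g) (s, y) (1, 0)) s := fun s y hp => by
    have := (hdiff _ hp).comp_hasDerivAt s ((hasDerivAt_id s).prodMk (hasDerivAt_const s y))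
    simpa [Function.comp_def] using this
  have hevt : ∀ᶠ s in 𝓝 t, (s, x) ∈ v :=
    (Continuous.prodMk_left x).continuousAt.preimage_mem_nhds (hv.mem_nhds hmem)
  have hevx : ∀ᶠ y in 𝓝 x, (t, y) ∈ v :=
    (Continuous.prodMk_right t).continuousAt.preimage_mem_nhds (hv.mem_nhds hmem)
  -- Both derivatives are this second derivative with one slot at (1, 0) and the other in the space
  -- directions; only the order of the slots differs.
  set D2 := fderiv ℝ (fderiv ℝ (uncurry g)) (t, x)
  have hA : HasFDerivAt (fun y => deriv (fun s => g s y) t)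
      ((ContinuousLinearMap.apply ℝ F ((1 : ℝ), (0 : E))).comp
        (D2.comp (ContinuousLinearMap.inr ℝ ℝ E))) x := by
    have h3 : HasFDerivAt (fun y => fderiv ℝ (uncurry g) (t, y) (1, 0))
      ((ContinuousLinearMap.apply ℝ F ((1 : ℝ), (0 : E))).comp
        (D2.comp (ContinuousLinearMap.inr ℝ ℝ E))) x :=
      (ContinuousLinearMap.apply ℝ F ((1 : ℝ), (0 : E))).hasFDerivAt.comp x
        (h2.comp x (hasFDerivAt_prodMk_right t x))
    exact h3.congr_of_eventuallyEq (hevx.mono fun y hy => (hts t y hy).deriv)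
  have hB : HasDerivAt (fun s => fderiv ℝ (g s) x)
      ((D2 (1, 0)).comp (ContinuousLinearMap.inr ℝ ℝ E)) t := by
    have h3 := h2.comp_hasDerivAt t ((hasDerivAt_id t).prodMk (hasDerivAt_const t x))
    have h4 := ((ContinuousLinearMap.compL ℝ E (ℝ × E) F).flip
      (ContinuousLinearMap.inr ℝ ℝ E)).hasFDerivAt.comp_hasDerivAt t h3
    have h5 : HasDerivAt (fun s => (fderiv ℝ (uncurry g) (s, x)).comp
        (ContinuousLinearMap.inr ℝ ℝ E)) ((D2 (1, 0)).comp (ContinuousLinearMap.inr ℝ ℝ E)) t := h4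
    exact h5.congr_of_eventuallyEq (hevt.mono fun s hs => (hxs s x hs).fderiv)
  refine ⟨hA.differentiableAt, ?_⟩
  rw [hA.fderiv]
  refine hB.congr_deriv ?_
  ext v
  exact hsymm _ _

/-- A continuous local inverse, within a set, of a smooth map with invertible derivative
is smooth. -/
theorem contDiffOn_of_left_inverse [CompleteSpace E] {f g : E → E} {s : Set E}
    (hs : UniqueDiffOn ℝ s) (hf : ContDiffOn ℝ ∞ f s)
    (hinv : ∀ x ∈ s, ∃ e : E ≃L[ℝ] E, (e : E →L[ℝ] E) = fderivWithin ℝ f s x)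
    (hg : ContinuousOn g s) (hmaps : MapsTo g s s) (hfg : ∀ x ∈ s, f (g x) = x) :
    ContDiffOn ℝ ∞ g s := by
  have hder : ∀ x ∈ s, HasFDerivWithinAt g
      (ContinuousLinearMap.inverse (fderivWithin ℝ f s (g x))) s x := by
    intro x hx
    obtain ⟨e, he⟩ := hinv _ (hmaps hx)
    rw [← he, ContinuousLinearMap.inverse_equiv]
    refine HasFDerivWithinAt.of_local_left_inverse (t := s) (f := f)
      (tendsto_nhdsWithin_iff.mpr ⟨hg x hx, ?_⟩) ?_ hx ?_
    · exact eventually_nhdsWithin_of_forall fun y hy => hmaps hy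
    · rw [he]
      exact (hf.differentiableOn (by simp) _ (hmaps hx)).hasFDerivWithinAt
    · exact eventually_nhdsWithin_of_forall hfg
  have hdiff : DifferentiableOn ℝ g s := fun x hx => (hder x hx).differentiableWithinAt
  have hfd : ∀ x ∈ s, fderivWithin ℝ g s x =
      ContinuousLinearMap.inverse (fderivWithin ℝ f s (g x)) := fun x hx =>
    (hder x hx).fderivWithin (hs x hx)
  have hf' : ContDiffOn ℝ ∞ (fderivWithin ℝ f s) s := hf.fderivWithin hs (by simp)
  -- Bootstrapping: the derivative of g is the inverse of the derivative of f evaluated at g, so it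
  -- is as regular as g and g gains one order.
  have hn : ∀ n : ℕ, ContDiffOn ℝ n g s := by
    intro n
    induction n with
    | zero => exact_mod_cast contDiffOn_zero.mpr hg
    | succ n ih =>
      have : ((n + 1 : ℕ) : WithTop ℕ∞) = (n : WithTop ℕ∞) + 1 := by push_cast; rfl
      rw [this, contDiffOn_succ_iff_fderivWithin hs]
      refine ⟨hdiff, by simp, ?_⟩
      have h1 : ContDiffOn ℝ n (fun x => fderivWithin ℝ f s (g x)) s :=
        (hf'.of_le (by exact_mod_cast le_top)).comp ih hmaps
      refine ContDiffOn.congr (f := fun x =>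
        ContinuousLinearMap.inverse (fderivWithin ℝ f s (g x))) ?_ hfd
      intro x hx
      obtain ⟨e, he⟩ := hinv _ (hmaps hx)
      have h2 : ContDiffAt ℝ n ContinuousLinearMap.inverse (fderivWithin ℝ f s (g x)) := by
        rw [← he]; exact contDiffAt_map_inverse e
      exact h2.comp_contDiffWithinAt x (h1 x hx)
  exact contDiffOn_infty.mpr hn

end PartialDerivatives

end CHFlow

namespace CHFlow

open scoped ContDiff Topology RealInnerProductSpace
open Set Filter Function

/-! ### Linear algebra -/

section LinearAlgebra

variable {E ι : Type*} [NormedAddCommGroup E] [InnerProductSpace ℝ E] [Fintype ι]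

/-- An orthogonal complex structure. -/
structure IsOrthComplex (J : E →L[ℝ] E) : Prop where
  sq : ∀ x, J (J x) = -x
  skew : ∀ x y, ⟪J x, y⟫ = -⟪x, J y⟫

namespace IsOrthComplex

variable {J : E →L[ℝ] E} (hJ : IsOrthComplex J)
include hJ

theorem inner_self (x : E) : ⟪J x, x⟫ = 0 := by
  have := hJ.skew x x
  rw [real_inner_comm (J x) x] at this
  linarith

theorem inner_self' (x : E) : ⟪x, J x⟫ = 0 := by
  rw [real_inner_comm]; exact hJ.inner_self x

theorem inner_map_map (x y : E) : ⟪J x, J y⟫ = ⟪x, y⟫ := by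
  rw [hJ.skew, hJ.sq, inner_neg_right, neg_neg]

theorem norm_map (x : E) : ‖J x‖ = ‖x‖ := by
  have h := hJ.inner_map_map x x
  rw [real_inner_self_eq_norm_sq, real_inner_self_eq_norm_sq] at h
  exact (sq_eq_sq₀ (norm_nonneg _) (norm_nonneg _)).mp h

end IsOrthComplex

/-- The trace of an operator, in an orthonormal basis. -/
noncomputable def basisTrace (b : OrthonormalBasis ι ℝ E) (S : E →L[ℝ] E) : ℝ := ∑ k, ⟪S (b k), b k⟫

variable (b : OrthonormalBasis ι ℝ E)

theorem basisTrace_add (S S' : E →L[ℝ] E) :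
    basisTrace b (S + S') = basisTrace b S + basisTrace b S' := by
  simp [basisTrace, inner_add_left, Finset.sum_add_distrib]

theorem basisTrace_sub (S S' : E →L[ℝ] E) :
    basisTrace b (S - S') = basisTrace b S - basisTrace b S' := by
  simp [basisTrace, inner_sub_left, Finset.sum_sub_distrib]

theorem basisTrace_smul (c : ℝ) (S : E →L[ℝ] E) :
    basisTrace b (c • S) = c * basisTrace b S := by
  simp [basisTrace, inner_smul_left, Finset.mul_sum]

theorem basisTrace_id : basisTrace b (ContinuousLinearMap.id ℝ E) = Fintype.card ι := by
  simp [basisTrace]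

theorem basisTrace_rankOne (u w : E) :
    basisTrace b ((innerSL ℝ u).smulRight w) = ⟪u, w⟫ := by
  simp only [basisTrace, ContinuousLinearMap.smulRight_apply, innerSL_apply_apply,
    inner_smul_left, conj_trivial]
  rw [← b.sum_inner_mul_inner u w]
  exact Finset.sum_congr rfl fun k _ => by rw [real_inner_comm w (b k)]

theorem sum_inner_apply (S : E →L[ℝ] E) (p w : E) :
    ∑ k, ⟪b k, p⟫ * ⟪S (b k), w⟫ = ⟪S p, w⟫ := by
  conv_rhs => rw [← b.sum_repr' p, map_sum, sum_inner]
  simp [inner_smul_left]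

theorem sum_inner_apply' (S : E →L[ℝ] E) (p w : E) :
    ∑ k, ⟪b k, p⟫ * ⟪S w, b k⟫ = ⟪S w, p⟫ := by
  rw [← b.sum_inner_mul_inner (S w) p]
  exact Finset.sum_congr rfl fun k _ => by ring

theorem basisTrace_comp_comm (A J : E →L[ℝ] E) :
    basisTrace b (A.comp J) = basisTrace b (J.comp A) := by
  have h : ∀ S R : E →L[ℝ] E, basisTrace b (S.comp R) = ∑ k, ∑ l, ⟪b l, R (b k)⟫ * ⟪S (b l), b k⟫ :=
    fun S R => Finset.sum_congr rfl fun k _ => (sum_inner_apply b S (R (b k)) (b k)).symm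
  rw [h, h, Finset.sum_comm]
  refine Finset.sum_congr rfl fun k _ => Finset.sum_congr rfl fun l _ => ?_
  rw [mul_comm, real_inner_comm, real_inner_comm (J (b l))]

/-- The sum of the values of a quadratic form on the vectors `b k - α ⟨b k, p⟩ p`. -/
theorem sum_inner_sub_smul (S : E →L[ℝ] E) (p : E) (α : ℝ) :
    ∑ k, ⟪S (b k - (α * ⟪b k, p⟫) • p), b k - (α * ⟪b k, p⟫) • p⟫ =
      basisTrace b S - 2 * α * ⟪S p, p⟫ + α ^ 2 * ‖p‖ ^ 2 * ⟪S p, p⟫ := by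
  have h1 := sum_inner_apply b S p p
  have h2 := sum_inner_apply' b S p p
  have h3 : ∑ k, ⟪b k, p⟫ * ⟪b k, p⟫ = ‖p‖ ^ 2 := by
    rw [← real_inner_self_eq_norm_sq, ← b.sum_inner_mul_inner p p]
    exact Finset.sum_congr rfl fun k _ => by rw [real_inner_comm (b k) p]
  have : ∀ k, ⟪S (b k - (α * ⟪b k, p⟫) • p), b k - (α * ⟪b k, p⟫) • p⟫ =
      ⟪S (b k), b k⟫ - α * (⟪b k, p⟫ * ⟪S (b k), p⟫) - α * (⟪b k, p⟫ * ⟪S p, b k⟫)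
        + α ^ 2 * ⟪S p, p⟫ * (⟪b k, p⟫ * ⟪b k, p⟫) := fun k => by
    simp only [map_sub, map_smul, inner_sub_left, inner_sub_right, inner_smul_left,
      inner_smul_right, conj_trivial]
    ring
  simp only [this, Finset.sum_add_distrib, Finset.sum_sub_distrib, ← Finset.mul_sum, h1, h2, h3,
    basisTrace]
  ring

/-- A nonnegative quadratic form is at most its trace times the square of the norm. -/
theorem inner_le_norm_sq_mul_basisTrace {S : E →L[ℝ] E} (hS : ∀ v, 0 ≤ ⟪S v, v⟫) (p : E) :
    ⟪S p, p⟫ ≤ ‖p‖ ^ 2 * basisTrace b S := by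
  rcases eq_or_ne p 0 with rfl | hp
  · simp
  have hp' : 0 < ‖p‖ ^ 2 := by positivity
  -- This coefficient projects the basis onto the orthogonal complement of p, so the nonnegative sum
  -- equals tr S − ⟪S p, p⟫ / ‖p‖².
  have h := sum_inner_sub_smul b S p (1 / ‖p‖ ^ 2)
  have h0 : 0 ≤ ∑ k, ⟪S (b k - (1 / ‖p‖ ^ 2 * ⟪b k, p⟫) • p), b k - (1 / ‖p‖ ^ 2 * ⟪b k, p⟫) • p⟫ :=
    Finset.sum_nonneg fun k _ => hS _
  rw [h] at h0
  have h1 : basisTrace b S - 2 * (1 / ‖p‖ ^ 2) * ⟪S p, p⟫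
      + (1 / ‖p‖ ^ 2) ^ 2 * ‖p‖ ^ 2 * ⟪S p, p⟫ = basisTrace b S - ⟪S p, p⟫ / ‖p‖ ^ 2 := by
    field_simp; ring
  rw [h1, sub_nonneg, div_le_iff₀ hp'] at h0
  linarith

/-- Nonnegativity of `tr_{g⁻¹} S` for the inverse metric `g⁻¹ = K - q ⊗ q / V`, where
`K = 1 - θ ξ ⊗ ξ`, `q = K p` and `V = 1 + ⟨p, q⟩`. -/
theorem trace_inverse_metric_nonneg {S : E →L[ℝ] E} (hS : ∀ v, 0 ≤ ⟪S v, v⟫) {p ξ : E}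
    (hξ : ‖ξ‖ = 1) {θ : ℝ} (hθ : θ ≤ 1) :
    0 ≤ basisTrace b S - θ * ⟪S ξ, ξ⟫
      - ⟪S (p - (θ * ⟪p, ξ⟫) • ξ), p - (θ * ⟪p, ξ⟫) • ξ⟫ / (1 + ‖p‖ ^ 2 - θ * ⟪p, ξ⟫ ^ 2) := by
  -- With this β the symmetric operator R = 1 − β ξ ⊗ ξ is a square root of K = 1 − θ ξ ⊗ ξ.
  -- Conjugating S by R reduces the claim to the Euclidean bound of a quadratic form by its trace.
  set β : ℝ := 1 - Real.sqrt (1 - θ) with hβ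
  have hβ2 : 2 * β - β ^ 2 = θ := by
    have := Real.sq_sqrt (show 0 ≤ 1 - θ by linarith)
    rw [hβ]; linear_combination -this
  have hξξ : ⟪ξ, ξ⟫ = 1 := by rw [real_inner_self_eq_norm_sq, hξ]; norm_num
  set R : E →L[ℝ] E := ContinuousLinearMap.id ℝ E - β • (innerSL ℝ ξ).smulRight ξ with hR
  have hRa : ∀ v, R v = v - (β * ⟪v, ξ⟫) • ξ := fun v => by
    simp [hR, smul_smul, real_inner_comm]
  have hRs : ∀ v w, ⟪R v, w⟫ = ⟪v, R w⟫ := fun v w => by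
    rw [hRa, hRa, inner_sub_left, inner_sub_right, inner_smul_left, inner_smul_right,
      real_inner_comm w ξ]
    simp only [conj_trivial]; ring
  have hRR : ∀ v, R (R v) = v - (θ * ⟪v, ξ⟫) • ξ := fun v => by
    rw [hRa (R v), hRa v, inner_sub_left, inner_smul_left, hξξ, sub_sub, ← add_smul]
    congr 2
    simp only [conj_trivial]
    linear_combination ⟪v, ξ⟫ * hβ2
  set N : E →L[ℝ] E := R.comp (S.comp R) with hN
  have hNi : ∀ v, ⟪N v, v⟫ = ⟪S (R v), R v⟫ := fun v => by
    simp only [hN, ContinuousLinearMap.comp_apply, hRs]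
  have hN0 : ∀ v, 0 ≤ ⟪N v, v⟫ := fun v => by rw [hNi]; exact hS _
  have htr : basisTrace b N = basisTrace b S - θ * ⟪S ξ, ξ⟫ := by
    have h := sum_inner_sub_smul b S ξ β
    rw [hξ] at h
    have h' : basisTrace b N = ∑ k, ⟪S (b k - (β * ⟪b k, ξ⟫) • ξ), b k - (β * ⟪b k, ξ⟫) • ξ⟫ :=
      Finset.sum_congr rfl fun k _ => by rw [hNi, hRa]
    rw [h', h]; linear_combination -⟪S ξ, ξ⟫ * hβ2
  -- The form R S R at R p is S at K p, and ‖R p‖² = V − 1 < V, which leaves room for the division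
  -- by V.
  have hm := inner_le_norm_sq_mul_basisTrace b hN0 (R p)
  have hnorm : ‖R p‖ ^ 2 = ‖p‖ ^ 2 - θ * ⟪p, ξ⟫ ^ 2 := by
    rw [← real_inner_self_eq_norm_sq, hRs, hRR, inner_sub_right, inner_smul_right,
      real_inner_self_eq_norm_sq]
    ring
  rw [hNi, hRR, hnorm, htr] at hm
  have hV : 0 < 1 + ‖p‖ ^ 2 - θ * ⟪p, ξ⟫ ^ 2 := by
    have := sq_nonneg ‖R p‖
    linarith [hnorm ▸ this]
  have htr0 : 0 ≤ basisTrace b S - θ * ⟪S ξ, ξ⟫ := by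
    rw [← htr]; exact Finset.sum_nonneg fun k _ => hN0 _
  rw [sub_nonneg, div_le_iff₀ hV]
  nlinarith

/-- The lower bound of `tr A²` used for the gradient estimate: on the complex line spanned by the
unit vector `x`, the operator `A` is prescribed. -/
theorem sum_norm_sq_ge {J : E →L[ℝ] E} (hJ : IsOrthComplex J) {A : E →L[ℝ] E}
    (hA : ∀ v w, ⟪A v, w⟫ = ⟪A w, v⟫) {x p : E} (hx : ‖x‖ = 1) (hpx : ⟪p, x⟫ = 0)
    (hpJ : ⟪p, J x⟫ = 0) (hAx : A x = -p) (hAJ : A (J x) = J p) :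
    4 * ‖p‖ ^ 2 + basisTrace b A ^ 2 / Fintype.card ι ≤ ∑ k, ‖A (b k)‖ ^ 2 := by
  have hxx : ⟪x, x⟫ = 1 := by rw [real_inner_self_eq_norm_sq, hx]; norm_num
  have hxp : ⟪x, p⟫ = 0 := by rw [real_inner_comm]; exact hpx
  have hJxp : ⟪J x, p⟫ = 0 := by rw [real_inner_comm]; exact hpJ
  have hJxx : ⟪J x, J x⟫ = 1 := by rw [hJ.inner_map_map, hxx]
  have hJpp : ⟪J p, J p⟫ = ⟪p, p⟫ := hJ.inner_map_map p p
  have hxJp : ⟪x, J p⟫ = 0 := by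
    have := hJ.skew x p; rw [hJxp] at this; linarith
  have hxJx : ⟪x, J x⟫ = 0 := hJ.inner_self' x
  have hJxJp : ⟪J x, J p⟫ = 0 := by rw [hJ.inner_map_map, hxp]
  -- B removes from A its prescribed part and annihilates the complex line of x. The removed part is
  -- trace free and costs exactly 4‖p‖² in the squared norm, so it remains to apply Cauchy–Schwarz
  -- to the diagonal of B, with the full dimension as factor.
  set B : E →L[ℝ] E := A + (innerSL ℝ x).smulRight p + (innerSL ℝ p).smulRight x
    - (innerSL ℝ (J x)).smulRight (J p) - (innerSL ℝ (J p)).smulRight (J x) with hB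
  have hBa : ∀ v, B v = A v + ⟪x, v⟫ • p + ⟪p, v⟫ • x - ⟪J x, v⟫ • J p - ⟪J p, v⟫ • J x :=
    fun v => by simp [hB]
  have htr : basisTrace b B = basisTrace b A := by
    rw [hB, basisTrace_sub, basisTrace_sub, basisTrace_add, basisTrace_add, basisTrace_rankOne,
      basisTrace_rankOne, basisTrace_rankOne, basisTrace_rankOne, hpx, hxp, hJxJp,
      real_inner_comm, hJxJp]
    ring
  have hsum2 : ∀ u w : E, ∑ k, ⟪u, b k⟫ * ⟪w, b k⟫ = ⟪u, w⟫ := fun u w => by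
    rw [← b.sum_inner_mul_inner u w]
    exact Finset.sum_congr rfl fun k _ => by rw [real_inner_comm w (b k)]
  have hpt : ∀ v, ‖B v‖ ^ 2 = ‖A v‖ ^ 2 + ⟪p, p⟫ * (⟪x, v⟫ * ⟪x, v⟫) + ⟪p, v⟫ * ⟪p, v⟫
      + ⟪p, p⟫ * (⟪J x, v⟫ * ⟪J x, v⟫) + ⟪J p, v⟫ * ⟪J p, v⟫
      + 2 * (⟪x, v⟫ * ⟪A p, v⟫) + 2 * (⟪p, v⟫ * ⟪A x, v⟫) - 2 * (⟪J x, v⟫ * ⟪A (J p), v⟫)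
      - 2 * (⟪J p, v⟫ * ⟪A (J x), v⟫)
      - 2 * ⟪p, J p⟫ * (⟪x, v⟫ * ⟪J x, v⟫) := fun v => by
    rw [← real_inner_self_eq_norm_sq, ← real_inner_self_eq_norm_sq, hBa]
    simp only [inner_add_left, inner_add_right, inner_sub_left, inner_sub_right, inner_smul_left,
      inner_smul_right, conj_trivial, hxx, hJxx, hxp, hpx, hpJ, hJxp, hJpp, hxJp, hxJx, hJxJp,
      real_inner_comm x (J p), real_inner_comm x (J x), real_inner_comm (J x) (J p),
      real_inner_comm (A v) p, real_inner_comm (A v) x, real_inner_comm (A v) (J x),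
      real_inner_comm (A v) (J p), real_inner_comm p (J p), hA v p, hA v x, hA v (J x), hA v (J p)]
    ring
  have hAp : ⟪A p, x⟫ = -⟪p, p⟫ := by rw [hA, hAx, inner_neg_left]
  have hAJp : ⟪A (J p), J x⟫ = ⟪p, p⟫ := by rw [hA, hAJ, hJpp]
  have hsum : ∑ k, ‖B (b k)‖ ^ 2 = ∑ k, ‖A (b k)‖ ^ 2 - 4 * ‖p‖ ^ 2 := by
    simp only [hpt, Finset.sum_add_distrib, Finset.sum_sub_distrib, ← Finset.mul_sum, hsum2]
    rw [hxx, hJxx, hJpp, hxJx, real_inner_comm (A p) x, hAp, hAx, inner_neg_right,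
      real_inner_comm (A (J p)), hAJp, hAJ, hJpp, real_inner_self_eq_norm_sq]
    ring
  have hcs : basisTrace b B ^ 2 ≤ Fintype.card ι * ∑ k, ‖B (b k)‖ ^ 2 := by
    refine (sq_sum_le_card_mul_sum_sq (s := Finset.univ)).trans ?_
    refine mul_le_mul_of_nonneg_left (Finset.sum_le_sum fun k _ => ?_) (by positivity)
    have := abs_real_inner_le_norm (B (b k)) (b k)
    rw [b.norm_eq_one, mul_one] at this
    exact sq_le_sq' (by linarith [neg_abs_le ⟪B (b k), b k⟫]) ((le_abs_self _).trans this)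
  rw [htr, hsum] at hcs
  rcases Nat.eq_zero_or_pos (Fintype.card ι) with h0 | h0
  · rw [Fintype.card_eq_zero_iff] at h0
    have h1 := b.sum_inner_mul_inner x x
    simp [hx] at h1
  · have h0' : (0 : ℝ) < Fintype.card ι := by exact_mod_cast h0
    have : basisTrace b A ^ 2 / Fintype.card ι ≤ ∑ k, ‖A (b k)‖ ^ 2 - 4 * ‖p‖ ^ 2 := by
      rw [div_le_iff₀ h0']; linarith
    linarith

end LinearAlgebra

end CHFlow

namespace CHFlow

open scoped ContDiff Topology RealInnerProductSpace
open Set Filter Function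

/-! ### Derivatives of functions that are homogeneous of degree zero -/

section Homogeneous

variable {E : Type*} [NormedAddCommGroup E] [InnerProductSpace ℝ E] [CompleteSpace E]
  {φ : E → ℝ}

/-- A function that is smooth away from the origin and constant along rays. -/
structure IsSmoothConic (φ : E → ℝ) : Prop where
  smooth : ContDiffOn ℝ ∞ φ {0}ᶜ
  homog : ∀ c : ℝ, 0 < c → ∀ x, x ≠ 0 → φ (c • x) = φ x

/-- The Hessian as an operator. -/
noncomputable def hessOp (φ : E → ℝ) (x : E) : E →L[ℝ] E := fderiv ℝ (gradient φ) x

theorem inner_gradient (φ : E → ℝ) (x v : E) : ⟪gradient φ x, v⟫ = fderiv ℝ φ x v := by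
  simp [gradient]

set_option linter.unusedSectionVars false

namespace IsSmoothConic

variable (h : IsSmoothConic φ)
include h

theorem contDiffAt {x : E} (hx : x ≠ 0) : ContDiffAt ℝ ∞ φ x :=
  h.smooth.contDiffAt (isOpen_compl_singleton.mem_nhds hx)

theorem hasFDerivAt {x : E} (hx : x ≠ 0) : HasFDerivAt φ (fderiv ℝ φ x) x :=
  ((h.contDiffAt hx).differentiableAt (by simp)).hasFDerivAt

theorem contDiffAt_gradient {x : E} (hx : x ≠ 0) : ContDiffAt ℝ ∞ (gradient φ) x :=
  ((InnerProductSpace.toDual ℝ E).symm.toContinuousLinearEquiv.contDiff.contDiffAt).comp x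
    ((h.contDiffAt hx).fderiv_right (m := ∞) (by simp))

theorem hasFDerivAt_gradient {x : E} (hx : x ≠ 0) :
    HasFDerivAt (gradient φ) (hessOp φ x) x :=
  ((h.contDiffAt_gradient hx).differentiableAt (by simp)).hasFDerivAt

theorem contDiffAt_hessOp {x : E} (hx : x ≠ 0) : ContDiffAt ℝ ∞ (hessOp φ) x :=
  (h.contDiffAt_gradient hx).fderiv_right (m := ∞) (by simp)

theorem hasFDerivAt_hessOp {x : E} (hx : x ≠ 0) :
    HasFDerivAt (hessOp φ) (fderiv ℝ (hessOp φ) x) x :=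
  ((h.contDiffAt_hessOp hx).differentiableAt (by simp)).hasFDerivAt

theorem eventually_ne {x : E} (hx : x ≠ 0) : ∀ᶠ y in 𝓝 x, y ≠ 0 :=
  isOpen_compl_singleton.mem_nhds hx

theorem hessOp_symm {x : E} (hx : x ≠ 0) (v w : E) :
    ⟪hessOp φ x v, w⟫ = ⟪hessOp φ x w, v⟫ := by
  have key : ∀ v w, ⟪hessOp φ x v, w⟫ = fderiv ℝ (fderiv ℝ φ) x v w := fun v w => by
    have h1 : HasFDerivAt (fun y => ⟪gradient φ y, w⟫)
        ((innerSL ℝ w).comp (hessOp φ x)) x := by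
      have := (innerSL ℝ w).hasFDerivAt.comp x (h.hasFDerivAt_gradient hx)
      refine this.congr_of_eventuallyEq (Eventually.of_forall fun y => ?_)
      simp
    have h2 : HasFDerivAt (fun y => fderiv ℝ φ y w)
        ((ContinuousLinearMap.apply ℝ ℝ w).comp (fderiv ℝ (fderiv ℝ φ) x)) x :=
      (ContinuousLinearMap.apply ℝ ℝ w).hasFDerivAt.comp x
        ((((h.contDiffAt hx).fderiv_right (m := ∞) (by simp)).differentiableAt
          (by simp)).hasFDerivAt)
    simp only [inner_gradient] at h1
    have := congrArg (fun L => L v) (h1.unique h2)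
    simpa [real_inner_comm] using this
  rw [key, key]
  exact (h.contDiffAt hx).isSymmSndFDerivAt (by simp; norm_cast) v w

theorem fderiv_hessOp_swap {x : E} (hx : x ≠ 0) (u v : E) :
    fderiv ℝ (hessOp φ) x u v = fderiv ℝ (hessOp φ) x v u :=
  (h.contDiffAt_gradient hx).isSymmSndFDerivAt (by simp; norm_cast) u v

theorem fderiv_hessOp_symm {x : E} (hx : x ≠ 0) (u v w : E) :
    ⟪fderiv ℝ (hessOp φ) x u v, w⟫ = ⟪fderiv ℝ (hessOp φ) x u w, v⟫ := by
  have key : ∀ v w, HasFDerivAt (fun y => ⟪hessOp φ y v, w⟫)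
      ((innerSL ℝ w).comp ((ContinuousLinearMap.apply ℝ E v).comp (fderiv ℝ (hessOp φ) x))) x :=
    fun v w => by
      have := (innerSL ℝ w).hasFDerivAt.comp x
        ((ContinuousLinearMap.apply ℝ E v).hasFDerivAt.comp x (h.hasFDerivAt_hessOp hx))
      refine this.congr_of_eventuallyEq (Eventually.of_forall fun y => ?_)
      simp [real_inner_comm]
  have h1 := (key v w).congr_of_eventuallyEq
    ((h.eventually_ne hx).mono fun y hy => (h.hessOp_symm hy v w).symm)
  have := congrArg (fun L => L u) (h1.unique (key w v))
  simpa [real_inner_comm] using this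

theorem inner_gradient_self {x : E} (hx : x ≠ 0) : ⟪gradient φ x, x⟫ = 0 := by
  rw [inner_gradient]
  have h1 : HasDerivAt (fun s : ℝ => φ (s • x)) (fderiv ℝ φ x x) 1 := by
    have hc : HasDerivAt (fun s : ℝ => s • x) x 1 := by
      simpa using (hasDerivAt_id (1 : ℝ)).smul_const x
    have := HasFDerivAt.comp_hasDerivAt (f := fun s : ℝ => s • x) 1
      (by simpa using h.hasFDerivAt hx) hc
    exact this
  have h2 : HasDerivAt (fun s : ℝ => φ (s • x)) 0 1 := by
    refine (hasDerivAt_const (1 : ℝ) (φ x)).congr_of_eventuallyEq ?_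
    filter_upwards [lt_mem_nhds (show (0 : ℝ) < 1 by norm_num)] with s hs
    exact h.homog s hs x hx
  exact h1.unique h2

/-- Euler's identity ⟪∇φ(y), y⟫ = 0, differentiated. It prescribes the Hessian in the radial
direction, one of the two inputs of `sum_norm_sq_ge`. -/
theorem hessOp_self {x : E} (hx : x ≠ 0) : hessOp φ x x = -gradient φ x := by
  refine ext_inner_right ℝ fun v => ?_
  have h1 : HasFDerivAt (fun y => ⟪gradient φ y, y⟫) _ x :=
    (h.hasFDerivAt_gradient hx).inner ℝ (hasFDerivAt_id x)
  have h2 : HasFDerivAt (fun y => ⟪gradient φ y, y⟫) (0 : E →L[ℝ] ℝ) x :=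
    (hasFDerivAt_const (0 : ℝ) x).congr_of_eventuallyEq
      ((h.eventually_ne hx).mono fun y hy => h.inner_gradient_self hy)
  have h3 := congrArg (fun L => L v) (h1.unique h2)
  simp [fderivInnerCLM_apply] at h3
  rw [inner_neg_left, h.hessOp_symm hx, inner_gradient]
  linarith

theorem gradient_smul {c : ℝ} (hc : 0 < c) {x : E} (hx : x ≠ 0) :
    gradient φ (c • x) = c⁻¹ • gradient φ x := by
  refine ext_inner_right ℝ fun v => ?_
  have hcx : c • x ≠ 0 := smul_ne_zero hc.ne' hx
  have h1 : HasFDerivAt (fun y => φ (c • y)) ((fderiv ℝ φ (c • x)).comp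
      (c • ContinuousLinearMap.id ℝ E)) x :=
    (h.hasFDerivAt hcx).comp x ((hasFDerivAt_id x).const_smul c)
  have h2 := (h.hasFDerivAt hx).congr_of_eventuallyEq
    ((h.eventually_ne hx).mono fun y hy => h.homog c hc y hy)
  have h3 := congrArg (fun L => L v) (h1.unique h2)
  simp at h3
  rw [inner_smul_left, inner_gradient, inner_gradient, ← h3]
  simp only [conj_trivial]
  field_simp

theorem hessOp_smul {c : ℝ} (hc : 0 < c) {x : E} (hx : x ≠ 0) :
    hessOp φ (c • x) = (c ^ 2)⁻¹ • hessOp φ x := by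
  have hcx : c • x ≠ 0 := smul_ne_zero hc.ne' hx
  have h1 : HasFDerivAt (fun y => gradient φ (c • y)) ((hessOp φ (c • x)).comp
      (c • ContinuousLinearMap.id ℝ E)) x :=
    (h.hasFDerivAt_gradient hcx).comp x ((hasFDerivAt_id x).const_smul c)
  have h2 := ((h.hasFDerivAt_gradient hx).const_smul c⁻¹).congr_of_eventuallyEq
    ((h.eventually_ne hx).mono fun y hy => h.gradient_smul hc hy)
  ext v
  have h3 := congrArg (fun L => c⁻¹ • L v) (h1.unique h2)
  simp only [ContinuousLinearMap.comp_apply, smul_apply, smul_smul,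
    ContinuousLinearMap.id_apply, map_smul, inv_mul_cancel₀ hc.ne', one_smul] at h3
  rw [h3, smul_apply]
  congr 1; field_simp

/-! #### Derivatives along a line -/

theorem hasDerivAt_gradient {x v : E} {s : ℝ} (hx : x + s • v ≠ 0) :
    HasDerivAt (fun r : ℝ => gradient φ (x + r • v)) (hessOp φ (x + s • v) v) s := by
  have hc : HasDerivAt (fun r : ℝ => x + r • v) v s := by
    simpa using ((hasDerivAt_id s).smul_const v).const_add x
  exact (h.hasFDerivAt_gradient hx).comp_hasDerivAt s hc

theorem hasDerivAt_hessOp {x v : E} {s : ℝ} (hx : x + s • v ≠ 0) :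
    HasDerivAt (fun r : ℝ => hessOp φ (x + r • v)) (fderiv ℝ (hessOp φ) (x + s • v) v) s := by
  have hc : HasDerivAt (fun r : ℝ => x + r • v) v s := by
    simpa using ((hasDerivAt_id s).smul_const v).const_add x
  exact (h.hasFDerivAt_hessOp hx).comp_hasDerivAt s hc

end IsSmoothConic

theorem hasDerivAt_line (x v : E) (s : ℝ) : HasDerivAt (fun r : ℝ => x + r • v) v s := by
  simpa using ((hasDerivAt_id s).smul_const v).const_add x

theorem hasDerivAt_norm_sq_line (x v : E) (s : ℝ) :
    HasDerivAt (fun r : ℝ => ‖x + r • v‖ ^ 2) (2 * ⟪x + s • v, v⟫) s :=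
  (hasDerivAt_line x v s).norm_sq

theorem eventually_line_ne {x : E} (hx : x ≠ 0) (v : E) : ∀ᶠ s : ℝ in 𝓝 0, x + s • v ≠ 0 := by
  have : ContinuousAt (fun s : ℝ => x + s • v) 0 := (hasDerivAt_line x v 0).continuousAt
  exact this.eventually_ne (by simpa using hx)

/-- A maximum on the unit sphere of a function that is constant along rays
is a maximum along each line. -/
theorem isLocalMax_line {w : E → ℝ} (hw : ∀ c : ℝ, 0 < c → ∀ x, x ≠ 0 → w (c • x) = w x)
    {x : E} (hx : ‖x‖ = 1) (hmax : ∀ y, ‖y‖ = 1 → w y ≤ w x) (v : E) :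
    IsLocalMax (fun s : ℝ => w (x + s • v)) 0 := by
  have hx0 : x ≠ 0 := by rintro rfl; simp at hx
  filter_upwards [eventually_line_ne hx0 v] with s hs
  have h0 : 0 < ‖x + s • v‖ := norm_pos_iff.mpr hs
  rw [← hw ‖x + s • v‖⁻¹ (by positivity) _ hs]
  simp only [zero_smul, add_zero]
  exact hmax _ (by rw [norm_smul, norm_inv, norm_norm, inv_mul_cancel₀ h0.ne'])

/-- The two derivative conditions at a maximum point. -/
theorem first_second_order_conditions {w : E → ℝ} {x v : E} {w' : ℝ → ℝ} {w'' : ℝ}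
    (hmax : IsLocalMax (fun s : ℝ => w (x + s • v)) 0)
    (h1 : ∀ᶠ s in 𝓝 0, HasDerivAt (fun s : ℝ => w (x + s • v)) (w' s) s)
    (h2 : HasDerivAt w' w'' 0) : w' 0 = 0 ∧ w'' ≤ 0 :=
  ⟨hmax.hasDerivAt_eq_zero h1.self_of_nhds, second_deriv_nonpos_of_isLocalMax h1 h2 hmax⟩

end Homogeneous

end CHFlow

namespace CHFlow

open scoped ContDiff Topology RealInnerProductSpace
open Set Filter Function

/-! ### The graph equation: estimates at a fixed time -/

section GraphOperator

variable {E ι : Type*} [NormedAddCommGroup E] [InnerProductSpace ℝ E] [Fintype ι]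

noncomputable section

/-- For a graph with `φ = log tanh (ρ / 2)`, in terms of `p = ∇φ`: the function
`1 + |∇φ|² - tanh² ρ ⟨∇φ, ξ⟩²`. -/
def graphV (J : E →L[ℝ] E) (ρ : ℝ) (p x : E) : ℝ :=
  1 + ‖x‖ ^ 2 * ‖p‖ ^ 2 - Real.sinh ρ ^ 2 / Real.cosh ρ ^ 2 * ⟪p, J x⟫ ^ 2

/-- The dual of `∇φ` for the Berger metric. -/
def graphQ (J : E →L[ℝ] E) (ρ : ℝ) (p x : E) : E :=
  ‖x‖ ^ 2 • p - (Real.sinh ρ ^ 2 / Real.cosh ρ ^ 2 * ⟪p, J x⟫) • J x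

/-- The mean curvature of the graph, up to a positive factor, in terms of `p = ∇φ` and the Hessian
`A` of `φ`. -/
def graphG (J : E →L[ℝ] E) (b : OrthonormalBasis ι ℝ E) (ρ : ℝ) (p : E) (A : E →L[ℝ] E)
    (x : E) : ℝ :=
  Fintype.card ι * Real.cosh ρ - 1 / Real.cosh ρ
    + Real.sinh ρ ^ 2 / Real.cosh ρ ^ 3 * ⟪p, J x⟫ ^ 2 / graphV J ρ p x
    - ‖x‖ ^ 2 * basisTrace b A + Real.sinh ρ ^ 2 / Real.cosh ρ ^ 2 * ⟪A (J x), J x⟫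
    + ⟪A (graphQ J ρ p x), graphQ J ρ p x⟫ / graphV J ρ p x

/-- The zeroth order coefficient in the equation for the derivative of `φ` in the Hopf
direction. -/
def graphK (m : ℝ) (J : E →L[ℝ] E) (ρ : ℝ) (p : E) (A : E →L[ℝ] E) (x : E) : ℝ :=
  m * Real.sinh ρ ^ 2 + Real.sinh ρ ^ 2 / Real.cosh ρ ^ 2
    + (2 * Real.cosh ρ ^ 2 - 3 * Real.sinh ρ ^ 2) * Real.sinh ρ ^ 2 / Real.cosh ρ ^ 4
        * ⟪p, J x⟫ ^ 2 / graphV J ρ p x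
    + Real.sinh ρ ^ 2 / Real.cosh ρ ^ 3 * (2 * Real.sinh ρ ^ 2 / Real.cosh ρ ^ 3) * ⟪p, J x⟫ ^ 4
        / graphV J ρ p x ^ 2
    + 2 * Real.sinh ρ ^ 2 / Real.cosh ρ ^ 3 * ⟪A (J x), J x⟫
    - 2 * (2 * Real.sinh ρ ^ 2 / Real.cosh ρ ^ 3) * ⟪p, J x⟫ * ⟪A (graphQ J ρ p x), J x⟫
        / graphV J ρ p x
    + 2 * Real.sinh ρ ^ 2 / Real.cosh ρ ^ 3 * ⟪p, J x⟫ ^ 2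
        * ⟪A (graphQ J ρ p x), graphQ J ρ p x⟫ / graphV J ρ p x ^ 2

end

theorem tanh_sq_le_one (ρ : ℝ) : Real.sinh ρ ^ 2 / Real.cosh ρ ^ 2 ≤ 1 := by
  rw [div_le_one (by positivity), Real.sinh_sq]
  linarith

/-- Cauchy–Schwarz for ⟪p, J x⟫ together with tanh² ≤ 1. It keeps every division by V harmless. -/
theorem one_le_graphV {J : E →L[ℝ] E} (hJ : IsOrthComplex J) (ρ : ℝ) (p x : E) :
    1 ≤ graphV J ρ p x := by
  have h1 : ⟪p, J x⟫ ^ 2 ≤ ‖x‖ ^ 2 * ‖p‖ ^ 2 := by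
    have h := abs_real_inner_le_norm p (J x)
    rw [hJ.norm_map] at h
    have := sq_le_sq' (by linarith [neg_abs_le ⟪p, J x⟫]) ((le_abs_self _).trans h)
    nlinarith
  have h2 := mul_le_mul_of_nonneg_right (tanh_sq_le_one ρ) (sq_nonneg ⟪p, J x⟫)
  rw [graphV]
  linarith

theorem graphG_of_inner_eq_zero {J : E →L[ℝ] E} (b : OrthonormalBasis ι ℝ E) (ρ : ℝ) {p : E}
    (A : E →L[ℝ] E) {x : E} (hp : ⟪p, J x⟫ = 0) (hA : ⟪A (J x), J x⟫ = 0) :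
    graphG J b ρ p A x = Fintype.card ι * Real.cosh ρ - 1 / Real.cosh ρ
      - ‖x‖ ^ 2 * basisTrace b A + (‖x‖ ^ 2) ^ 2 * ⟪A p, p⟫ / (1 + ‖x‖ ^ 2 * ‖p‖ ^ 2) := by
  rw [graphG, graphQ, graphV, hp, hA]
  simp [inner_smul_left, inner_smul_right]
  ring

set_option linter.unusedSectionVars false

variable [CompleteSpace E] {φ ρ : E → ℝ} {J : E →L[ℝ] E}

theorem hasDerivAt_basisTrace (b : OrthonormalBasis ι ℝ E) {S : ℝ → E →L[ℝ] E} {S' : E →L[ℝ] E}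
    {s : ℝ} (hS : HasDerivAt S S' s) :
    HasDerivAt (fun r => basisTrace b (S r)) (basisTrace b S') s := by
  refine HasDerivAt.fun_sum fun k _ => ?_
  have h1 : HasDerivAt (fun r => S r (b k)) (S' (b k)) s := by
    simpa using hS.clm_apply (hasDerivAt_const s (b k))
  simpa using h1.inner ℝ (hasDerivAt_const s (b k))

/-- The derivative of the quotient `V / G`, in terms of its constituents. -/
theorem hasDerivAt_graph_quotient {m δ P' t' a' c' : ℝ} {n P F t a c r : ℝ → ℝ}
    (hn : HasDerivAt n 0 0) (hn1 : n 0 = 1) (hP : HasDerivAt P P' 0) (hP' : P' = 0)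
    (hF : HasDerivAt F 0 0)
    (ht : HasDerivAt t t' 0) (ha : HasDerivAt a a' 0) (hc : HasDerivAt c c' 0)
    (hr : HasDerivAt r (Real.sinh (r 0) * δ) 0) {V G V' : ℝ}
    (hV : V = 1 + P 0 - Real.sinh (r 0) ^ 2 / Real.cosh (r 0) ^ 2 * F 0 ^ 2) (hV0 : V ≠ 0)
    (hG : G = m * Real.cosh (r 0) - 1 / Real.cosh (r 0)
      + Real.sinh (r 0) ^ 2 / Real.cosh (r 0) ^ 3 * F 0 ^ 2 / V - t 0
      + Real.sinh (r 0) ^ 2 / Real.cosh (r 0) ^ 2 * a 0 + c 0 / V) (hG0 : G ≠ 0)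
    (hV' : V' = -(2 * Real.sinh (r 0) ^ 2 / Real.cosh (r 0) ^ 3 * δ * F 0 ^ 2)) :
    HasDerivAt (fun s => (1 + n s * P s - Real.sinh (r s) ^ 2 / Real.cosh (r s) ^ 2 * F s ^ 2) /
      (m * Real.cosh (r s) - 1 / Real.cosh (r s)
      + Real.sinh (r s) ^ 2 / Real.cosh (r s) ^ 3 * F s ^ 2 /
        (1 + n s * P s - Real.sinh (r s) ^ 2 / Real.cosh (r s) ^ 2 * F s ^ 2) - n s * t s
      + Real.sinh (r s) ^ 2 / Real.cosh (r s) ^ 2 * a s + c s /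
        (1 + n s * P s - Real.sinh (r s) ^ 2 / Real.cosh (r s) ^ 2 * F s ^ 2)))
      ((V' * G - V * ((m * Real.sinh (r 0) ^ 2 + Real.sinh (r 0) ^ 2 / Real.cosh (r 0) ^ 2) * δ
        + (2 * Real.cosh (r 0) ^ 2 - 3 * Real.sinh (r 0) ^ 2) * Real.sinh (r 0) ^ 2
          / Real.cosh (r 0) ^ 4 * δ * F 0 ^ 2 / V
        - Real.sinh (r 0) ^ 2 / Real.cosh (r 0) ^ 3 * F 0 ^ 2 * V' / V ^ 2 - t'
        + 2 * Real.sinh (r 0) ^ 2 / Real.cosh (r 0) ^ 3 * δ * a 0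
        + Real.sinh (r 0) ^ 2 / Real.cosh (r 0) ^ 2 * a' + c' / V - c 0 * V' / V ^ 2)) / G ^ 2)
      0 := by
  subst hP'
  have hch0 : Real.cosh (r 0) ≠ 0 := (Real.cosh_pos _).ne'
  have hch2 : Real.cosh (r 0) ^ 2 = Real.sinh (r 0) ^ 2 + 1 := Real.cosh_sq _
  -- Since r' = δ sinh r, the square of tanh r changes at the rate 2δ sinh²/cosh³. As n, P and F are
  -- stationary, this is the only source of V'.
  have hth : HasDerivAt (fun s => Real.sinh (r s) ^ 2 / Real.cosh (r s) ^ 2)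
      (2 * Real.sinh (r 0) ^ 2 / Real.cosh (r 0) ^ 3 * δ) 0 := by
    refine HasDerivAt.congr_deriv ((hr.sinh.fun_pow 2).fun_div (hr.cosh.fun_pow 2) (by positivity)) ?_
    field_simp
    simp
    linear_combination 2 * Real.sinh (r 0) ^ 2 * δ * Real.cosh (r 0) * hch2
  have hk : HasDerivAt (fun s => Real.sinh (r s) ^ 2 / Real.cosh (r s) ^ 3)
      ((2 * Real.cosh (r 0) ^ 2 - 3 * Real.sinh (r 0) ^ 2) * Real.sinh (r 0) ^ 2
          / Real.cosh (r 0) ^ 4 * δ) 0 := by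
    refine HasDerivAt.congr_deriv ((hr.sinh.fun_pow 2).fun_div (hr.cosh.fun_pow 3) (by positivity)) ?_
    field_simp
    simp
    ring
  have hVd : HasDerivAt (fun s => 1 + n s * P s
      - Real.sinh (r s) ^ 2 / Real.cosh (r s) ^ 2 * F s ^ 2) V' 0 := by
    refine HasDerivAt.congr_deriv (((hn.fun_mul hP).const_add 1).fun_sub (hth.fun_mul (hF.fun_pow 2))) ?_
    rw [hV']; ring
  have hV0' : 1 + n 0 * P 0 - Real.sinh (r 0) ^ 2 / Real.cosh (r 0) ^ 2 * F 0 ^ 2 = V := by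
    rw [hn1, hV]; ring
  have hGd := (((((hr.cosh.const_mul m).fun_sub ((hasDerivAt_const (0 : ℝ) (1 : ℝ)).fun_div
    hr.cosh hch0)).fun_add ((hk.fun_mul (hF.fun_pow 2)).fun_div hVd (by rwa [hV0']))).fun_sub
    (hn.fun_mul ht)).fun_add (hth.fun_mul ha)).fun_add (hc.fun_div hVd (by rwa [hV0']))
  rw [hV0'] at hGd
  have hG0' : m * Real.cosh (r 0) - 1 / Real.cosh (r 0)
      + Real.sinh (r 0) ^ 2 / Real.cosh (r 0) ^ 3 * F 0 ^ 2 /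
        (1 + n 0 * P 0 - Real.sinh (r 0) ^ 2 / Real.cosh (r 0) ^ 2 * F 0 ^ 2) - n 0 * t 0
      + Real.sinh (r 0) ^ 2 / Real.cosh (r 0) ^ 2 * a 0 + c 0 /
        (1 + n 0 * P 0 - Real.sinh (r 0) ^ 2 / Real.cosh (r 0) ^ 2 * F 0 ^ 2) = G := by
    rw [hV0', hG, hn1]; ring
  refine HasDerivAt.congr_deriv (hVd.fun_div hGd (by rwa [hG0'])) ?_
  rw [hG0', hV0', hn1]
  congr 3
  field_simp
  ring

/-- The derivative of `V / G` in a direction `v` in which `|x|²`, `|∇φ|²` and the Hopf derivative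
of `φ` are stationary. -/
theorem fderiv_graph_speed (b : OrthonormalBasis ι ℝ E) (hJ : IsOrthComplex J)
    (hφ : IsSmoothConic φ)
    {x v : E} (hx : ‖x‖ = 1) (hρ : HasFDerivAt ρ (Real.sinh (ρ x) • fderiv ℝ φ x) x)
    (hxv : ⟪x, v⟫ = 0) (hPv : ⟪gradient φ x, hessOp φ x v⟫ = 0)
    (hFv : ⟪hessOp φ x v, J x⟫ + ⟪gradient φ x, J v⟫ = 0)
    {p q : E} {A T : E →L[ℝ] E} {sh ch V V' G δ F : ℝ} (hp : p = gradient φ x) (hA : A = hessOp φ x)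
    (hT : T = fderiv ℝ (hessOp φ) x v) (hsh : sh = Real.sinh (ρ x)) (hch : ch = Real.cosh (ρ x))
    (hδ : δ = ⟪p, v⟫) (hF : F = ⟪p, J x⟫) (hq : q = graphQ J (ρ x) p x)
    (hV : V = graphV J (ρ x) p x) (hGe : G = graphG J b (ρ x) p A x)
    (hG : 0 < G) (hV' : V' = -(2 * sh ^ 2 / ch ^ 3 * δ * F ^ 2)) {ψ : E → ℝ}
    (hψ : ∀ᶠ y in 𝓝 x, ψ y = graphV J (ρ y) (gradient φ y) y /
      graphG J b (ρ y) (gradient φ y) (hessOp φ y) y)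
    (hψd : DifferentiableAt ℝ ψ x) :
    fderiv ℝ ψ x v = (V' * G - V * ((Fintype.card ι * sh ^ 2 + sh ^ 2 / ch ^ 2) * δ
        + (2 * ch ^ 2 - 3 * sh ^ 2) * sh ^ 2 / ch ^ 4 * δ * F ^ 2 / V
        - sh ^ 2 / ch ^ 3 * F ^ 2 * V' / V ^ 2 - basisTrace b T
        + 2 * sh ^ 2 / ch ^ 3 * δ * ⟪A (J x), J x⟫
        + sh ^ 2 / ch ^ 2 * (⟪T (J x), J x⟫ + 2 * ⟪A (J x), J v⟫)
        + (⟪T q, q⟫ + 2 * ⟪A q, A v - (sh ^ 2 / ch ^ 2 * F) • J v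
            - (2 * sh ^ 2 / ch ^ 3 * δ * F) • J x⟫) / V
        - ⟪A q, q⟫ * V' / V ^ 2)) / G ^ 2 := by
  have hx0 : x ≠ 0 := by rintro rfl; simp at hx
  have hAs : ∀ v w, ⟪A v, w⟫ = ⟪A w, v⟫ := by rw [hA]; exact hφ.hessOp_symm hx0
  have hx0' : x + (0 : ℝ) • v ≠ 0 := by simpa using hx0
  have hn : HasDerivAt (fun s : ℝ => ‖x + s • v‖ ^ 2) 0 0 := by
    refine HasDerivAt.congr_deriv (hasDerivAt_norm_sq_line x v 0) ?_
    simp [hxv]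
  have hg : HasDerivAt (fun s : ℝ => gradient φ (x + s • v)) (A v) 0 := by
    refine HasDerivAt.congr_deriv (hφ.hasDerivAt_gradient hx0') ?_
    simp [hA]
  have hh : HasDerivAt (fun s : ℝ => hessOp φ (x + s • v)) T 0 := by
    refine HasDerivAt.congr_deriv (hφ.hasDerivAt_hessOp hx0') ?_
    simp [hT]
  have hJx : HasDerivAt (fun s : ℝ => J (x + s • v)) (J v) 0 :=
    J.hasFDerivAt.comp_hasDerivAt 0 (hasDerivAt_line x v 0)
  have hr : HasDerivAt (fun s : ℝ => ρ (x + s • v))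
      (Real.sinh (ρ (x + (0 : ℝ) • v)) * δ) 0 := by
    have := HasFDerivAt.comp_hasDerivAt (f := fun s : ℝ => x + s • v) 0 (by simpa using hρ)
      (hasDerivAt_line x v 0)
    have e : Real.sinh (ρ (x + (0 : ℝ) • v)) * δ = (Real.sinh (ρ x) • fderiv ℝ φ x) v := by
      rw [hδ, hp, inner_gradient]; simp
    rw [e]; exact this
  have hP : HasDerivAt (fun s : ℝ => ‖gradient φ (x + s • v)‖ ^ 2) 0 0 := by
    refine HasDerivAt.congr_deriv (hg.norm_sq) ?_
    simp [hA, hPv]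
  have hFd : HasDerivAt (fun s : ℝ => ⟪gradient φ (x + s • v), J (x + s • v)⟫) 0 0 := by
    refine HasDerivAt.congr_deriv (hg.inner ℝ hJx) ?_
    simp only [zero_smul, add_zero]
    rw [hA]; linarith
  have ht := hasDerivAt_basisTrace b hh
  have ha : HasDerivAt (fun s : ℝ => ⟪hessOp φ (x + s • v) (J (x + s • v)), J (x + s • v)⟫)
      (⟪T (J x), J x⟫ + 2 * ⟪A (J x), J v⟫) 0 := by
    refine HasDerivAt.congr_deriv ((hh.clm_apply hJx).inner ℝ hJx) ?_
    simp only [zero_smul, add_zero, inner_add_left, ← hA]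
    rw [hAs (J v)]; ring
  have hch0 : Real.cosh (ρ x) ≠ 0 := (Real.cosh_pos _).ne'
  have hth : HasDerivAt (fun s : ℝ => Real.sinh (ρ (x + s • v)) ^ 2 / Real.cosh (ρ (x + s • v)) ^ 2)
      (2 * sh ^ 2 / ch ^ 3 * δ) 0 := by
    refine HasDerivAt.congr_deriv ((hr.sinh.fun_pow 2).fun_div (hr.cosh.fun_pow 2) (by positivity)) ?_
    simp only [zero_smul, add_zero, hsh, hch]
    field_simp
    simp
    linear_combination 2 * Real.sinh (ρ x) ^ 2 * δ * Real.cosh (ρ x) * Real.cosh_sq (ρ x)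
  have hqd : HasDerivAt (fun s : ℝ => graphQ J (ρ (x + s • v)) (gradient φ (x + s • v))
      (x + s • v)) (A v - (sh ^ 2 / ch ^ 2 * F) • J v - (2 * sh ^ 2 / ch ^ 3 * δ * F) • J x) 0 := by
    refine HasDerivAt.congr_deriv ((hn.fun_smul hg).fun_sub ((hth.fun_mul hFd).fun_smul hJx)) ?_
    simp only [zero_smul, add_zero, hx, one_pow, one_smul, hsh, hch, hF, hp, mul_zero]
    abel
  have hc : HasDerivAt (fun s : ℝ => ⟪hessOp φ (x + s • v) (graphQ J (ρ (x + s • v))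
      (gradient φ (x + s • v)) (x + s • v)), graphQ J (ρ (x + s • v)) (gradient φ (x + s • v))
      (x + s • v)⟫) (⟪T q, q⟫ + 2 * ⟪A q, A v - (sh ^ 2 / ch ^ 2 * F) • J v
            - (2 * sh ^ 2 / ch ^ 3 * δ * F) • J x⟫) 0 := by
    refine HasDerivAt.congr_deriv ((hh.clm_apply hqd).inner ℝ hqd) ?_
    simp only [zero_smul, add_zero, inner_add_left, ← hA, ← hp, ← hq]
    rw [hAs (A v - (sh ^ 2 / ch ^ 2 * F) • J v - (2 * sh ^ 2 / ch ^ 3 * δ * F) • J x) q]; ring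
  have hV0 : V ≠ 0 := by
    have := one_le_graphV hJ (ρ x) p x
    rw [hV]; linarith
  have hquot := hasDerivAt_graph_quotient (m := Fintype.card ι) (V := V) (G := G) (V' := V')
    hn (by simp [hx]) hP rfl hFd ht ha hc hr
    (by simp [hV, graphV, hx, hp]) hV0
    (by simp only [zero_smul, add_zero]; rw [hGe, graphG, ← hV, hx, ← hA, ← hp]; ring) hG.ne'
    (by simp [hV', hsh, hch, hF, hp])
  have hline : HasDerivAt (fun s : ℝ => ψ (x + s • v)) (fderiv ℝ ψ x v) 0 :=
    HasFDerivAt.comp_hasDerivAt (f := fun s : ℝ => x + s • v) 0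
      (by simpa using hψd.hasFDerivAt) (hasDerivAt_line x v 0)
  have hev : ∀ᶠ s : ℝ in 𝓝 0, ψ (x + s • v) = graphV J (ρ (x + s • v)) (gradient φ (x + s • v))
      (x + s • v) / graphG J b (ρ (x + s • v)) (gradient φ (x + s • v)) (hessOp φ (x + s • v))
      (x + s • v) := by
    have : Tendsto (fun s : ℝ => x + s • v) (𝓝 0) (𝓝 x) := by
      have := (hasDerivAt_line x v 0).continuousAt.tendsto
      simpa using this
    exact this.eventually hψ
  rw [hline.unique (hquot.congr_of_eventuallyEq hev)]
  simp only [zero_smul, add_zero, ← hA, ← hp, ← hq, ← hsh, ← hch, ← hF]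

/-- At a maximum point of `|∇φ|²` of a circle invariant `φ`, the graph operator decreases
`|∇φ|²` at the rate `2 / m`. -/
theorem gradSq_decay (b : OrthonormalBasis ι ℝ E) (hJ : IsOrthComplex J) (hφ : IsSmoothConic φ)
    {x : E} (hx : ‖x‖ = 1) (hρ : HasFDerivAt ρ (Real.sinh (ρ x) • fderiv ℝ φ x) x)
    (hf : ∀ y, y ≠ 0 → ⟪gradient φ y, J y⟫ = 0)
    (hmax : ∀ y, ‖y‖ = 1 → ‖y‖ ^ 2 * ‖gradient φ y‖ ^ 2 ≤ ‖x‖ ^ 2 * ‖gradient φ x‖ ^ 2)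
    (hG : 0 < graphG J b (ρ x) (gradient φ x) (hessOp φ x) x) {ψ : E → ℝ}
    (hψ : ∀ᶠ y in 𝓝 x, ψ y = graphV J (ρ y) (gradient φ y) y /
      graphG J b (ρ y) (gradient φ y) (hessOp φ y) y)
    (hψd : DifferentiableAt ℝ ψ x) :
    2 * fderiv ℝ ψ x (gradient φ x) ≤ -(2 / Fintype.card ι) * ‖gradient φ x‖ ^ 2 := by
  have hx0 : x ≠ 0 := by rintro rfl; simp at hx
  -- The identity ⟪∇φ(y), J y⟫ = 0, differentiated in y: this prescribes the Hessian in the Hopf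
  -- direction.
  have hAJ : ∀ y, y ≠ 0 → hessOp φ y (J y) = J (gradient φ y) := by
    intro y hy
    refine ext_inner_right ℝ fun v => ?_
    have h1 : HasFDerivAt (fun y => ⟪gradient φ y, J y⟫) _ y :=
      (hφ.hasFDerivAt_gradient hy).inner ℝ J.hasFDerivAt
    have h2 : HasFDerivAt (fun y => ⟪gradient φ y, J y⟫) (0 : E →L[ℝ] ℝ) y :=
      (hasFDerivAt_const (0 : ℝ) y).congr_of_eventuallyEq
        ((hφ.eventually_ne hy).mono fun y hy => hf y hy)
    have h3 : ⟪gradient φ y, J v⟫ + ⟪hessOp φ y v, J y⟫ = 0 := by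
      have := congrArg (fun L => L v) (h1.unique h2)
      simpa only [ContinuousLinearMap.comp_apply, ContinuousLinearMap.prod_apply,
        fderivInnerCLM_apply, zero_apply] using this
    rw [hφ.hessOp_symm hy, hJ.skew]
    linarith
  have hAJJ : ∀ y, y ≠ 0 → ⟪hessOp φ y (J y), J y⟫ = 0 := fun y hy => by
    rw [hAJ y hy, hJ.inner_map_map, hφ.inner_gradient_self hy]
  set p := gradient φ x with hp
  set A := hessOp φ x with hA
  set T := fderiv ℝ (hessOp φ) x with hT
  have hpx : ⟪p, x⟫ = 0 := hφ.inner_gradient_self hx0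
  have hxp : ⟪x, p⟫ = 0 := by rw [real_inner_comm]; exact hpx
  have hpp : ⟪p, p⟫ = ‖p‖ ^ 2 := real_inner_self_eq_norm_sq p
  have hAs : ∀ v w, ⟪A v, w⟫ = ⟪A w, v⟫ := hφ.hessOp_symm hx0
  -- the conditions at the maximum
  have hcond : ∀ v, 2 * ⟪x, v⟫ * ‖p‖ ^ 2 + 2 * ⟪p, A v⟫ = 0 ∧
      2 * ⟪v, v⟫ * ‖p‖ ^ 2 + 8 * ⟪x, v⟫ * ⟪p, A v⟫ + 2 * (⟪A v, A v⟫ + ⟪p, T v v⟫) ≤ 0 := by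
    intro v
    -- The factor ‖y‖² makes the quantity constant along rays, so all directions v may be tested,
    -- not only those tangent to the sphere.
    have hloc := isLocalMax_line (w := fun y => ‖y‖ ^ 2 * ‖gradient φ y‖ ^ 2)
      (fun c hc y hy => by
        rw [hφ.gradient_smul hc hy, norm_smul, norm_smul, norm_inv, Real.norm_of_nonneg hc.le]
        field_simp) hx hmax v
    have h1 : ∀ᶠ s in 𝓝 0, HasDerivAt
        (fun s : ℝ => ‖x + s • v‖ ^ 2 * ‖gradient φ (x + s • v)‖ ^ 2)
        (2 * ⟪x + s • v, v⟫ * ‖gradient φ (x + s • v)‖ ^ 2 + ‖x + s • v‖ ^ 2 *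
          (2 * ⟪gradient φ (x + s • v), hessOp φ (x + s • v) v⟫)) s := by
      filter_upwards [eventually_line_ne hx0 v] with s hs
      exact (hasDerivAt_norm_sq_line x v s).mul (hφ.hasDerivAt_gradient hs).norm_sq
    have hx0' : x + (0 : ℝ) • v ≠ 0 := by simpa using hx0
    have hg := hφ.hasDerivAt_gradient hx0'
    have hh : HasDerivAt (fun s : ℝ => hessOp φ (x + s • v) v) (T v v) 0 := by
      have := (hφ.hasDerivAt_hessOp hx0').clm_apply (hasDerivAt_const 0 v)
      simpa using this
    have h2 := ((((hasDerivAt_line x v 0).inner ℝ (hasDerivAt_const 0 v)).const_mul 2).mul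
      hg.norm_sq).add ((hasDerivAt_norm_sq_line x v 0).mul ((hg.inner ℝ hh).const_mul 2))
    obtain ⟨e1, e2⟩ := first_second_order_conditions
      (w := fun y => ‖y‖ ^ 2 * ‖gradient φ y‖ ^ 2) hloc h1 h2
    simp only [zero_smul, add_zero, inner_zero_right, zero_add, ← hp, ← hA, hx] at e1 e2
    constructor <;> linarith
  have hpA : ∀ v, ⟪p, A v⟫ = -(‖p‖ ^ 2 * ⟪x, v⟫) := fun v => by linarith [(hcond v).1]
  have hAp : A p = -(‖p‖ ^ 2 • x) := by
    refine ext_inner_right ℝ fun v => ?_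
    rw [hAs, real_inner_comm, hpA, inner_neg_left, inner_smul_left]; simp
  -- S is minus half the Hessian of ‖y‖²‖∇φ‖² at the maximum, after the first order condition ⟪p, A
  -- v⟫ = −‖p‖²⟪x, v⟫ is inserted.
  set S : E →L[ℝ] E := (4 * ‖p‖ ^ 2) • (innerSL ℝ x).smulRight x
    - ‖p‖ ^ 2 • ContinuousLinearMap.id ℝ E - (A.comp A + T p) with hS
  have hSa : ∀ v w, ⟪S v, w⟫ = 4 * ‖p‖ ^ 2 * (⟪x, v⟫ * ⟪x, w⟫) - ‖p‖ ^ 2 * ⟪v, w⟫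
      - (⟪A v, A w⟫ + ⟪T p v, w⟫) := fun v w => by
    simp only [hS, sub_apply, smul_apply, add_apply,
      ContinuousLinearMap.smulRight_apply, innerSL_apply_apply, ContinuousLinearMap.comp_apply,
      ContinuousLinearMap.id_apply, inner_sub_left, inner_add_left, inner_smul_left, conj_trivial,
      hAs (A v) w, real_inner_comm (A v) (A w)]
  have hS0 : ∀ v, 0 ≤ ⟪S v, v⟫ := fun v => by
    have hTv : ⟪p, T v v⟫ = ⟪T p v, v⟫ := by
      rw [real_inner_comm, hφ.fderiv_hessOp_symm hx0, hφ.fderiv_hessOp_swap hx0]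
    have := (hcond v).2
    rw [hpA, hTv] at this
    rw [hSa]
    nlinarith
  have htr : basisTrace b S = 4 * ‖p‖ ^ 2 - ‖p‖ ^ 2 * Fintype.card ι
      - (∑ k, ‖A (b k)‖ ^ 2 + basisTrace b (T p)) := by
    rw [hS, basisTrace_sub, basisTrace_sub, basisTrace_smul, basisTrace_smul, basisTrace_rankOne,
      basisTrace_id, basisTrace_add, real_inner_self_eq_norm_sq, hx]
    have : basisTrace b (A.comp A) = ∑ k, ‖A (b k)‖ ^ 2 :=
      Finset.sum_congr rfl fun k _ => by
        rw [ContinuousLinearMap.comp_apply, hAs, real_inner_self_eq_norm_sq]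
    rw [this]; ring
  -- Because the Hopf derivative vanishes, the inverse metric in the equation acts as 1 − p ⊗ p / V;
  -- this is the case θ = 0.
  have hell := trace_inverse_metric_nonneg b hS0 hx (p := p) (θ := 0) (by norm_num)
  simp only [zero_mul, zero_smul, sub_zero] at hell
  rw [htr, hSa, hAp, inner_neg_neg, inner_smul_left, inner_smul_right, hxp, hpp,
    real_inner_self_eq_norm_sq x, hx] at hell
  simp only [conj_trivial] at hell
  have hA2 := sum_norm_sq_ge b hJ hAs hx hpx (hf x hx0) (hφ.hessOp_self hx0) (hAJ x hx0)
  -- The function ⟪A(J y), J y⟫ vanishes identically, so its derivative along p does too. This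
  -- removes the term with tanh² from the derivative of G.
  have ha0 : ⟪T p (J x), J x⟫ + 2 * ⟪A (J x), J p⟫ = 0 := by
    have hx0' : x + (0 : ℝ) • p ≠ 0 := by simpa using hx0
    have hJx : HasDerivAt (fun s : ℝ => J (x + s • p)) (J p) 0 :=
      J.hasFDerivAt.comp_hasDerivAt 0 (hasDerivAt_line x p 0)
    have h1 := ((hφ.hasDerivAt_hessOp hx0').clm_apply hJx).inner ℝ hJx
    have h2 := h1.unique ((hasDerivAt_const (0 : ℝ) (0 : ℝ)).congr_of_eventuallyEq
      ((eventually_line_ne hx0 p).mono fun s hs => hAJJ _ hs))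
    simp only [zero_smul, add_zero, inner_add_left, ← hA, ← hT] at h2
    rw [hAs (J p)] at h2; linarith
  have hfx : ⟪p, J x⟫ = 0 := hf x hx0
  have hQ : graphQ J (ρ x) p x = p := by simp [graphQ, hfx, hx]
  have hVe : graphV J (ρ x) p x = 1 + ‖p‖ ^ 2 := by simp [graphV, hfx, hx]
  have hGe := graphG_of_inner_eq_zero b (ρ x) A (x := x) hfx (hAJJ x hx0)
  rw [hx, hAp, inner_neg_left, inner_smul_left, hxp] at hGe
  have hder := fderiv_graph_speed b hJ hφ hx hρ hxp (by rw [← hp, ← hA, hpA, hxp]; ring)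
    (by rw [← hp, ← hA, hAp, inner_neg_left, inner_smul_left, hJ.inner_self',
      hJ.inner_self']; simp) hp hA (congrArg (fun L => L p) hT) rfl rfl
    rfl rfl rfl rfl rfl hG rfl hψ hψd
  have haJ : ⟪A (J x), J x⟫ = 0 := hAJJ x hx0
  rw [hfx, hQ, ha0, hVe, hAp, haJ] at hder
  set G := graphG J b (ρ x) p A x
  rw [hder]
  simp only [inner_sub_right, inner_neg_right, inner_neg_left, inner_smul_left, inner_smul_right,
    hxp, real_inner_self_eq_norm_sq, hx, conj_trivial, hJ.inner_self', hpp]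
  set sh := Real.sinh (ρ x)
  set ch := Real.cosh (ρ x) with hch
  have hchpos : 0 < ch := Real.cosh_pos _
  have hch2 : ch ^ 2 = sh ^ 2 + 1 := Real.cosh_sq _
  rcases Nat.eq_zero_or_pos (Fintype.card ι) with h0 | h0
  · rw [Fintype.card_eq_zero_iff] at h0
    have h1 := b.sum_inner_mul_inner x x
    simp [hx] at h1
  have hm : (0 : ℝ) < Fintype.card ι := by exact_mod_cast h0
  set m : ℝ := (Fintype.card ι : ℝ)
  set V := 1 + ‖p‖ ^ 2 with hV
  have hVpos : 0 < V := by positivity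
  set s := -basisTrace b A with hs
  -- Here ⟪A p, p⟫ = 0, since A p is radial; the only term discarded is −1/cosh.
  have hGle : G ≤ m * ch + s := by
    rw [hGe, hs]
    have : 0 < 1 / ch := by positivity
    simp only [mul_zero, neg_zero, zero_div]
    linarith
  -- D is the derivative of G along p. The Hopf derivative vanishes, so V is stationary along p and
  -- the speed V / G has derivative −V D / G².
  set D := (m * sh ^ 2 + sh ^ 2 / ch ^ 2) * ‖p‖ ^ 2 - basisTrace b (T p)
    + (⟪T p p, p⟫ + 2 * (‖p‖ ^ 2 * ‖p‖ ^ 2)) / V with hD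
  -- The term m sinh² comes from differentiating cosh ρ and a further m from the trace of S; they
  -- add up to m cosh². The 4‖p‖² in the trace of S is absorbed by the gain in `hA2`.
  have hDge : ‖p‖ ^ 2 * (m * ch ^ 2) + s ^ 2 / m ≤ D := by
    have e1 : (4 * ‖p‖ ^ 2 * (0 * 0) - ‖p‖ ^ 2 * ‖p‖ ^ 2 - (‖p‖ ^ 2 * (‖p‖ ^ 2 * 1 ^ 2)
        + ⟪(T p) p, p⟫)) / V = -((⟪T p p, p⟫ + 2 * (‖p‖ ^ 2 * ‖p‖ ^ 2)) / V) := by ring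
    rw [e1] at hell
    have e2 : 0 ≤ sh ^ 2 / ch ^ 2 * ‖p‖ ^ 2 := by positivity
    have e3 : basisTrace b A ^ 2 = s ^ 2 := by rw [hs]; ring
    rw [e3] at hA2
    have e4 : ‖p‖ ^ 2 * (m * ch ^ 2) = m * sh ^ 2 * ‖p‖ ^ 2 + ‖p‖ ^ 2 * m := by rw [hch2]; ring
    rw [hD, e4]
    linarith
  have hGp : 0 < G := hG
  have key : ‖p‖ ^ 2 * G ^ 2 ≤ m * (V * D) := by
    have h1 : G ^ 2 ≤ (m * ch + s) ^ 2 := pow_le_pow_left₀ hGp.le hGle 2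
    have h2 : V * (‖p‖ ^ 2 * (m * ch) ^ 2 + s ^ 2) ≤ m * (V * D) := by
      have := mul_le_mul_of_nonneg_left hDge (show 0 ≤ m * V by positivity)
      calc _ = m * V * (‖p‖ ^ 2 * (m * ch ^ 2) + s ^ 2 / m) := by field_simp
        _ ≤ _ := this
        _ = _ := by ring
    -- With V = 1 + ‖p‖² the defect is a perfect square. This is what makes the rate 2 / m come out
    -- without further loss.
    have h3 : V * (‖p‖ ^ 2 * (m * ch) ^ 2 + s ^ 2) - ‖p‖ ^ 2 * (m * ch + s) ^ 2
        = (‖p‖ ^ 2 * (m * ch) - s) ^ 2 := by rw [hV]; ring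
    have h4 := mul_le_mul_of_nonneg_left h1 (sq_nonneg ‖p‖)
    have h5 := sq_nonneg (‖p‖ ^ 2 * (m * ch) - s)
    linarith
  have e : ∀ R : ℝ, R = -(V * D) / G ^ 2 → 2 * R ≤ -(2 / m) * ‖p‖ ^ 2 := by
    rintro R rfl
    rw [← sub_nonneg]
    have : -(2 / m) * ‖p‖ ^ 2 - 2 * (-(V * D) / G ^ 2)
        = 2 / (m * G ^ 2) * (m * (V * D) - ‖p‖ ^ 2 * G ^ 2) := by field_simp; ring
    rw [this]
    exact mul_nonneg (by positivity) (by linarith)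
  apply e
  rw [hD]
  congr 1
  simp only [neg_mul, mul_neg]
  ring

/-- At a maximum point of the square of the Hopf derivative `f` of `φ`, the graph operator
increases `f²` at most at a rate proportional to `f²`. -/
theorem hopfDeriv_growth (b : OrthonormalBasis ι ℝ E) (hJ : IsOrthComplex J)
    (hφ : IsSmoothConic φ)
    {x : E} (hx : ‖x‖ = 1) (hρ : HasFDerivAt ρ (Real.sinh (ρ x) • fderiv ℝ φ x) x)
    (hne : ⟪gradient φ x, J x⟫ ≠ 0)
    (hmax : ∀ y, ‖y‖ = 1 → ⟪gradient φ y, J y⟫ ^ 2 ≤ ⟪gradient φ x, J x⟫ ^ 2)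
    (hG : 0 < graphG J b (ρ x) (gradient φ x) (hessOp φ x) x) {ψ : E → ℝ}
    (hψ : ∀ᶠ y in 𝓝 x, ψ y = graphV J (ρ y) (gradient φ y) y /
      graphG J b (ρ y) (gradient φ y) (hessOp φ y) y)
    (hψd : DifferentiableAt ℝ ψ x) :
    ⟪gradient φ x, J x⟫ * fderiv ℝ ψ x (J x) ≤
      graphV J (ρ x) (gradient φ x) x *
        |graphK (Fintype.card ι) J (ρ x) (gradient φ x) (hessOp φ x) x| /
        graphG J b (ρ x) (gradient φ x) (hessOp φ x) x ^ 2 * ⟪gradient φ x, J x⟫ ^ 2 := by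
  have hx0 : x ≠ 0 := by rintro rfl; simp at hx
  set p := gradient φ x with hp
  set A := hessOp φ x with hA
  set T := fderiv ℝ (hessOp φ) x with hT
  set F := ⟪p, J x⟫ with hF
  have hAs : ∀ v w, ⟪A v, w⟫ = ⟪A w, v⟫ := hφ.hessOp_symm hx0
  have hcond : ∀ v, ⟪A v, J x⟫ + ⟪p, J v⟫ = 0 ∧ F * (⟪T v v, J x⟫ + 2 * ⟪A v, J v⟫) ≤ 0 := by
    intro v
    have hloc := isLocalMax_line (w := fun y => ⟪gradient φ y, J y⟫ ^ 2)
      (fun c hc y hy => by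
        rw [hφ.gradient_smul hc hy, map_smul, inner_smul_left, inner_smul_right]
        simp only [conj_trivial]
        field_simp) hx hmax v
    have hJx : ∀ s, HasDerivAt (fun s : ℝ => J (x + s • v)) (J v) s := fun s =>
      J.hasFDerivAt.comp_hasDerivAt s (hasDerivAt_line x v s)
    have hf : ∀ s : ℝ, x + s • v ≠ 0 → HasDerivAt
        (fun s : ℝ => ⟪gradient φ (x + s • v), J (x + s • v)⟫)
        (⟪gradient φ (x + s • v), J v⟫ + ⟪hessOp φ (x + s • v) v, J (x + s • v)⟫) s :=
      fun s hs => (hφ.hasDerivAt_gradient hs).inner ℝ (hJx s)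
    have h1 : ∀ᶠ s in 𝓝 0, HasDerivAt
        (fun s : ℝ => ⟪gradient φ (x + s • v), J (x + s • v)⟫ ^ 2)
        (2 * ⟪gradient φ (x + s • v), J (x + s • v)⟫ *
          (⟪gradient φ (x + s • v), J v⟫ + ⟪hessOp φ (x + s • v) v, J (x + s • v)⟫)) s := by
      filter_upwards [eventually_line_ne hx0 v] with s hs
      refine ((hf s hs).fun_pow 2).congr_deriv ?_
      simp
    have hx0' : x + (0 : ℝ) • v ≠ 0 := by simpa using hx0
    have hg := hφ.hasDerivAt_gradient hx0'
    have hh : HasDerivAt (fun s : ℝ => hessOp φ (x + s • v) v) (T v v) 0 := by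
      have := (hφ.hasDerivAt_hessOp hx0').clm_apply (hasDerivAt_const 0 v)
      simpa using this
    have h2 := ((hf 0 hx0').const_mul 2).fun_mul
      ((hg.inner ℝ (hasDerivAt_const 0 (J v))).fun_add (hh.inner ℝ (hJx 0)))
    obtain ⟨e1, e2⟩ := first_second_order_conditions
      (w := fun y => ⟪gradient φ y, J y⟫ ^ 2) hloc h1 h2
    simp only [zero_smul, add_zero, inner_zero_right, zero_add, ← hp, ← hA, ← hF] at e1 e2
    have e3 : ⟪p, J v⟫ + ⟪A v, J x⟫ = 0 := by
      rcases mul_eq_zero.mp e1 with h | h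
      · exact absurd (by linarith : F = 0) hne
      · exact h
    rw [e3] at e2
    constructor <;> linarith
  -- Since F ≠ 0, stationarity of F² is stationarity of F. The identity that invariance would give
  -- everywhere thus holds at the maximum point, so that ‖∇φ‖² and F are stationary in the Hopf
  -- direction as well.
  have hAJ : A (J x) = J p := by
    refine ext_inner_right ℝ fun v => ?_
    rw [hAs, hJ.skew]
    linarith [(hcond v).1]
  have hxJx : ⟪x, J x⟫ = 0 := hJ.inner_self' x
  have hδ : ⟪p, J x⟫ = F := rfl
  set q := graphQ J (ρ x) p x with hq
  set V := graphV J (ρ x) p x with hV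
  set G := graphG J b (ρ x) p A x with hGdef
  set sh := Real.sinh (ρ x) with hsh
  set ch := Real.cosh (ρ x) with hch
  have hqe : q = p - (sh ^ 2 / ch ^ 2 * F) • J x := by
    rw [hq, graphQ, hx, ← hF, ← hsh, ← hch]; simp
  have hder := fderiv_graph_speed b hJ hφ hx hρ hxJx (by
      rw [← hp, ← hA, hAJ, hJ.inner_self'])
    (by
      rw [← hp, ← hA, hAJ, hJ.inner_map_map, hJ.sq, inner_neg_right]; ring)
    hp hA (congrArg (fun L => L (J x)) hT) hsh hch rfl hF hq hV hGdef hG rfl hψ hψd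
  rw [← hF] at hder
  -- As a quadratic form, S is −F times the Hessian of the Hopf derivative, nonnegative at a maximum
  -- of its square. The two terms with J and A have opposite traces.
  set S : E →L[ℝ] E := -F • (T (J x) - J.comp A + A.comp J) with hS
  have hSa : ∀ v, ⟪S v, v⟫ = -F * (⟪T (J x) v, v⟫ + 2 * ⟪A v, J v⟫) := fun v => by
    simp only [hS, sub_apply, smul_apply, add_apply, ContinuousLinearMap.comp_apply,
      inner_add_left, inner_sub_left, inner_smul_left, conj_trivial, hJ.skew, hAs (J v)]
    ring
  have hS0 : ∀ v, 0 ≤ ⟪S v, v⟫ := fun v => by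
    have h1 : ⟪T v v, J x⟫ = ⟪T (J x) v, v⟫ := by
      rw [hφ.fderiv_hessOp_symm hx0, hφ.fderiv_hessOp_swap hx0]
    have := (hcond v).2
    rw [h1] at this
    rw [hSa]; linarith
  have htr : basisTrace b S = -F * basisTrace b (T (J x)) := by
    rw [hS, basisTrace_smul, basisTrace_add, basisTrace_sub, basisTrace_comp_comm b A J]
    ring
  have hell := trace_inverse_metric_nonneg b hS0 (p := p) (ξ := J x) (by rw [hJ.norm_map, hx])
    (tanh_sq_le_one (ρ x))
  have hVe : V = 1 + ‖p‖ ^ 2 - sh ^ 2 / ch ^ 2 * F ^ 2 := by rw [hV, graphV, hx, ← hF]; ring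
  rw [← hF, ← hsh, ← hch, ← hqe, htr, hSa, hSa, ← hVe] at hell
  have hV1 : 1 ≤ V := one_le_graphV hJ (ρ x) p x
  have hVpos : 0 < V := by linarith
  have hchpos : 0 < ch := Real.cosh_pos _
  -- Along the Hopf direction q rotates with J, apart from the change of tanh² ρ.
  have hqv : A (J x) - (sh ^ 2 / ch ^ 2 * F) • J (J x) = J q := by
    rw [hqe, map_sub, map_smul, hAJ]
  rw [hqv] at hder
  have hK : graphK (Fintype.card ι) J (ρ x) p A x =
      Fintype.card ι * sh ^ 2 + sh ^ 2 / ch ^ 2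
    + (2 * ch ^ 2 - 3 * sh ^ 2) * sh ^ 2 / ch ^ 4 * F ^ 2 / V
    + sh ^ 2 / ch ^ 3 * (2 * sh ^ 2 / ch ^ 3) * F ^ 4 / V ^ 2
    + 2 * sh ^ 2 / ch ^ 3 * ⟪A (J x), J x⟫
    - 2 * (2 * sh ^ 2 / ch ^ 3) * F * ⟪A q, J x⟫ / V
    + 2 * sh ^ 2 / ch ^ 3 * F ^ 2 * ⟪A q, q⟫ / V ^ 2 := rfl
  set K := graphK (Fintype.card ι) J (ρ x) p A x
  set L := -F * basisTrace b (T (J x)) - sh ^ 2 / ch ^ 2 *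
    (-F * (⟪T (J x) (J x), J x⟫ + 2 * ⟪A (J x), J (J x)⟫))
    - -F * (⟪T (J x) q, q⟫ + 2 * ⟪A q, J q⟫) / V with hL
  -- The third derivatives of φ occur only through L, the trace of S for the inverse metric, which
  -- is nonnegative. Everything else is either of the right sign or a multiple of F².
  have hfin : F * fderiv ℝ ψ x (J x) =
      -(2 * sh ^ 2 / ch ^ 3 * F ^ 4) / G - V * L / G ^ 2 - V * K / G ^ 2 * F ^ 2 := by
    rw [hder, hK, hL, inner_sub_right, inner_smul_right]
    field_simp
    ring
  rw [hfin]
  have h1 : 0 ≤ 2 * sh ^ 2 / ch ^ 3 * F ^ 4 / G := by positivity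
  have h2 : 0 ≤ V * L / G ^ 2 := by positivity
  have h3 : -(V * K / G ^ 2 * F ^ 2) ≤ V * |K| / G ^ 2 * F ^ 2 := by
    have : V * (-K) / G ^ 2 * F ^ 2 ≤ V * |K| / G ^ 2 * F ^ 2 := by
      gcongr
      exact neg_le_abs K
    calc _ = V * (-K) / G ^ 2 * F ^ 2 := by ring
      _ ≤ _ := this
  have h4 : -(2 * sh ^ 2 / ch ^ 3 * F ^ 4) / G = -(2 * sh ^ 2 / ch ^ 3 * F ^ 4 / G) := by ring
  linarith

end GraphOperator

end CHFlow

namespace CHFlow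

open scoped ContDiff Topology RealInnerProductSpace
open Set Filter Function

/-! ### The graph equation: estimates in time -/

/-- A primitive of `1 / sinh` on the positive half line. -/
noncomputable def potential (r : ℝ) : ℝ := Real.log (Real.sinh (r / 2)) - Real.log (Real.cosh (r / 2))

theorem hasDerivAt_potential {r : ℝ} (hr : 0 < r) :
    HasDerivAt potential (1 / Real.sinh r) r := by
  have hs : 0 < Real.sinh (r / 2) := Real.sinh_pos_iff.mpr (by linarith)
  have hc : 0 < Real.cosh (r / 2) := Real.cosh_pos _
  have h2 : HasDerivAt (fun r : ℝ => r / 2) (1 / 2) r := (hasDerivAt_id r).div_const 2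
  refine ((h2.sinh.log hs.ne').fun_sub (h2.cosh.log hc.ne')).congr_deriv ?_
  have : Real.sinh r = 2 * Real.sinh (r / 2) * Real.cosh (r / 2) := by
    rw [← Real.sinh_two_mul]; congr 1; ring
  rw [this]
  field_simp
  have := Real.cosh_sq (r / 2)
  linarith

theorem contDiffOn_potential : ContDiffOn ℝ ∞ potential (Ioi 0) := by
  intro r hr
  have hr : 0 < r := hr
  have hs : 0 < Real.sinh (r / 2) := Real.sinh_pos_iff.mpr (by linarith)
  have hc : 0 < Real.cosh (r / 2) := Real.cosh_pos _
  have h2 : ContDiff ℝ ∞ (fun r : ℝ => r / 2) := contDiff_id.div_const 2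
  exact (((Real.contDiff_sinh.comp h2).contDiffAt.log hs.ne').sub
    ((Real.contDiff_cosh.comp h2).contDiffAt.log hc.ne')).contDiffWithinAt

theorem strictMonoOn_potential : StrictMonoOn potential (Ioi 0) := by
  refine strictMonoOn_of_deriv_pos (convex_Ioi 0) contDiffOn_potential.continuousOn fun r hr => ?_
  rw [interior_Ioi] at hr
  rw [(hasDerivAt_potential hr).deriv]
  have : 0 < Real.sinh r := Real.sinh_pos_iff.mpr hr
  positivity

section GraphSolution

variable {E ι : Type*} [NormedAddCommGroup E] [InnerProductSpace ℝ E] [FiniteDimensional ℝ E]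
  [Fintype ι]

set_option linter.unusedSectionVars false

/-- Serves only to bound the growth coefficient on compact time intervals. No uniform bound is
needed, because the Hopf derivative starts from zero. -/
theorem continuousOn_graph_coefficient {J : E →L[ℝ] E} (b : OrthonormalBasis ι ℝ E)
    (hJ : IsOrthComplex J) {X : Type*} [TopologicalSpace X] {D : Set X} {r : X → ℝ} {p y : X → E}
    {A : X → E →L[ℝ] E} (hr : ContinuousOn r D) (hp : ContinuousOn p D) (hA : ContinuousOn A D)
    (hx : ContinuousOn y D) (hG0 : ∀ z ∈ D, 0 < graphG J b (r z) (p z) (A z) (y z)) :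
    ContinuousOn (fun z => graphV J (r z) (p z) (y z) *
        |graphK (Fintype.card ι) J (r z) (p z) (A z) (y z)| /
        graphG J b (r z) (p z) (A z) (y z) ^ 2) D := by
  have hsh : ContinuousOn (fun z => Real.sinh (r z)) D := Real.continuous_sinh.comp_continuousOn hr
  have hch : ContinuousOn (fun z => Real.cosh (r z)) D := Real.continuous_cosh.comp_continuousOn hr
  have hch0 : ∀ z, Real.cosh (r z) ≠ 0 := fun z => (Real.cosh_pos _).ne'
  have hJx : ContinuousOn (fun z => J (y z)) D := J.continuous.comp_continuousOn hx
  have hf : ContinuousOn (fun z => ⟪p z, J (y z)⟫) D := hp.inner hJx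
  have hdiv : ∀ i j : ℕ, ContinuousOn (fun z => Real.sinh (r z) ^ i / Real.cosh (r z) ^ j) D :=
    fun i j => (hsh.pow i).div (hch.pow j) fun z _ => pow_ne_zero j (hch0 z)
  have hdiv2 : ∀ i j : ℕ, ContinuousOn (fun z => 2 * Real.sinh (r z) ^ i / Real.cosh (r z) ^ j) D :=
    fun i j => (continuousOn_const.mul (hsh.pow i)).div (hch.pow j) fun z _ => pow_ne_zero j (hch0 z)
  have hV : ContinuousOn (fun z => graphV J (r z) (p z) (y z)) D :=
    (continuousOn_const.add ((hx.norm.pow 2).mul (hp.norm.pow 2))).sub ((hdiv 2 2).mul (hf.pow 2))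
  have hV0 : ∀ z, graphV J (r z) (p z) (y z) ≠ 0 := fun z => by
    have := one_le_graphV hJ (r z) (p z) (y z)
    linarith
  have hV2 : ∀ z, graphV J (r z) (p z) (y z) ^ 2 ≠ 0 := fun z => pow_ne_zero 2 (hV0 z)
  have hQ : ContinuousOn (fun z => graphQ J (r z) (p z) (y z)) D :=
    ((hx.norm.pow 2).smul hp).sub (((hdiv 2 2).mul hf).smul hJx)
  have hAQ := hA.clm_apply hQ
  have htr : ContinuousOn (fun z => basisTrace b (A z)) D :=
    continuousOn_finsetSum _ fun k _ => (hA.clm_apply continuousOn_const).inner continuousOn_const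
  have hAQQ : ContinuousOn (fun z => ⟪A z (graphQ J (r z) (p z) (y z)),
    graphQ J (r z) (p z) (y z)⟫) D := hAQ.inner hQ
  have hAQJ : ContinuousOn (fun z => ⟪A z (graphQ J (r z) (p z) (y z)), J (y z)⟫) D :=
    hAQ.inner hJx
  have hAJJ : ContinuousOn (fun z => ⟪A z (J (y z)), J (y z)⟫) D := (hA.clm_apply hJx).inner hJx
  have hG : ContinuousOn (fun z => graphG J b (r z) (p z) (A z) (y z)) D :=
    (((((continuousOn_const.mul hch).sub (continuousOn_const.div hch fun z _ => hch0 z)).add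
      (((hdiv 2 3).mul (hf.pow 2)).div hV fun z _ => hV0 z)).sub ((hx.norm.pow 2).mul htr)).add
      ((hdiv 2 2).mul hAJJ)).add (hAQQ.div hV fun z _ => hV0 z)
  have hK : ContinuousOn (fun z => graphK (Fintype.card ι) J (r z) (p z) (A z) (y z)) D := by
    have h24 : ContinuousOn (fun z => (2 * Real.cosh (r z) ^ 2 - 3 * Real.sinh (r z) ^ 2) *
        Real.sinh (r z) ^ 2 / Real.cosh (r z) ^ 4) D :=
      (((continuousOn_const.mul (hch.pow 2)).sub (continuousOn_const.mul (hsh.pow 2))).mul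
        (hsh.pow 2)).div (hch.pow 4) fun z _ => pow_ne_zero 4 (hch0 z)
    exact ((((((continuousOn_const.mul (hsh.pow 2)).add (hdiv 2 2)).add
      ((h24.mul (hf.pow 2)).div hV fun z _ => hV0 z)).add
      ((((hdiv 2 3).mul (hdiv2 2 3)).mul (hf.pow 4)).div (hV.pow 2) fun z _ => hV2 z)).add
      ((hdiv2 2 3).mul hAJJ)).sub
      ((((continuousOn_const.mul (hdiv2 2 3)).mul hf).mul hAQJ).div hV fun z _ => hV0 z)).add
      ((((hdiv2 2 3).mul (hf.pow 2)).mul hAQQ).div (hV.pow 2) fun z _ => hV2 z)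
  exact (hV.mul hK.abs).div (hG.pow 2) fun z hz => pow_ne_zero 2 (hG0 z hz).ne'

/-- The radial functions `ρ t`, extended to be constant along rays, of a family of star-shaped
hypersurfaces that moves by the inverse mean curvature flow. -/
structure IsGraphSolution (J : E →L[ℝ] E) (b : OrthonormalBasis ι ℝ E) (τ : ℝ)
    (ρ : ℝ → E → ℝ) : Prop where
  smooth : ContDiffOn ℝ ∞ (uncurry ρ) (Ico 0 τ ×ˢ {0}ᶜ)
  pos : ∀ t ∈ Ico 0 τ, ∀ x, x ≠ 0 → 0 < ρ t x
  homog : ∀ t ∈ Ico 0 τ, ∀ c : ℝ, 0 < c → ∀ x, x ≠ 0 → ρ t (c • x) = ρ t x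
  den_pos : ∀ t ∈ Ico 0 τ, ∀ x, x ≠ 0 →
    0 < graphG J b (ρ t x) (gradient (fun y => potential (ρ t y)) x)
      (hessOp (fun y => potential (ρ t y)) x) x
  eqn : ∀ t ∈ Ico 0 τ, ∀ x, x ≠ 0 → HasDerivWithinAt (fun s => potential (ρ s x))
    (graphV J (ρ t x) (gradient (fun y => potential (ρ t y)) x) x /
      graphG J b (ρ t x) (gradient (fun y => potential (ρ t y)) x)
      (hessOp (fun y => potential (ρ t y)) x) x) (Ico 0 τ) t

theorem uniqueDiffOn_Ico_zero (τ : ℝ) : UniqueDiffOn ℝ (Ico 0 τ) := uniqueDiffOn_Ico 0 τ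

namespace IsGraphSolution

variable {J : E →L[ℝ] E} {b : OrthonormalBasis ι ℝ E} {τ : ℝ} {ρ : ℝ → E → ℝ}
  (h : IsGraphSolution J b τ ρ)
include h

theorem smooth_potential :
    ContDiffOn ℝ ∞ (uncurry fun t x => potential (ρ t x)) (Ico 0 τ ×ˢ {0}ᶜ) :=
  contDiffOn_potential.comp h.smooth fun p hp => h.pos p.1 hp.1 p.2 hp.2

theorem isSmoothConic {t : ℝ} (ht : t ∈ Ico 0 τ) :
    IsSmoothConic (fun x => potential (ρ t x)) where
  smooth := contDiffOn_slice h.smooth_potential ht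
  homog c hc x hx := by rw [h.homog t ht c hc x hx]

theorem hasFDerivAt_radius {t : ℝ} (ht : t ∈ Ico 0 τ) {x : E} (hx : x ≠ 0) :
    HasFDerivAt (ρ t) (Real.sinh (ρ t x) • fderiv ℝ (fun y => potential (ρ t y)) x) x := by
  have h1 : HasFDerivAt (ρ t) (fderiv ℝ (ρ t) x) x :=
    (((contDiffOn_slice h.smooth ht).contDiffAt
      (isOpen_compl_singleton.mem_nhds hx)).differentiableAt (by simp)).hasFDerivAt
  have hpos := h.pos t ht x hx
  have h2 := (hasDerivAt_potential hpos).comp_hasFDerivAt x h1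
  have h3 : fderiv ℝ (fun y => potential (ρ t y)) x
      = (1 / Real.sinh (ρ t x)) • fderiv ℝ (ρ t) x := h2.fderiv
  have hs : 0 < Real.sinh (ρ t x) := Real.sinh_pos_iff.mpr hpos
  rw [h3, smul_smul, mul_one_div_cancel hs.ne', one_smul]
  exact h1

theorem contDiffOn_gradient :
    ContDiffOn ℝ ∞ (uncurry fun t x => gradient (fun y => potential (ρ t y)) x)
      (Ico 0 τ ×ˢ {0}ᶜ) :=
  (InnerProductSpace.toDual ℝ E).symm.toContinuousLinearEquiv.contDiff.comp_contDiffOn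
    (contDiffOn_fderiv_snd (uniqueDiffOn_Ico_zero τ) isOpen_compl_singleton h.smooth_potential)

theorem contDiffOn_hessOp :
    ContDiffOn ℝ ∞ (uncurry fun t x => hessOp (fun y => potential (ρ t y)) x)
      (Ico 0 τ ×ˢ {0}ᶜ) :=
  contDiffOn_fderiv_snd (uniqueDiffOn_Ico_zero τ) isOpen_compl_singleton h.contDiffOn_gradient

theorem sphere_subset {t₁ : ℝ} (ht₁ : t₁ < τ) :
    Icc 0 t₁ ×ˢ Metric.sphere (0 : E) 1 ⊆ Ico 0 τ ×ˢ {0}ᶜ := by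
  rintro ⟨t, x⟩ ⟨ht, hx⟩
  refine ⟨⟨ht.1, ht.2.trans_lt ht₁⟩, ?_⟩
  rintro rfl
  simp at hx

/-- The right-hand side of the graph equation. -/
theorem deriv_potential {t : ℝ} (ht : t ∈ Ioo 0 τ) {x : E} (hx : x ≠ 0) :
    deriv (fun s => potential (ρ s x)) t =
      graphV J (ρ t x) (gradient (fun y => potential (ρ t y)) x) x /
      graphG J b (ρ t x) (gradient (fun y => potential (ρ t y)) x)
      (hessOp (fun y => potential (ρ t y)) x) x :=
  ((h.eqn t ⟨ht.1.le, ht.2⟩ x hx).hasDerivAt (Ico_mem_nhds ht.1 ht.2)).deriv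

theorem hasDerivAt_gradient {t : ℝ} (ht : t ∈ Ioo 0 τ) {x : E} (hx : x ≠ 0) :
    DifferentiableAt ℝ (fun y => deriv (fun s => potential (ρ s y)) t) x ∧
    HasDerivAt (fun s => gradient (fun y => potential (ρ s y)) x)
      (gradient (fun y => deriv (fun s => potential (ρ s y)) t) x) t := by
  have h1 : ContDiffAt ℝ ∞ (uncurry fun t x => potential (ρ t x)) (t, x) :=
    h.smooth_potential.contDiffAt (prod_mem_nhds (Ico_mem_nhds ht.1 ht.2)
      (isOpen_compl_singleton.mem_nhds hx))
  have h2 := hasDerivAt_fderiv_snd h1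
  let e : (E →L[ℝ] ℝ) ≃L[ℝ] E := (InnerProductSpace.toDual ℝ E).symm.toContinuousLinearEquiv
  exact ⟨h2.1, e.toContinuousLinearMap.hasFDerivAt.comp_hasDerivAt t h2.2⟩

theorem continuousOn_coefficient (hJ : IsOrthComplex J) :
    ContinuousOn (fun z : ℝ × E => graphV J (ρ z.1 z.2)
        (gradient (fun y => potential (ρ z.1 y)) z.2) z.2 *
        |graphK (Fintype.card ι) J (ρ z.1 z.2) (gradient (fun y => potential (ρ z.1 y)) z.2)
          (hessOp (fun y => potential (ρ z.1 y)) z.2) z.2| /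
        graphG J b (ρ z.1 z.2) (gradient (fun y => potential (ρ z.1 y)) z.2)
          (hessOp (fun y => potential (ρ z.1 y)) z.2) z.2 ^ 2) (Ico 0 τ ×ˢ {0}ᶜ) :=
  continuousOn_graph_coefficient b hJ h.smooth.continuousOn h.contDiffOn_gradient.continuousOn
    h.contDiffOn_hessOp.continuousOn continuous_snd.continuousOn
    fun z hz => h.den_pos z.1 hz.1 z.2 hz.2

/-- The Hopf derivative vanishes if it vanishes initially. -/
theorem hopfDeriv_eq_zero (hJ : IsOrthComplex J)
    (h0 : ∀ x, x ≠ 0 → ⟪gradient (fun y => potential (ρ 0 y)) x, J x⟫ = 0) :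
    ∀ t ∈ Ico 0 τ, ∀ x, x ≠ 0 → ⟪gradient (fun y => potential (ρ t y)) x, J x⟫ = 0 := by
  have hsphere : ∀ t ∈ Ico 0 τ, ∀ x ∈ Metric.sphere (0 : E) 1,
      ⟪gradient (fun y => potential (ρ t y)) x, J x⟫ = 0 := by
    intro t₁ ht₁ x₁ hx₁
    have hsub := h.sphere_subset ht₁.2
    have hK : IsCompact (Metric.sphere (0 : E) 1) := isCompact_sphere 0 1
    -- C may depend on t₁. The factor 2 passed to the maximum principle comes from differentiating
    -- the square of the Hopf derivative.
    obtain ⟨C, hC⟩ := (isCompact_Icc.prod hK).exists_bound_of_continuousOn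
      ((h.continuousOn_coefficient hJ).mono hsub)
    have hcont : ContinuousOn (uncurry fun t x =>
        ⟪gradient (fun y => potential (ρ t y)) x, J x⟫ ^ 2) (Icc 0 t₁ ×ˢ Metric.sphere (0 : E) 1) :=
      ((h.contDiffOn_gradient.continuousOn.mono hsub).inner
        ((J.continuous.comp continuous_snd).continuousOn)).pow 2
    have := max_principle (C := 2 * C) hK hcont (fun x hx => by
      rw [h0 x (by rintro rfl; simp at hx)]; simp) (fun t ht x hx hpos hmax => by
      have ht' : t ∈ Ioo 0 τ := ⟨ht.1, ht.2.trans_lt ht₁.2⟩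
      have ht'' : t ∈ Ico 0 τ := ⟨ht.1.le, ht'.2⟩
      have hx1 : ‖x‖ = 1 := by simpa using hx
      have hx0 : x ≠ 0 := by rintro rfl; simp at hx1
      have hd := h.hasDerivAt_gradient ht' hx0
      have hgr := hopfDeriv_growth b hJ (h.isSmoothConic ht'') hx1 (h.hasFDerivAt_radius ht'' hx0)
        (fun h0 => by rw [h0] at hpos; simp at hpos)
        (fun y hy => hmax y (by simpa using hy)) (h.den_pos t ht'' x hx0)
        ((eventually_ne_nhds hx0).mono
          fun y hy => h.deriv_potential ht' hy) hd.1
      have hder := (hd.2.inner ℝ (hasDerivAt_const t (J x))).fun_pow 2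
      refine ⟨_, hder, ?_⟩
      have hb := hC (t, x) ⟨⟨ht.1.le, ht.2⟩, hx⟩
      have hb' := mul_le_mul_of_nonneg_right ((le_abs_self _).trans hb)
        (sq_nonneg ⟪gradient (fun y => potential (ρ t y)) x, J x⟫)
      rw [inner_zero_right, zero_add,
        inner_gradient (fun y => deriv (fun s => potential (ρ s y)) t)]
      simp only [Nat.cast_ofNat, Nat.add_one_sub_one, pow_one]
      dsimp only at hb'
      linarith) t₁ ⟨ht₁.1, le_rfl⟩ x₁ hx₁
    exact pow_eq_zero_iff (two_ne_zero) |>.mp (le_antisymm this (sq_nonneg _))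
  intro t ht x hx
  have hpos : 0 < ‖x‖ := norm_pos_iff.mpr hx
  have h1 := hsphere t ht (‖x‖⁻¹ • x) (by
    rw [mem_sphere_zero_iff_norm, norm_smul, norm_inv, norm_norm, inv_mul_cancel₀ hpos.ne'])
  rw [(h.isSmoothConic ht).gradient_smul (inv_pos.mpr hpos) hx, map_smul, inner_smul_left,
    inner_smul_right] at h1
  simpa [hpos.ne'] using h1

/-- The gradient estimate. -/
theorem gradSq_le (hJ : IsOrthComplex J)
    (h0 : ∀ x, x ≠ 0 → ⟪gradient (fun y => potential (ρ 0 y)) x, J x⟫ = 0) {c : ℝ}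
    (hc : ∀ x, ‖x‖ = 1 → ‖gradient (fun y => potential (ρ 0 y)) x‖ ^ 2 ≤ c) :
    ∀ t ∈ Ico 0 τ, ∀ x, ‖x‖ = 1 → ‖gradient (fun y => potential (ρ t y)) x‖ ^ 2 ≤
      c * Real.exp (-(2 / Fintype.card ι) * t) := by
  intro t₁ ht₁ x₁ hx₁
  have hsub := h.sphere_subset ht₁.2
  have hf := h.hopfDeriv_eq_zero hJ h0
  have hK : IsCompact (Metric.sphere (0 : E) 1) := isCompact_sphere 0 1
  set m : ℝ := 2 / Fintype.card ι with hm
  -- The exponential weight exactly offsets the decay rate at a maximum, so the maximum principle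
  -- applies with growth constant 0.
  have hcont : ContinuousOn (uncurry fun t x => Real.exp (m * t) *
      ‖gradient (fun y => potential (ρ t y)) x‖ ^ 2 - c) (Icc 0 t₁ ×ˢ Metric.sphere (0 : E) 1) :=
    ((Real.continuous_exp.comp (continuous_const.mul continuous_fst)).continuousOn.mul
      ((h.contDiffOn_gradient.continuousOn.mono hsub).norm.pow 2)).sub continuousOn_const
  have := max_principle (C := 0) hK hcont (fun x hx => by
    simpa using hc x (by simpa using hx)) (fun t ht x hx hpos hmax => by
    have ht' : t ∈ Ioo 0 τ := ⟨ht.1, ht.2.trans_lt ht₁.2⟩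
    have ht'' : t ∈ Ico 0 τ := ⟨ht.1.le, ht'.2⟩
    have hx1 : ‖x‖ = 1 := by simpa using hx
    have hx0 : x ≠ 0 := by rintro rfl; simp at hx1
    have hd := h.hasDerivAt_gradient ht' hx0
    have hgr := gradSq_decay b hJ (h.isSmoothConic ht'') hx1 (h.hasFDerivAt_radius ht'' hx0)
      (hf t ht'') (fun y hy => by
        have h2 := hmax y (by simpa using hy)
        have h3 := le_of_mul_le_mul_left (sub_le_sub_iff_right _ |>.mp h2) (Real.exp_pos _)
        rwa [hy, hx1, one_pow, one_mul, one_mul]) (h.den_pos t ht'' x hx0)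
      ((eventually_ne_nhds hx0).mono
        fun y hy => h.deriv_potential ht' hy) hd.1
    have he : HasDerivAt (fun s : ℝ => Real.exp (m * s)) (Real.exp (m * t) * m) t := by
      have := ((hasDerivAt_id t).const_mul m).exp
      simpa using this
    refine ⟨_, (he.fun_mul hd.2.norm_sq).sub_const c, ?_⟩
    rw [real_inner_comm, inner_gradient (fun y => deriv (fun s => potential (ρ s y)) t)]
    have h3 := mul_le_mul_of_nonneg_left hgr (Real.exp_pos (m * t)).le
    rw [← hm] at h3
    linarith) t₁ ⟨ht₁.1, le_rfl⟩ x₁ (by simpa using hx₁)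
  have h4 : Real.exp (m * t₁) * ‖gradient (fun y => potential (ρ t₁ y)) x₁‖ ^ 2 ≤ c := by
    linarith
  have h5 := mul_le_mul_of_nonneg_right h4 (Real.exp_pos (-m * t₁)).le
  have h6 : Real.exp (m * t₁) * Real.exp (-m * t₁) = 1 := by
    rw [← Real.exp_add]; simp
  calc _ = Real.exp (m * t₁) * Real.exp (-m * t₁) *
        ‖gradient (fun y => potential (ρ t₁ y)) x₁‖ ^ 2 := by rw [h6, one_mul]
    _ = _ := by ring
    _ ≤ _ := h5

/-- The hypersurfaces move outward. -/
theorem radius_mono (hJ : IsOrthComplex J) {t : ℝ} (ht : t ∈ Ico 0 τ) {x : E} (hx : x ≠ 0) :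
    ρ 0 x ≤ ρ t x := by
  have h0 : (0 : ℝ) ∈ Ico 0 τ := ⟨le_rfl, ht.1.trans_lt ht.2⟩
  have hmono : MonotoneOn (fun s => potential (ρ s x)) (Ico 0 τ) := by
    refine monotoneOn_of_deriv_nonneg (convex_Ico 0 τ)
      (fun s hs => (h.eqn s hs x hx).continuousWithinAt) (fun s hs => ?_) fun s hs => ?_
    · rw [interior_Ico] at hs
      exact ((h.eqn s ⟨hs.1.le, hs.2⟩ x hx).hasDerivAt
        (Ico_mem_nhds hs.1 hs.2)).differentiableAt.differentiableWithinAt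
    · rw [interior_Ico] at hs
      rw [h.deriv_potential hs hx]
      have h1 := one_le_graphV hJ (ρ s x) (gradient (fun y => potential (ρ s y)) x) x
      have h2 := h.den_pos s ⟨hs.1.le, hs.2⟩ x hx
      exact div_nonneg (by linarith) h2.le
  exact (strictMonoOn_potential.le_iff_le (h.pos 0 h0 x hx) (h.pos t ht x hx)).mp
    (hmono h0 ht ht.1)

end IsGraphSolution

end GraphSolution

end CHFlow

namespace CHFlow

open scoped ContDiff Topology RealInnerProductSpace
open Set Filter Function

/-! ### Geometry of the ambient metric in linear coordinates -/

section AmbientMetric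

variable {E ι : Type*} [NormedAddCommGroup E] [InnerProductSpace ℝ E] [Fintype ι]

theorem hasFDerivAt_norm_of_ne {x : E} (hx : x ≠ 0) :
    HasFDerivAt (fun y : E => ‖y‖) (‖x‖⁻¹ • innerSL ℝ x) x := by
  have hr : 0 < ‖x‖ := norm_pos_iff.mpr hx
  have h := (hasStrictFDerivAt_norm_sq x).hasFDerivAt.sqrt (by positivity)
  have h2 : HasFDerivAt (fun y : E => ‖y‖) _ x := h.congr_of_eventuallyEq
    (Eventually.of_forall fun y => (Real.sqrt_sq (norm_nonneg y)).symm)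
  refine h2.congr_fderiv ?_
  rw [Real.sqrt_sq hr.le]
  ext v
  simp
  field_simp

theorem hasFDerivAt_radial {f : ℝ → ℝ} {f' : ℝ} {x : E} (hx : x ≠ 0) (hf : HasDerivAt f f' ‖x‖) :
    HasFDerivAt (fun y : E => f ‖y‖) ((f' / ‖x‖) • innerSL ℝ x) x := by
  refine (hf.comp_hasFDerivAt x (hasFDerivAt_norm_of_ne hx)).congr_fderiv ?_
  rw [smul_smul, div_eq_mul_inv]

/-- The metric of complex hyperbolic space away from the origin. -/
noncomputable def ambientMetric (J : E →L[ℝ] E) (x u w : E) : ℝ :=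
  Real.sinh ‖x‖ ^ 2 / ‖x‖ ^ 2 * ⟪u, w⟫
    + (1 - Real.sinh ‖x‖ ^ 2 / ‖x‖ ^ 2) / ‖x‖ ^ 2 * (⟪x, u⟫ * ⟪x, w⟫)
    + (Real.sinh ‖x‖ ^ 2 / ‖x‖ ^ 2) ^ 2 * (⟪J x, u⟫ * ⟪J x, w⟫)

/-- The derivative of the metric in the direction `v`. -/
noncomputable def ambientMetricDeriv (J : E →L[ℝ] E) (x v u w : E) : ℝ :=
  let r := ‖x‖
  let a := Real.sinh r ^ 2 / r ^ 2
  let a' := 2 * Real.sinh r * Real.cosh r / r ^ 2 - 2 * Real.sinh r ^ 2 / r ^ 3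
  let b' := -a' / r ^ 2 - 2 * (1 - a) / r ^ 3
  a' / r * ⟪x, v⟫ * ⟪u, w⟫
    + (b' / r * ⟪x, v⟫ * (⟪x, u⟫ * ⟪x, w⟫) + (1 - a) / r ^ 2 * (⟪v, u⟫ * ⟪x, w⟫ + ⟪x, u⟫ * ⟪v, w⟫))
    + (2 * a * a' / r * ⟪x, v⟫ * (⟪J x, u⟫ * ⟪J x, w⟫)
      + a ^ 2 * (⟪J v, u⟫ * ⟪J x, w⟫ + ⟪J x, u⟫ * ⟪J v, w⟫))

theorem fderiv_ambientMetric (J : E →L[ℝ] E) {x : E} (hx : x ≠ 0) (v u w : E) :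
    fderiv ℝ (fun y => ambientMetric J y u w) x v = ambientMetricDeriv J x v u w := by
  have hr : 0 < ‖x‖ := norm_pos_iff.mpr hx
  set r := ‖x‖ with hrdef
  set a' := 2 * Real.sinh r * Real.cosh r / r ^ 2 - 2 * Real.sinh r ^ 2 / r ^ 3 with ha'
  have hid := hasDerivAt_id r
  have ha : HasDerivAt (fun s : ℝ => Real.sinh s ^ 2 / s ^ 2) a' r := by
    refine ((hid.sinh.fun_pow 2).fun_div (hid.fun_pow 2) (by simpa using hr.ne')).congr_deriv ?_
    rw [ha']
    simp only [id]
    field_simp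
    simp
    ring
  have hb : HasDerivAt (fun s : ℝ => (1 - Real.sinh s ^ 2 / s ^ 2) / s ^ 2)
      (-a' / r ^ 2 - 2 * (1 - Real.sinh r ^ 2 / r ^ 2) / r ^ 3) r := by
    refine ((ha.const_sub 1).fun_div (hid.fun_pow 2) (by simpa using hr.ne')).congr_deriv ?_
    simp only [id]
    field_simp
    simp
    ring
  have hc : HasDerivAt (fun s : ℝ => (Real.sinh s ^ 2 / s ^ 2) ^ 2)
      (2 * (Real.sinh r ^ 2 / r ^ 2) * a') r := by
    refine (ha.fun_pow 2).congr_deriv ?_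
    simp
  have hxi : ∀ u, HasFDerivAt (fun y : E => ⟪y, u⟫) (innerSL ℝ u) x := fun u =>
    (innerSL ℝ u).hasFDerivAt.congr_of_eventuallyEq
      (Eventually.of_forall fun y => by simp [real_inner_comm])
  have hJi : ∀ u, HasFDerivAt (fun y : E => ⟪J y, u⟫) ((innerSL ℝ u).comp J) x := fun u =>
    ((innerSL ℝ u).comp J).hasFDerivAt.congr_of_eventuallyEq
      (Eventually.of_forall fun y => by simp [real_inner_comm])
  have h := (((hasFDerivAt_radial hx ha).fun_mul (hasFDerivAt_const ⟪u, w⟫ x)).fun_add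
    ((hasFDerivAt_radial hx hb).fun_mul ((hxi u).fun_mul (hxi w)))).fun_add
    ((hasFDerivAt_radial hx hc).fun_mul ((hJi u).fun_mul (hJi w)))
  have h' : fderiv ℝ (fun y => ambientMetric J y u w) x = _ := h.fderiv
  rw [h']
  simp only [add_apply, smul_apply, ContinuousLinearMap.comp_apply, innerSL_apply_apply, smul_eq_mul,
    zero_apply, ambientMetricDeriv, ← hrdef, ← ha', real_inner_comm v u, real_inner_comm v w,
    real_inner_comm (J v) u, real_inner_comm (J v) w]
  ring

/-- The metric as a bilinear form. -/
noncomputable def ambientForm (J : E →L[ℝ] E) (x : E) : E →ₗ[ℝ] E →ₗ[ℝ] ℝ :=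
  LinearMap.mk₂ ℝ (ambientMetric J x)
    (fun u v w => by simp only [ambientMetric, inner_add_left, inner_add_right]; ring)
    (fun c u w => by
      simp only [ambientMetric, inner_smul_left, inner_smul_right, conj_trivial, smul_eq_mul]; ring)
    (fun u v w => by simp only [ambientMetric, inner_add_right]; ring)
    (fun c u w => by
      simp only [ambientMetric, inner_smul_right, smul_eq_mul]; ring)

@[simp] theorem ambientForm_apply (J : E →L[ℝ] E) (x u w : E) :
    ambientForm J x u w = ambientMetric J x u w := rfl

theorem ambientMetric_comm (J : E →L[ℝ] E) (x u w : E) :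
    ambientMetric J x u w = ambientMetric J x w u := by
  rw [ambientMetric, ambientMetric, real_inner_comm]; ring

theorem ambientMetric_self_pos (J : E →L[ℝ] E) {x : E} (hx : x ≠ 0) {u : E} (hu : u ≠ 0) :
    0 < ambientMetric J x u u := by
  have hr : 0 < ‖x‖ := norm_pos_iff.mpr hx
  have hs : 0 < Real.sinh ‖x‖ := Real.sinh_pos_iff.mpr hr
  have hcs := real_inner_mul_inner_self_le x u
  rw [real_inner_self_eq_norm_sq, real_inner_self_eq_norm_sq] at hcs
  have hu' : 0 < ‖u‖ := norm_pos_iff.mpr hu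
  set r := ‖x‖
  have e : ambientMetric J x u u = Real.sinh r ^ 2 / r ^ 4 * (r ^ 2 * ‖u‖ ^ 2 - ⟪x, u⟫ * ⟪x, u⟫)
      + ⟪x, u⟫ ^ 2 / r ^ 2 + (Real.sinh r ^ 2 / r ^ 2) ^ 2 * ⟪J x, u⟫ ^ 2 := by
    rw [ambientMetric, real_inner_self_eq_norm_sq]
    field_simp
    ring
  rw [e]
  have h3 : 0 ≤ (Real.sinh r ^ 2 / r ^ 2) ^ 2 * ⟪J x, u⟫ ^ 2 := by positivity
  rcases eq_or_ne ⟪x, u⟫ 0 with h0 | h0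
  · rw [h0]
    have : 0 < Real.sinh r ^ 2 / r ^ 4 * (r ^ 2 * ‖u‖ ^ 2 - 0 * 0) := by
      rw [mul_zero, sub_zero]; positivity
    have h2 : (0 : ℝ) ^ 2 / r ^ 2 = 0 := by simp
    linarith
  · have h1 : 0 ≤ Real.sinh r ^ 2 / r ^ 4 * (r ^ 2 * ‖u‖ ^ 2 - ⟪x, u⟫ * ⟪x, u⟫) :=
      mul_nonneg (by positivity) (by linarith)
    have h2 : 0 < ⟪x, u⟫ ^ 2 / r ^ 2 := by positivity
    linarith

/-- The Christoffel symbols of the first kind. -/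
noncomputable def ambientChristoffel (J : E →L[ℝ] E) (x u w q : E) : ℝ :=
  (ambientMetricDeriv J x u w q + ambientMetricDeriv J x w u q - ambientMetricDeriv J x q u w) / 2

/-- The second derivative of `potential ‖x‖ - φ`, where `A` is the Hessian of `φ`. -/
noncomputable def levelHess (A : E →L[ℝ] E) (x u w : E) : ℝ :=
  -(Real.sinh ‖x‖ + ‖x‖ * Real.cosh ‖x‖) / (‖x‖ ^ 2 * Real.sinh ‖x‖ ^ 2) / ‖x‖ * (⟪x, u⟫ * ⟪x, w⟫)
    + 1 / (‖x‖ * Real.sinh ‖x‖) * ⟪u, w⟫ - ⟪A u, w⟫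

/-- The metric gradient of `potential ‖x‖ - φ`, where `p` is the gradient of `φ`. -/
noncomputable def levelGrad (J : E →L[ℝ] E) (p x : E) : E :=
  (1 / (‖x‖ * Real.sinh ‖x‖)) • x - (1 / Real.sinh ‖x‖ ^ 2) • graphQ J ‖x‖ p x

/-- The Hessian of `potential ‖x‖ - φ` for the ambient metric. -/
noncomputable def levelForm (J : E →L[ℝ] E) (p : E) (A : E →L[ℝ] E) (x : E) : E →ₗ[ℝ] E →ₗ[ℝ] ℝ :=
  LinearMap.mk₂ ℝ (fun u w => levelHess A x u w - ambientChristoffel J x u w (levelGrad J p x))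
    (fun u v w => by
      simp only [levelHess, ambientChristoffel, ambientMetricDeriv, inner_add_left, inner_add_right,
        map_add]; ring)
    (fun c u w => by
      simp only [levelHess, ambientChristoffel, ambientMetricDeriv, inner_smul_left,
        inner_smul_right, map_smul, conj_trivial, smul_eq_mul]; ring)
    (fun u v w => by
      simp only [levelHess, ambientChristoffel, ambientMetricDeriv, inner_add_left, inner_add_right,
        map_add]; ring)
    (fun c u w => by
      simp only [levelHess, ambientChristoffel, ambientMetricDeriv, inner_smul_left,
        inner_smul_right, map_smul, conj_trivial, smul_eq_mul]; ring)

theorem levelForm_apply (J : E →L[ℝ] E) (p : E) (A : E →L[ℝ] E) (x u w : E) :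
    levelForm J p A x u w = levelHess A x u w - ambientChristoffel J x u w (levelGrad J p x) := rfl

theorem levelForm_comm (J : E →L[ℝ] E) (p : E) {A : E →L[ℝ] E}
    (hA : ∀ v w, ⟪A v, w⟫ = ⟪A w, v⟫) (x u w : E) :
    levelForm J p A x u w = levelForm J p A x w u := by
  simp only [levelForm_apply, levelHess, ambientChristoffel, ambientMetricDeriv,
    real_inner_comm w u, hA w u]
  ring

section

variable {J : E →L[ℝ] E} (hJ : IsOrthComplex J) {x p : E} (hx : x ≠ 0) (hpx : ⟪p, x⟫ = 0)
include hJ hx hpx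

/-- `levelGrad` represents the differential of `potential ‖x‖ - φ`. -/
theorem ambientMetric_levelGrad (w : E) : ambientMetric J x (levelGrad J p x) w =
    1 / (‖x‖ * Real.sinh ‖x‖) * ⟪x, w⟫ - ⟪p, w⟫ := by
  have hr : 0 < ‖x‖ := norm_pos_iff.mpr hx
  have hs : 0 < Real.sinh ‖x‖ := Real.sinh_pos_iff.mpr hr
  have hc : 0 < Real.cosh ‖x‖ := Real.cosh_pos _
  have hc2 := Real.cosh_sq ‖x‖
  have hxp : ⟪x, p⟫ = 0 := by rw [real_inner_comm]; exact hpx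
  simp only [ambientMetric, levelGrad, graphQ, inner_sub_left, inner_sub_right, inner_smul_left,
    inner_smul_right, conj_trivial, hxp, hJ.inner_self, hJ.inner_self', hJ.inner_map_map,
    real_inner_self_eq_norm_sq, real_inner_comm p (J x)]
  set r := ‖x‖
  set sh := Real.sinh r
  set ch := Real.cosh r
  field_simp
  simp only [hc2]
  ring

/-- The length √V / sinh of this gradient normalizes the unit normal and converts the traced Hessian
into the mean curvature. -/
theorem ambientMetric_levelGrad_self : ambientMetric J x (levelGrad J p x) (levelGrad J p x) =
    graphV J ‖x‖ p x / Real.sinh ‖x‖ ^ 2 := by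
  have hr : 0 < ‖x‖ := norm_pos_iff.mpr hx
  have hs : 0 < Real.sinh ‖x‖ := Real.sinh_pos_iff.mpr hr
  have hc : 0 < Real.cosh ‖x‖ := Real.cosh_pos _
  have hxp : ⟪x, p⟫ = 0 := by rw [real_inner_comm]; exact hpx
  rw [ambientMetric_levelGrad hJ hx hpx]
  simp only [levelGrad, graphQ, graphV, inner_sub_right,
    inner_smul_right, hxp, hpx, hJ.inner_self',
    real_inner_self_eq_norm_sq]
  field_simp
  ring

/-- The ambient metric trace of the Hessian of `potential ‖x‖ - φ` over a level set. -/
theorem levelForm_trace (b : OrthonormalBasis ι ℝ E) {A : E →L[ℝ] E}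
    (hA : ∀ v w, ⟪A v, w⟫ = ⟪A w, v⟫) (hAx : A x = -p) :
    ‖x‖ ^ 2 / Real.sinh ‖x‖ ^ 2 * (∑ k, levelForm J p A x (b k) (b k)
      - Real.sinh ‖x‖ ^ 2 / Real.cosh ‖x‖ ^ 2 / ‖x‖ ^ 2 * levelForm J p A x (J x) (J x)
      - (1 - Real.sinh ‖x‖ ^ 2 / ‖x‖ ^ 2) / ‖x‖ ^ 2 * levelForm J p A x x x)
      - levelForm J p A x (levelGrad J p x) (levelGrad J p x)
        / (graphV J ‖x‖ p x / Real.sinh ‖x‖ ^ 2)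
      = graphG J b ‖x‖ p A x / Real.sinh ‖x‖ ^ 2 := by
  have hr : 0 < ‖x‖ := norm_pos_iff.mpr hx
  have hs : 0 < Real.sinh ‖x‖ := Real.sinh_pos_iff.mpr hr
  have hc : 0 < Real.cosh ‖x‖ := Real.cosh_pos _
  have hc2 := Real.cosh_sq ‖x‖
  have hxp : ⟪x, p⟫ = 0 := by rw [real_inner_comm]; exact hpx
  have hV := one_le_graphV hJ ‖x‖ p x
  set Q := levelGrad J p x with hQ
  set q := graphQ J ‖x‖ p x with hq
  set f := ⟪p, J x⟫ with hf
  have hQx : ⟪x, Q⟫ = ‖x‖ / Real.sinh ‖x‖ := by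
    rw [hQ, levelGrad, graphQ]
    simp only [inner_sub_right, inner_smul_right, hxp, hJ.inner_self', real_inner_self_eq_norm_sq]
    field_simp
    ring
  have hQJ : ⟪J x, Q⟫ = -(‖x‖ ^ 2 / Real.sinh ‖x‖ ^ 2 * (f / Real.cosh ‖x‖ ^ 2)) := by
    rw [hQ, levelGrad, graphQ]
    simp only [inner_sub_right, inner_smul_right, real_inner_comm p (J x), hJ.inner_self,
      hJ.inner_map_map, real_inner_self_eq_norm_sq, ← hf]
    field_simp
    rw [hc2]; ring
  have hqx : ⟪x, q⟫ = 0 := by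
    rw [hq, graphQ]
    simp only [inner_sub_right, inner_smul_right, hxp, hJ.inner_self']; ring
  have hpq : ⟪p, q⟫ = graphV J ‖x‖ p x - 1 := by
    rw [hq, graphQ, graphV]
    simp only [inner_sub_right, inner_smul_right, real_inner_self_eq_norm_sq, ← hf]; ring
  have hqq : ⟪q, q⟫ = ‖x‖ ^ 2 * (graphV J ‖x‖ p x - 1
      - Real.sinh ‖x‖ ^ 2 / Real.cosh ‖x‖ ^ 4 * f ^ 2) := by
    rw [hq, graphQ, graphV]
    simp only [inner_sub_right, inner_sub_left, inner_smul_left, inner_smul_right,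
      real_inner_self_eq_norm_sq, ← hf, conj_trivial, hJ.norm_map, real_inner_comm p (J x)]
    field_simp
    linear_combination -(Real.sinh ‖x‖ ^ 2 * f ^ 2) * hc2
  have hQQ : ⟪Q, Q⟫ = 1 / Real.sinh ‖x‖ ^ 2 + 1 / Real.sinh ‖x‖ ^ 4 * ⟪q, q⟫ := by
    rw [hQ, levelGrad, ← hq]
    simp only [inner_sub_right, inner_sub_left, inner_smul_left, inner_smul_right,
      real_inner_self_eq_norm_sq x, conj_trivial, real_inner_comm x q, hqx]
    field_simp
    ring
  have hAQ : ⟪A Q, Q⟫ = 2 / (‖x‖ * Real.sinh ‖x‖ ^ 3) * (graphV J ‖x‖ p x - 1)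
      + 1 / Real.sinh ‖x‖ ^ 4 * ⟪A q, q⟫ := by
    rw [hQ, levelGrad, ← hq]
    simp only [map_sub, map_smul, inner_sub_right, inner_sub_left, inner_smul_left,
      inner_smul_right, conj_trivial, hA q x, hAx, inner_neg_left, hpq, hpx]
    field_simp
    ring
  have hAxx : ⟪A x, x⟫ = 0 := by rw [hAx, inner_neg_left, hpx, neg_zero]
  have hxx : ⟪x, x⟫ = ‖x‖ ^ 2 := real_inner_self_eq_norm_sq x
  have hJxJx : ⟪J x, J x⟫ = ‖x‖ ^ 2 := by rw [hJ.inner_map_map, hxx]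
  have hJQx : ⟪J Q, J x⟫ = ‖x‖ / Real.sinh ‖x‖ := by
    rw [hJ.inner_map_map, real_inner_comm, hQx]
  -- Expansion of the Christoffel symbols with Q in the last slot: apart from A, only inner products
  -- with X, x, J x, Q and J Q remain, so sums over the basis are explicit.
  have hquad : ∀ X, levelForm J p A x X X = Real.cosh ‖x‖ / ‖x‖ ^ 2 * ⟪X, X⟫
      + (-(Real.cosh ‖x‖ / (‖x‖ ^ 2 * Real.sinh ‖x‖ ^ 2)) + Real.cosh ‖x‖ / ‖x‖ ^ 4
        - 2 * Real.sinh ‖x‖ / ‖x‖ ^ 5) * (⟪x, X⟫ * ⟪x, X⟫)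
      - (2 * Real.sinh ‖x‖ * Real.cosh ‖x‖ / ‖x‖ ^ 3 - 2 * Real.sinh ‖x‖ ^ 2 / ‖x‖ ^ 4)
        * (⟪x, X⟫ * ⟪Q, X⟫)
      + Real.sinh ‖x‖ ^ 2 / ‖x‖ ^ 2 * (2 * Real.cosh ‖x‖ / ‖x‖ ^ 2 - 2 * Real.sinh ‖x‖ / ‖x‖ ^ 3)
        * (⟪J x, X⟫ * ⟪J x, X⟫)
      - 2 * (Real.sinh ‖x‖ ^ 2 / ‖x‖ ^ 2)
        * (2 * Real.sinh ‖x‖ * Real.cosh ‖x‖ / ‖x‖ ^ 3 - 2 * Real.sinh ‖x‖ ^ 2 / ‖x‖ ^ 4)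
        * ⟪J x, Q⟫ * (⟪x, X⟫ * ⟪J x, X⟫)
      + 2 * (Real.sinh ‖x‖ ^ 2 / ‖x‖ ^ 2) ^ 2 * (⟪J Q, X⟫ * ⟪J x, X⟫) - ⟪A X, X⟫ := by
    intro X
    have h1 : ⟪J X, Q⟫ = -⟪J Q, X⟫ := by rw [hJ.skew, real_inner_comm]
    simp only [levelForm_apply, levelHess, ambientChristoffel, ambientMetricDeriv, ← hQ, h1,
      hJ.inner_self X, hQx, real_inner_comm Q X]
    field_simp
    ring
  have hsum2 : ∀ u w : E, ∑ k, ⟪u, b k⟫ * ⟪w, b k⟫ = ⟪u, w⟫ := fun u w => by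
    rw [← b.sum_inner_mul_inner u w]
    exact Finset.sum_congr rfl fun k _ => by rw [real_inner_comm w (b k)]
  have hsum : ∑ k, levelForm J p A x (b k) (b k) = Real.cosh ‖x‖ / ‖x‖ ^ 2 * Fintype.card ι
      + (-(Real.cosh ‖x‖ / (‖x‖ ^ 2 * Real.sinh ‖x‖ ^ 2)) + Real.cosh ‖x‖ / ‖x‖ ^ 4
        - 2 * Real.sinh ‖x‖ / ‖x‖ ^ 5) * ‖x‖ ^ 2
      - (2 * Real.sinh ‖x‖ * Real.cosh ‖x‖ / ‖x‖ ^ 3 - 2 * Real.sinh ‖x‖ ^ 2 / ‖x‖ ^ 4)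
        * (‖x‖ / Real.sinh ‖x‖)
      + Real.sinh ‖x‖ ^ 2 / ‖x‖ ^ 2 * (2 * Real.cosh ‖x‖ / ‖x‖ ^ 2 - 2 * Real.sinh ‖x‖ / ‖x‖ ^ 3)
        * ‖x‖ ^ 2
      + 2 * (Real.sinh ‖x‖ ^ 2 / ‖x‖ ^ 2) ^ 2 * (‖x‖ / Real.sinh ‖x‖) - basisTrace b A := by
    have hbb : ∑ k, ⟪b k, b k⟫ = (Fintype.card ι : ℝ) := by simp
    simp only [hquad, Finset.sum_add_distrib, Finset.sum_sub_distrib, ← Finset.mul_sum, hsum2, hbb]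
    rw [hJQx, hxx, hQx, hJxJx, hJ.inner_self', basisTrace]
    ring
  have hQx' : ⟪Q, x⟫ = ‖x‖ / Real.sinh ‖x‖ := by rw [real_inner_comm, hQx]
  have hQJ' : ⟪J Q, x⟫ = ‖x‖ ^ 2 / Real.sinh ‖x‖ ^ 2 * (f / Real.cosh ‖x‖ ^ 2) := by
    rw [hJ.skew, real_inner_comm, hQJ, neg_neg]
  have hQJ'' : ⟪Q, J x⟫ = -(‖x‖ ^ 2 / Real.sinh ‖x‖ ^ 2 * (f / Real.cosh ‖x‖ ^ 2)) := by
    rw [real_inner_comm, hQJ]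
  rw [hsum, hquad (J x), hquad x, hquad Q, hJQx, hJ.inner_self Q, hQx, hQQ, hqq, hAQ, hQJ, hJxJx,
    hJ.inner_self', hJ.inner_self, hAxx, hxx, graphG, ← hq, ← hf, hQx']
  clear hquad hsum hQQ hqq hAQ hQJ hJxJx hQx hQx' hQJ' hQJ'' hJQx hAxx hxx hpq hqx hsum2
  set V := graphV J ‖x‖ p x
  have hV0 : V ≠ 0 := by linarith
  clear_value V f q Q
  -- What is left is a rational identity in independent variables, subject only to sh² = ch² − 1.
  generalize basisTrace b A = t
  generalize ⟪A (J x), J x⟫ = a1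
  generalize ⟪A q, q⟫ = a2
  generalize (Fintype.card ι : ℝ) = m
  generalize Real.sinh ‖x‖ = sh at *
  generalize Real.cosh ‖x‖ = ch at *
  generalize ‖x‖ = r at *
  have h2 : sh ^ 2 = ch ^ 2 - 1 := by linarith
  have h4 : sh ^ 4 = (ch ^ 2 - 1) ^ 2 := by rw [← h2]; ring
  have h6 : sh ^ 6 = (ch ^ 2 - 1) ^ 3 := by rw [← h2]; ring
  field_simp
  ring_nf
  simp only [h2, h4, h6]
  ring

end

end AmbientMetric

end CHFlow

namespace CHFlow

open scoped ContDiff Topology RealInnerProductSpace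
open Set Filter Function

/-! ### Traces with respect to the metric of a hypersurface -/

section Trace

/-- The trace of a bilinear form `h` with respect to a bilinear form `g`, in terms of a
reproducing family for `g`. -/
theorem trace_mul_inv_of_reproducing {V ι K : Type*} [AddCommGroup V] [Module ℝ V] [Fintype ι]
    [DecidableEq ι] [Fintype K] (e : Module.Basis ι ℝ V) (g h : V →ₗ[ℝ] V →ₗ[ℝ] ℝ) (κ : K → ℝ)
    (c : K → V) (hc : ∀ v, v = ∑ k, (κ k * g v (c k)) • c k) :
    (Matrix.of (fun i j => h (e i) (e j)) * (Matrix.of fun i j => g (e i) (e j))⁻¹).trace =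
      ∑ k, κ k * h (c k) (c k) := by
  have hexp : ∀ k, ∑ j, e.repr (c k) j • e j = c k := fun k => e.sum_repr (c k)
  -- The reproducing property says that ∑ κ c ⊗ c is the inverse of g; its coordinates are therefore
  -- the inverse Gram matrix.
  have hinv : (Matrix.of fun i j => g (e i) (e j))⁻¹ =
      Matrix.of fun i j => ∑ k, κ k * (e.repr (c k) i * e.repr (c k) j) := by
    refine Matrix.inv_eq_right_inv ?_
    ext i l
    rw [Matrix.mul_apply]
    have h1 : e.repr (e i) l = ∑ k, κ k * g (e i) (c k) * e.repr (c k) l := by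
      conv_lhs => rw [hc (e i)]
      simp
    have h2 : (1 : Matrix ι ι ℝ) i l = e.repr (e i) l := by
      rw [e.repr_self, Matrix.one_apply, Finsupp.single_apply]
    rw [h2, h1]
    simp only [Matrix.of_apply, Finset.mul_sum]
    rw [Finset.sum_comm]
    refine Finset.sum_congr rfl fun k _ => ?_
    have h3 : g (e i) (c k) = ∑ j, e.repr (c k) j * g (e i) (e j) := by
      conv_lhs => rw [← hexp k]
      simp only [map_sum, map_smul, smul_eq_mul]
    rw [h3, Finset.mul_sum, Finset.sum_mul]
    exact Finset.sum_congr rfl fun j _ => by ring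
  rw [hinv, Matrix.trace]
  simp only [Matrix.diag_apply, Matrix.mul_apply, Matrix.of_apply, Finset.mul_sum]
  have h3 : ∀ k, h (c k) (c k) = ∑ i, ∑ j, e.repr (c k) i * e.repr (c k) j * h (e i) (e j) := by
    intro k
    conv_lhs => rw [← hexp k]
    simp only [map_sum, map_smul, smul_eq_mul, LinearMap.sum_apply, LinearMap.smul_apply,
      Finset.mul_sum]
    rw [Finset.sum_comm]
    exact Finset.sum_congr rfl fun i _ => Finset.sum_congr rfl fun j _ => by ring
  simp only [h3, Finset.mul_sum]
  symm
  rw [Finset.sum_comm]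
  refine Finset.sum_congr rfl fun i _ => ?_
  rw [Finset.sum_comm]
  exact Finset.sum_congr rfl fun j _ => Finset.sum_congr rfl fun k _ => by ring

/-- The trace over a hyperplane `Qᗮ`, parametrized by `L`. -/
theorem trace_hyperplane {E V ι K : Type*} [AddCommGroup V] [Module ℝ V] [AddCommGroup E]
    [Module ℝ E] [Fintype ι] [DecidableEq ι] [Fintype K] (e : Module.Basis ι ℝ V) (L : V →ₗ[ℝ] E)
    (hL : Injective L) (g B : E →ₗ[ℝ] E →ₗ[ℝ] ℝ) (hg : ∀ v w, g v w = g w v)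
    (hB : ∀ v w, B v w = B w v) {Q : E} (hQ : g Q Q ≠ 0) (hker : ∀ v, g Q (L v) = 0)
    (hrange : ∀ w, g Q w = 0 → ∃ v, L v = w) (κ : K → ℝ) (c : K → E)
    (hc : ∀ w, w = ∑ k, (κ k * g w (c k)) • c k) :
    (Matrix.of (fun i j => B (L (e i)) (L (e j))) *
      (Matrix.of fun i j => g (L (e i)) (L (e j)))⁻¹).trace =
      ∑ k, κ k * B (c k) (c k) - B Q Q / g Q Q := by
  -- Projecting a reproducing family of the whole space along Q gives one of the hyperplane, which
  -- `L` pulls back.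
  have h1 : ∀ k, ∃ d, L d = c k - (g Q (c k) / g Q Q) • Q := fun k => by
    refine hrange _ ?_
    rw [map_sub, map_smul, smul_eq_mul, div_mul_cancel₀ _ hQ, sub_self]
  choose d hd using h1
  have h2 : ∀ v, v = ∑ k, (κ k * g.compl₁₂ L L v (d k)) • d k := by
    intro v
    refine hL ?_
    simp only [map_sum, map_smul, LinearMap.compl₁₂_apply, hd, map_sub, hg (L v) Q, hker,
      smul_zero, sub_zero, smul_sub, Finset.sum_sub_distrib]
    rw [← hc (L v)]
    have h3 : ∑ k, (κ k * g (L v) (c k)) • (g Q (c k) / g Q Q) • Q =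
        (∑ k, κ k * g (L v) (c k) * g Q (c k)) • (g Q Q)⁻¹ • Q := by
      rw [Finset.sum_smul]
      exact Finset.sum_congr rfl fun k _ => by
        rw [smul_smul, smul_smul, div_eq_mul_inv, mul_assoc, mul_assoc, mul_assoc]
    have h4 : ∑ k, κ k * g (L v) (c k) * g Q (c k) = 0 := by
      have := congrArg (g Q) (hc (L v))
      simp only [map_sum, map_smul, hker, smul_eq_mul] at this
      exact this.symm
    rw [h3, h4, zero_smul, sub_zero]
  have h3 := trace_mul_inv_of_reproducing e (g.compl₁₂ L L) (B.compl₁₂ L L) κ d h2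
  simp only [LinearMap.compl₁₂_apply] at h3
  rw [h3]
  have hBQ : ∑ k, κ k * g Q (c k) * B Q (c k) = B Q Q := by
    have := congrArg (B Q) (hc Q)
    simp only [map_sum, map_smul, smul_eq_mul] at this
    exact this.symm
  have hgQ : ∑ k, κ k * g Q (c k) * g Q (c k) = g Q Q := by
    have := congrArg (g Q) (hc Q)
    simp only [map_sum, map_smul, smul_eq_mul] at this
    exact this.symm
  -- After summation the cross terms contribute −2 B(Q, Q)/g(Q, Q) and the square terms +B(Q,
  -- Q)/g(Q, Q).
  have h5 : ∀ k, κ k * B (L (d k)) (L (d k)) = κ k * B (c k) (c k)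
      - 2 / g Q Q * (κ k * g Q (c k) * B Q (c k))
      + B Q Q / g Q Q ^ 2 * (κ k * g Q (c k) * g Q (c k)) := by
    intro k
    simp only [hd, map_sub, map_smul, LinearMap.sub_apply, LinearMap.smul_apply, smul_eq_mul,
      hB (c k) Q]
    field_simp
    ring
  simp only [h5, Finset.sum_add_distrib, Finset.sum_sub_distrib, ← Finset.mul_sum, hBQ, hgQ]
  field_simp
  ring

end Trace

/-! ### The inverse of the ambient metric and traces over its level sets. -/

section Hypersurface

variable {E ι : Type*} [NormedAddCommGroup E] [InnerProductSpace ℝ E] [Fintype ι]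
variable {J : E →L[ℝ] E} (hJ : IsOrthComplex J)
include hJ

/-- The weights of the reproducing family of the ambient metric. -/
noncomputable def frameWeight (ι : Type*) (x : E) : Option (Option ι) → ℝ
  | none => -(‖x‖ ^ 2 / Real.sinh ‖x‖ ^ 2 * (Real.sinh ‖x‖ ^ 2 / Real.cosh ‖x‖ ^ 2 / ‖x‖ ^ 2))
  | some none => -(‖x‖ ^ 2 / Real.sinh ‖x‖ ^ 2 * ((1 - Real.sinh ‖x‖ ^ 2 / ‖x‖ ^ 2) / ‖x‖ ^ 2))
  | some (some _) => ‖x‖ ^ 2 / Real.sinh ‖x‖ ^ 2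

/-- The reproducing family of the ambient metric. -/
noncomputable def frameVector (J : E →L[ℝ] E) (b : OrthonormalBasis ι ℝ E) (x : E) :
    Option (Option ι) → E
  | none => J x
  | some none => x
  | some (some k) => b k

/-- The metric is a multiple of the Euclidean one plus rank-one terms in the orthogonal directions x
and J x, so it is inverted separately in each of them; the two extra weights are these corrections
and need not be positive. -/
theorem ambientMetric_reproducing (b : OrthonormalBasis ι ℝ E) {x : E} (hx : x ≠ 0) (w : E) :
    w = ∑ k, (frameWeight ι x k * ambientMetric J x w (frameVector J b x k)) •
      frameVector J b x k := by
  have hr : 0 < ‖x‖ := norm_pos_iff.mpr hx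
  have hs : 0 < Real.sinh ‖x‖ := Real.sinh_pos_iff.mpr hr
  have hc : 0 < Real.cosh ‖x‖ := Real.cosh_pos _
  have hc2 := Real.cosh_sq ‖x‖
  have hsum : ∀ u : E, ∑ k, ⟪u, b k⟫ • b k = u := fun u => by
    conv_rhs => rw [← b.sum_repr' u]
    exact Finset.sum_congr rfl fun k _ => by rw [real_inner_comm]
  have h1 : ∑ k, ambientMetric J x w (b k) • b k = (Real.sinh ‖x‖ ^ 2 / ‖x‖ ^ 2) • w
      + ((1 - Real.sinh ‖x‖ ^ 2 / ‖x‖ ^ 2) / ‖x‖ ^ 2 * ⟪x, w⟫) • x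
      + ((Real.sinh ‖x‖ ^ 2 / ‖x‖ ^ 2) ^ 2 * ⟪J x, w⟫) • J x := by
    simp only [ambientMetric, add_smul, Finset.sum_add_distrib, ← mul_assoc, mul_smul _ ⟪_, b _⟫,
      ← Finset.smul_sum, hsum]
  have h2 : ambientMetric J x w x = ⟪x, w⟫ := by
    rw [ambientMetric, hJ.inner_self, real_inner_self_eq_norm_sq, real_inner_comm x w]
    field_simp
    ring
  have h3 : ambientMetric J x w (J x) =
      Real.sinh ‖x‖ ^ 2 / ‖x‖ ^ 2 * Real.cosh ‖x‖ ^ 2 * ⟪J x, w⟫ := by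
    rw [ambientMetric, hJ.inner_self', real_inner_self_eq_norm_sq, hJ.norm_map,
      real_inner_comm (J x) w, hc2]
    field_simp
    ring
  rw [Fintype.sum_option, Fintype.sum_option]
  have h4 : ∀ k, (frameWeight ι x (some (some k)) * ambientMetric J x w (b k)) • b k =
      (‖x‖ ^ 2 / Real.sinh ‖x‖ ^ 2) • (ambientMetric J x w (b k) • b k) := fun k =>
    mul_smul _ _ _
  simp only [frameVector, h4, ← Finset.smul_sum]
  rw [h1, h2, h3]
  simp only [frameWeight, smul_add, smul_smul]
  have key : ∀ (α β γ δ ε : ℝ), α = 1 → β + δ = 0 → γ + ε = 0 →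
      w = ε • J x + (δ • x + (α • w + β • x + γ • J x)) := by
    intro α β γ δ ε hα hβ hγ
    rw [hα, ← neg_eq_of_add_eq_zero_left hβ, ← neg_eq_of_add_eq_zero_left hγ, one_smul, neg_smul,
      neg_smul]
    abel
  refine key _ _ _ _ _ ?_ ?_ ?_ <;> field_simp <;> ring

/-- The trace of the Hessian of `potential ‖x‖ - φ` over a level set. -/
theorem trace_levelForm {V κ : Type*} [AddCommGroup V] [Module ℝ V] [Fintype κ] [DecidableEq κ]
    (e : Module.Basis κ ℝ V) (L : V →ₗ[ℝ] E) (hL : Injective L) (b : OrthonormalBasis ι ℝ E)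
    {x p : E} (hx : x ≠ 0) (hpx : ⟪p, x⟫ = 0) {A : E →L[ℝ] E}
    (hA : ∀ v w, ⟪A v, w⟫ = ⟪A w, v⟫) (hAx : A x = -p)
    (hker : ∀ v, ambientMetric J x (levelGrad J p x) (L v) = 0)
    (hrange : ∀ w, ambientMetric J x (levelGrad J p x) w = 0 → ∃ v, L v = w) :
    (Matrix.of (fun i j => levelForm J p A x (L (e i)) (L (e j))) *
      (Matrix.of fun i j => ambientMetric J x (L (e i)) (L (e j)))⁻¹).trace =
      graphG J b ‖x‖ p A x / Real.sinh ‖x‖ ^ 2 := by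
  have hr : 0 < ‖x‖ := norm_pos_iff.mpr hx
  have hs : 0 < Real.sinh ‖x‖ := Real.sinh_pos_iff.mpr hr
  have hV := one_le_graphV hJ ‖x‖ p x
  have h := trace_hyperplane e L hL (ambientForm J x) (levelForm J p A x) (ambientMetric_comm J x)
    (levelForm_comm J p hA x) (Q := levelGrad J p x)
    (by rw [ambientForm_apply, ambientMetric_levelGrad_self hJ hx hpx]; positivity)
    hker hrange (frameWeight ι x) (frameVector J b x) (ambientMetric_reproducing hJ b hx)
  simp only [ambientForm_apply] at h
  rw [h, ← levelForm_trace hJ hx hpx b hA hAx, ambientMetric_levelGrad_self hJ hx hpx,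
    Fintype.sum_option, Fintype.sum_option]
  simp only [frameWeight, frameVector, ← Finset.mul_sum]
  ring

/-- A unit normal of a level set is determined up to its sign. -/
theorem unit_normal_eq {x p N : E} (hx : x ≠ 0) (hpx : ⟪p, x⟫ = 0)
    (hN : ∀ w, ambientMetric J x (levelGrad J p x) w = 0 → ambientMetric J x N w = 0)
    (hN1 : ambientMetric J x N N = 1) (hNx : 0 < ambientMetric J x N x) :
    N = (Real.sinh ‖x‖ / √(graphV J ‖x‖ p x)) • levelGrad J p x := by
  have hr : 0 < ‖x‖ := norm_pos_iff.mpr hx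
  have hs : 0 < Real.sinh ‖x‖ := Real.sinh_pos_iff.mpr hr
  have hV := one_le_graphV hJ ‖x‖ p x
  set V := graphV J ‖x‖ p x with hVdef
  set Q := levelGrad J p x with hQ
  have hQQ : ambientMetric J x Q Q = V / Real.sinh ‖x‖ ^ 2 :=
    ambientMetric_levelGrad_self hJ hx hpx
  have hQQ0 : ambientForm J x Q Q ≠ 0 := by rw [ambientForm_apply, hQQ]; positivity
  -- N − μ Q is orthogonal to Q, hence by `hN` also to N, hence to itself. Unit length fixes μ² and
  -- the sign against x fixes μ.
  set μ := ambientMetric J x N Q / ambientMetric J x Q Q with hμ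
  have hperp : ambientForm J x Q (N - μ • Q) = 0 := by
    rw [map_sub, map_smul, smul_eq_mul, hμ, ambientForm_apply, ambientForm_apply,
      ambientMetric_comm J x Q N, div_mul_cancel₀ _ (by rwa [ambientForm_apply] at hQQ0), sub_self]
  have hNμ : N - μ • Q = 0 := by
    by_contra hne
    have h1 := ambientMetric_self_pos J hx hne
    have h2 : ambientForm J x (N - μ • Q) (N - μ • Q) = 0 := by
      rw [map_sub (ambientForm J x), map_smul, LinearMap.sub_apply, LinearMap.smul_apply, hperp,
        ambientForm_apply, hN _ hperp, smul_zero, sub_zero]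
    exact h1.ne' h2
  have hNeq : N = μ • Q := sub_eq_zero.mp hNμ
  have e1 : μ ^ 2 * (V / Real.sinh ‖x‖ ^ 2) = 1 := by
    rw [← hN1, ← hQQ]
    have : ambientForm J x N N = μ ^ 2 * ambientForm J x Q Q := by
      rw [hNeq, map_smul, map_smul, LinearMap.smul_apply]; simp only [smul_eq_mul]; ring
    exact this.symm
  have e2 : 0 < μ := by
    have : ambientForm J x N x = μ * ambientForm J x Q x := by
      rw [hNeq, map_smul, LinearMap.smul_apply, smul_eq_mul]
    rw [ambientForm_apply, ambientForm_apply, ambientMetric_levelGrad hJ hx hpx, hpx, sub_zero,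
      real_inner_self_eq_norm_sq] at this
    rw [this] at hNx
    exact pos_of_mul_pos_left hNx (by positivity)
  rw [hNeq]
  congr 1
  clear_value μ
  have e3 : μ ^ 2 = (Real.sinh ‖x‖ / √V) ^ 2 := by
    rw [div_pow, Real.sq_sqrt (by linarith)]
    field_simp at e1 ⊢
    linarith
  exact (sq_eq_sq₀ e2.le (by positivity)).mp e3

end Hypersurface

/-! ### Differentiating the level equation of a hypersurface. -/

section LevelSet

variable {E : Type*} [NormedAddCommGroup E] [InnerProductSpace ℝ E] [CompleteSpace E]

/-- The second derivative of a map into a level set of `potential ‖x‖ - φ`. -/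
theorem level_derivatives {φ : E → ℝ} (hφ : IsSmoothConic φ) {f : E → E} {z : E}
    (hf : ContDiffAt ℝ 2 f z) (hfz : f z ≠ 0)
    (hlev : ∀ᶠ y in 𝓝 z, potential ‖f y‖ = φ (f y)) (X Y : E) :
    1 / (‖f z‖ * Real.sinh ‖f z‖) * ⟪f z, fderiv ℝ f z X⟫
      - ⟪gradient φ (f z), fderiv ℝ f z X⟫ = 0 ∧
    levelHess (hessOp φ (f z)) (f z) (fderiv ℝ f z X) (fderiv ℝ f z Y)
      + (1 / (‖f z‖ * Real.sinh ‖f z‖) * ⟪f z, fderiv ℝ (fun y => fderiv ℝ f y Y) z X⟫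
      - ⟪gradient φ (f z), fderiv ℝ (fun y => fderiv ℝ f y Y) z X⟫) = 0 := by
  have hev1 : ∀ᶠ y in 𝓝 z, DifferentiableAt ℝ f y :=
    (hf.eventually (by simp)).mono fun y hy => hy.differentiableAt (by simp)
  have hev2 : ∀ᶠ y in 𝓝 z, f y ≠ 0 := hf.continuousAt.eventually_ne hfz
  have key : ∀ᶠ y in 𝓝 z, ∀ X, 1 / (‖f y‖ * Real.sinh ‖f y‖) * ⟪f y, fderiv ℝ f y X⟫
      - ⟪gradient φ (f y), fderiv ℝ f y X⟫ = 0 := by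
    filter_upwards [hev1, hev2, hlev.eventually_nhds] with y h1 h2 h3 X
    have hr : 0 < ‖f y‖ := norm_pos_iff.mpr h2
    have h4 : HasFDerivAt (fun y => potential ‖f y‖ - φ (f y)) _ y :=
      ((hasFDerivAt_radial h2 (hasDerivAt_potential hr)).comp y h1.hasFDerivAt).fun_sub
        ((hφ.hasFDerivAt h2).comp y h1.hasFDerivAt)
    have h5 : HasFDerivAt (fun y => potential ‖f y‖ - φ (f y)) (0 : E →L[ℝ] ℝ) y :=
      (hasFDerivAt_const (0 : ℝ) y).congr_of_eventuallyEq (h3.mono fun w hw => by simp [hw])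
    have h6 := congrArg (fun T => T X) (h4.unique h5)
    simp only [sub_apply, ContinuousLinearMap.comp_apply, smul_apply, innerSL_apply_apply,
      smul_eq_mul, zero_apply] at h6
    rw [inner_gradient, ← h6]
    congr 2
    rw [div_div, mul_comm]
  refine ⟨key.self_of_nhds X, ?_⟩
  have hr : 0 < ‖f z‖ := norm_pos_iff.mpr hfz
  have hs : 0 < Real.sinh ‖f z‖ := Real.sinh_pos_iff.mpr hr
  have hfd : HasFDerivAt f (fderiv ℝ f z) z := hev1.self_of_nhds.hasFDerivAt
  have hD : HasFDerivAt (fun y => fderiv ℝ f y Y) (fderiv ℝ (fun y => fderiv ℝ f y Y) z) z := by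
    have : ContDiffAt ℝ 1 (fderiv ℝ f) z := hf.fderiv_right (by norm_cast)
    exact ((this.differentiableAt (by simp)).clm_apply (differentiableAt_const Y)).hasFDerivAt
  have hid := hasDerivAt_id ‖f z‖
  have hrad : HasDerivAt (fun r : ℝ => 1 / (r * Real.sinh r))
      (-(Real.sinh ‖f z‖ + ‖f z‖ * Real.cosh ‖f z‖) / (‖f z‖ ^ 2 * Real.sinh ‖f z‖ ^ 2)) ‖f z‖ := by
    refine ((hasDerivAt_const ‖f z‖ (1 : ℝ)).fun_div (hid.fun_mul hid.sinh)
      (by positivity)).congr_deriv ?_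
    simp only [id]
    field_simp
    ring
  have h1 := (((hasFDerivAt_radial hfz hrad).comp z hfd).fun_mul (hfd.inner ℝ hD)).fun_sub
    (((hφ.hasFDerivAt_gradient hfz).comp z hfd).inner ℝ hD)
  have h2 : HasFDerivAt (fun y => 1 / (‖f y‖ * Real.sinh ‖f y‖) * ⟪f y, fderiv ℝ f y Y⟫
      - ⟪gradient φ (f y), fderiv ℝ f y Y⟫) (0 : E →L[ℝ] ℝ) z :=
    (hasFDerivAt_const (0 : ℝ) z).congr_of_eventuallyEq (key.mono fun y hy => hy Y)
  have h3 := congrArg (fun T => T X) (h1.unique h2)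
  simp only [sub_apply, add_apply, ContinuousLinearMap.comp_apply, smul_apply,
    innerSL_apply_apply, smul_eq_mul, zero_apply, fderivInnerCLM_apply,
    ContinuousLinearMap.prod_apply, Function.comp_apply] at h3
  rw [← h3, levelHess]
  ring

end LevelSet

end CHFlow

namespace CHFlow

open scoped ContDiff Topology RealInnerProductSpace
open Set Filter Function

/-! ### Complex hyperbolic space -/

section ComplexSpace

variable {n : ℕ}

theorem euc_eq_inner (u w : CSpace n) : euc u w = ⟪u, w⟫ := by
  rw [euc, PiLp.inner_apply, PiLp.inner_apply, Complex.re_sum]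
  rfl

/-- Multiplication by `i`. -/
noncomputable def hopfJ (n : ℕ) : CSpace n →L[ℝ] CSpace n :=
  (Complex.I • ContinuousLinearMap.id ℂ (CSpace n)).restrictScalars ℝ

@[simp] theorem hopfJ_apply (x : CSpace n) : hopfJ n x = Complex.I • x := rfl

theorem isOrthComplex_hopfJ (n : ℕ) : IsOrthComplex (hopfJ n) where
  sq x := by rw [hopfJ_apply, hopfJ_apply, smul_smul, Complex.I_mul_I, neg_one_smul]
  skew x y := by
    rw [hopfJ_apply, hopfJ_apply, ← euc_eq_inner, ← euc_eq_inner, euc, euc, inner_smul_left,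
      inner_smul_right]
    simp

theorem finrank_real_CSpace (n : ℕ) : Module.finrank ℝ (CSpace n) = 2 * n := by
  have h := Module.finrank_mul_finrank ℝ ℂ (CSpace n)
  rw [← h, Complex.finrank_real_complex, finrank_euclideanSpace_fin]

/-- In linear coordinates the polar form becomes a conformal term plus two rank-one terms with
radial coefficients, which can be differentiated explicitly to get the Christoffel symbols. -/
theorem hypMetric_eq {x : CSpace n} (hx : x ≠ 0) (u w : CSpace n) :
    hypMetric x u w = ambientMetric (hopfJ n) x u w := by
  have hJ := isOrthComplex_hopfJ n
  have hr : ‖x‖ ≠ 0 := norm_ne_zero_iff.mpr hx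
  have hI : Complex.I • ((‖x‖⁻¹ : ℝ) • x) = (‖x‖⁻¹ : ℝ) • hopfJ n x := by
    rw [hopfJ_apply, smul_comm]
  simp only [hypMetric, hx, if_false, bergerMetric, euc_eq_inner, hI, ambientMetric,
    real_inner_smul_left, real_inner_smul_right, inner_sub_left, inner_sub_right,
    hJ.inner_self, real_inner_self_eq_norm_sq, Real.cosh_sq, real_inner_comm x u]
  field_simp
  ring

theorem christoffel_eq {x : CSpace n} (hx : x ≠ 0) (u w q : CSpace n) :
    christoffel x u w q = ambientChristoffel (hopfJ n) x u w q := by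
  have h : ∀ u w v : CSpace n, fderiv ℝ (fun y => hypMetric y u w) x v =
      ambientMetricDeriv (hopfJ n) x v u w := by
    intro u w v
    have he : (fun y => hypMetric y u w) =ᶠ[𝓝 x] fun y => ambientMetric (hopfJ n) y u w :=
      (eventually_ne_nhds hx).mono fun y hy => hypMetric_eq hy u w
    rw [he.fderiv_eq, fderiv_ambientMetric _ hx]
  rw [christoffel, ambientChristoffel, h, h, h]

theorem norm_coe_sphere (z : USphere n) : ‖(z : CSpace n)‖ = 1 := mem_sphere_zero_iff_norm.mp z.2

theorem coe_sphere_ne_zero (z : USphere n) : (z : CSpace n) ≠ 0 := by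
  rw [← norm_ne_zero_iff, norm_coe_sphere]
  exact one_ne_zero

theorem toSphere_coe (z : USphere n) (hz : (z : CSpace n) ≠ 0) : toSphere (z : CSpace n) hz = z := by
  ext1
  change (‖(z : CSpace n)‖⁻¹ : ℝ) • (z : CSpace n) = z
  rw [norm_coe_sphere, inv_one, one_smul]

theorem toSphere_smul {c : ℝ} (hc : 0 < c) {x : CSpace n} (hx : x ≠ 0) (hcx : c • x ≠ 0) :
    toSphere (c • x) hcx = toSphere x hx := by
  ext1
  simp only [toSphere]
  rw [norm_smul, Real.norm_of_nonneg hc.le, mul_inv, smul_smul, mul_right_comm,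
    inv_mul_cancel₀ hc.ne', one_mul]

variable {W : Type*} [Zero W]

theorem ext_of_ne (f : USphere n → W) {y : CSpace n} (hy : y ≠ 0) : ext f y = f (toSphere y hy) := by
  rw [ext, dif_neg hy]

theorem ext_coe (f : USphere n → W) (z : USphere n) : ext f (z : CSpace n) = f z := by
  rw [ext_of_ne f (coe_sphere_ne_zero z), toSphere_coe]

theorem ext_smul (f : USphere n → W) {c : ℝ} (hc : 0 < c) {x : CSpace n} (hx : x ≠ 0) :
    ext f (c • x) = ext f x := by
  rw [ext_of_ne f hx, ext_of_ne f (smul_ne_zero hc.ne' hx), toSphere_smul hc hx]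

theorem mem_sphereTangent {z : USphere n} {X : CSpace n} :
    X ∈ sphereTangent z ↔ ⟪(z : CSpace n), X⟫ = 0 := by
  rw [← euc_eq_inner]
  rfl

theorem finrank_sphereTangent (z : USphere n) :
    Module.finrank ℝ (sphereTangent z) + 1 = Module.finrank ℝ (CSpace n) := by
  have h0 : (innerSL ℝ (z : CSpace n)).toLinearMap ≠ 0 := by
    intro h
    have := congrArg (fun T => T (z : CSpace n)) h
    simp at this
  have : sphereTangent z = LinearMap.ker (innerSL ℝ (z : CSpace n)).toLinearMap := by
    ext X
    rw [mem_sphereTangent, LinearMap.mem_ker]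
    simp
  rw [this, ← Module.Dual.finrank_ker_add_one_of_ne_zero h0]

/-- The unit normal and the mean curvature of a hypersurface that is a level set of
`potential ‖x‖ - φ`. -/
theorem normal_and_meanCurvature {ι : Type*} [Fintype ι] (b : OrthonormalBasis ι ℝ (CSpace n))
    {F : USphere n → CSpace n} {z : USphere n} {N : CSpace n} {φ : CSpace n → ℝ}
    (hφ : IsSmoothConic φ) (hF : ContDiffAt ℝ 2 (ext F) z) (h0 : F z ≠ 0)
    (hlev : ∀ᶠ y in 𝓝 (z : CSpace n), potential ‖ext F y‖ = φ (ext F y))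
    (himm : ∀ X ∈ sphereTangent z, pushforward F z X = 0 → X = 0)
    (hN : IsOutwardNormal F z N) :
    N = (Real.sinh ‖F z‖ / √(graphV (hopfJ n) ‖F z‖ (gradient φ (F z)) (F z))) •
        levelGrad (hopfJ n) (gradient φ (F z)) (F z) ∧
    meanCurvature F N z =
      graphG (hopfJ n) b ‖F z‖ (gradient φ (F z)) (hessOp φ (F z)) (F z) /
      (Real.sinh ‖F z‖ * √(graphV (hopfJ n) ‖F z‖ (gradient φ (F z)) (F z))) := by
  have hJ := isOrthComplex_hopfJ n
  have hr : 0 < ‖F z‖ := norm_pos_iff.mpr h0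
  have hs : 0 < Real.sinh ‖F z‖ := Real.sinh_pos_iff.mpr hr
  have hpx : ⟪gradient φ (F z), F z⟫ = 0 := hφ.inner_gradient_self h0
  have hV := one_le_graphV hJ ‖F z‖ (gradient φ (F z)) (F z)
  have hlevel := level_derivatives hφ hF (by rwa [ext_coe]) hlev
  rw [ext_coe] at hlevel
  set x := F z with hxdef
  set p := gradient φ x with hp
  set A := hessOp φ x with hA
  set V := graphV (hopfJ n) ‖x‖ p x with hVdef
  set Q := levelGrad (hopfJ n) p x with hQ
  set L : sphereTangent z →ₗ[ℝ] CSpace n :=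
    (fderiv ℝ (ext F) (z : CSpace n)).toLinearMap.domRestrict (sphereTangent z) with hL
  have hLapp : ∀ X : sphereTangent z, L X = pushforward F z X := fun X => rfl
  have hLinj : Injective L := by
    rw [← LinearMap.ker_eq_bot, LinearMap.ker_eq_bot']
    intro X hX
    exact Subtype.ext (himm X X.2 hX)
  have hker0 : ∀ X, ambientMetric (hopfJ n) x Q (pushforward F z X) = 0 := fun X => by
    rw [hQ, ambientMetric_levelGrad hJ h0 hpx]
    exact (hlevel X X).1
  have hQ0 : ambientForm (hopfJ n) x Q ≠ 0 := by
    intro h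
    have h1 : ambientForm (hopfJ n) x Q Q = 0 := by rw [h]; rfl
    rw [ambientForm_apply, hQ, ambientMetric_levelGrad_self hJ h0 hpx] at h1
    have : 0 < V / Real.sinh ‖x‖ ^ 2 := by positivity
    exact this.ne' h1
  have hrange : ∀ w, ambientMetric (hopfJ n) x Q w = 0 → ∃ X, L X = w := by
    have hle : LinearMap.range L ≤ LinearMap.ker (ambientForm (hopfJ n) x Q) := by
      rintro _ ⟨X, rfl⟩
      exact hker0 X
    -- Both spaces have codimension one: the immersion is injective on the tangent space of the
    -- sphere, and the functional is nonzero.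
    have hfin : Module.finrank ℝ (LinearMap.range L) =
        Module.finrank ℝ (LinearMap.ker (ambientForm (hopfJ n) x Q)) := by
      have h1 := Module.Dual.finrank_ker_add_one_of_ne_zero hQ0
      have h2 := finrank_sphereTangent z
      rw [LinearMap.finrank_range_of_inj hLinj]
      omega
    have heq := Submodule.eq_of_le_of_finrank_eq hle hfin
    intro w hw
    have : w ∈ LinearMap.range L := by rw [heq]; exact hw
    exact this
  obtain ⟨⟨hN1, hNt⟩, hNx⟩ := hN
  rw [← hxdef, hypMetric_eq h0] at hN1 hNx
  have hNeq : N = (Real.sinh ‖x‖ / √V) • Q := by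
    refine unit_normal_eq hJ h0 hpx (fun w hw => ?_) hN1 hNx
    obtain ⟨X, rfl⟩ := hrange w hw
    rw [← hypMetric_eq h0]
    exact hNt X X.2
  refine ⟨hNeq, ?_⟩
  -- The twice differentiated level equation trades the second derivatives of F, paired with the
  -- normal, for the Hessian of the defining function.
  have hform : ∀ X Y : sphereTangent z, secondFundForm F N z X Y =
      Real.sinh ‖x‖ / √V * levelForm (hopfJ n) p A x (L X) (L Y) := by
    intro X Y
    have h1 := (hlevel X Y).2
    have h2 := ambientMetric_levelGrad hJ h0 hpx
      (fderiv ℝ (fun y => fderiv ℝ (ext F) y Y) (z : CSpace n) X)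
    rw [← h2, ← hQ] at h1
    have h3 : ∀ w, ambientMetric (hopfJ n) x w ((Real.sinh ‖x‖ / √V) • Q) =
        Real.sinh ‖x‖ / √V * ambientMetric (hopfJ n) x Q w := fun w => by
      rw [ambientMetric_comm (hopfJ n) x Q w]
      exact (ambientForm (hopfJ n) x w).map_smul _ _
    have h4 : ∀ u w, ambientChristoffel (hopfJ n) x u w ((Real.sinh ‖x‖ / √V) • Q) =
        Real.sinh ‖x‖ / √V * ambientChristoffel (hopfJ n) x u w Q := fun u w => by
      simp only [ambientChristoffel, ambientMetricDeriv, map_smul, inner_smul_left,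
        inner_smul_right, conj_trivial]
      ring
    rw [secondFundForm, ← hxdef, hypMetric_eq h0, christoffel_eq h0, hNeq, h3, h4, levelForm_apply,
      hLapp, hLapp]
    rw [← hQ]
    have h5 : levelHess A x (pushforward F z X) (pushforward F z Y) +
      ambientMetric (hopfJ n) x Q
        (fderiv ℝ (fun y => fderiv ℝ (ext F) y Y) (z : CSpace n) X) = 0 := h1
    linear_combination (-(Real.sinh ‖x‖ / √V)) * h5
  have htr := trace_levelForm hJ (Module.finBasis ℝ (sphereTangent z)) L hLinj b h0 hpx
    (hφ.hessOp_symm h0) (hφ.hessOp_self h0) (fun X => hker0 X) hrange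
  rw [meanCurvature]
  simp only [hform, inducedMetric, ← hxdef, hypMetric_eq h0, ← hLapp]
  have hsm : (Matrix.of fun i j => Real.sinh ‖x‖ / √V *
      levelForm (hopfJ n) p A x (L (Module.finBasis ℝ (sphereTangent z) i))
        (L (Module.finBasis ℝ (sphereTangent z) j))) =
      (Real.sinh ‖x‖ / √V) • Matrix.of fun i j =>
      levelForm (hopfJ n) p A x (L (Module.finBasis ℝ (sphereTangent z) i))
        (L (Module.finBasis ℝ (sphereTangent z) j)) := by
    ext i j
    simp
  rw [hsm, Matrix.smul_mul, Matrix.trace_smul, htr, smul_eq_mul, ← hA]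
  have hV0 : 0 < √V := Real.sqrt_pos.mpr (by linarith)
  field_simp

end ComplexSpace

end CHFlow

namespace CHFlow

open scoped ContDiff Topology RealInnerProductSpace
open Set Filter Function

/-! ### Families of conical maps -/

section ConeIsotopy

variable {E : Type*} [NormedAddCommGroup E] [InnerProductSpace ℝ E] [FiniteDimensional ℝ E]

theorem exists_equiv_of_injective {E : Type*} [NormedAddCommGroup E] [NormedSpace ℝ E]
    [FiniteDimensional ℝ E] {D : E →L[ℝ] E} (h : ∀ v, D v = 0 → v = 0) :
    ∃ e : E ≃L[ℝ] E, (e : E →L[ℝ] E) = D := by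
  have hinj : Injective (D : E →ₗ[ℝ] E) := by
    rw [← LinearMap.ker_eq_bot, LinearMap.ker_eq_bot']
    exact h
  refine ⟨(LinearEquiv.ofInjectiveEndo (D : E →ₗ[ℝ] E) hinj).toContinuousLinearEquiv, ?_⟩
  ext v
  rfl

/-- A smooth family of local diffeomorphisms of `E ∖ {0}` that are homogeneous of degree one and
initially injective. -/
structure IsConeIsotopy (τ : ℝ) (Q : ℝ → E → E) : Prop where
  smooth : ContDiffOn ℝ ∞ (uncurry Q) (Ico 0 τ ×ˢ {0}ᶜ)
  homog : ∀ t ∈ Ico 0 τ, ∀ c : ℝ, 0 < c → ∀ x, x ≠ 0 → Q t (c • x) = c • Q t x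
  ne_zero : ∀ t ∈ Ico 0 τ, ∀ x, x ≠ 0 → Q t x ≠ 0
  inj_deriv : ∀ t ∈ Ico 0 τ, ∀ x, x ≠ 0 → ∀ v, fderiv ℝ (Q t) x v = 0 → v = 0
  inj_zero : ∀ x y, x ≠ 0 → y ≠ 0 → Q 0 x = Q 0 y → x = y

set_option linter.unusedSectionVars false

namespace IsConeIsotopy

variable {τ : ℝ} {Q : ℝ → E → E} (h : IsConeIsotopy τ Q)
include h

/-- By homogeneity this is compactness of the unit sphere, uniformly over a closed time interval.
The bounds supply the properness used below. -/
theorem exists_bounds {t₁ : ℝ} (ht₁ : t₁ < τ) :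
    ∃ a b : ℝ, 0 < a ∧ 0 < b ∧ ∀ t ∈ Icc 0 t₁, ∀ x, x ≠ 0 →
      a * ‖x‖ ≤ ‖Q t x‖ ∧ ‖Q t x‖ ≤ b * ‖x‖ := by
  have hsub : Icc 0 t₁ ×ˢ Metric.sphere (0 : E) 1 ⊆ Ico 0 τ ×ˢ {0}ᶜ := by
    rintro ⟨t, x⟩ ⟨ht, hx⟩
    refine ⟨⟨ht.1, ht.2.trans_lt ht₁⟩, ?_⟩
    rintro rfl
    simp at hx
  have hK : IsCompact (Icc 0 t₁ ×ˢ Metric.sphere (0 : E) 1) := isCompact_Icc.prod (isCompact_sphere 0 1)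
  have hcont : ContinuousOn (fun p : ℝ × E => ‖Q p.1 p.2‖) (Icc 0 t₁ ×ˢ Metric.sphere (0 : E) 1) :=
    (h.smooth.continuousOn.mono hsub).norm
  have key : ∃ a b : ℝ, 0 < a ∧ 0 < b ∧ ∀ t ∈ Icc 0 t₁, ∀ x, ‖x‖ = 1 →
      a ≤ ‖Q t x‖ ∧ ‖Q t x‖ ≤ b := by
    rcases (Icc 0 t₁ ×ˢ Metric.sphere (0 : E) 1).eq_empty_or_nonempty with he | hne
    · refine ⟨1, 1, one_pos, one_pos, fun t ht x hx => ?_⟩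
      have : (t, x) ∈ Icc 0 t₁ ×ˢ Metric.sphere (0 : E) 1 := ⟨ht, by simpa using hx⟩
      rw [he] at this
      exact this.elim
    · obtain ⟨p, hp, hmin⟩ := hK.exists_isMinOn hne hcont
      obtain ⟨q, hq, hmax⟩ := hK.exists_isMaxOn hne hcont
      have hpos : ∀ p ∈ Icc 0 t₁ ×ˢ Metric.sphere (0 : E) 1, 0 < ‖Q p.1 p.2‖ := fun p hp =>
        norm_pos_iff.mpr (h.ne_zero _ (hsub hp).1 _ (hsub hp).2)
      exact ⟨_, _, hpos p hp, hpos q hq, fun t ht x hx =>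
        ⟨hmin (show (t, x) ∈ Icc 0 t₁ ×ˢ Metric.sphere (0 : E) 1 from ⟨ht, by simpa using hx⟩),
          hmax (show (t, x) ∈ Icc 0 t₁ ×ˢ Metric.sphere (0 : E) 1 from ⟨ht, by simpa using hx⟩)⟩⟩
  obtain ⟨a, b, ha, hb, hab⟩ := key
  refine ⟨a, b, ha, hb, fun t ht x hx => ?_⟩
  have hr : 0 < ‖x‖ := norm_pos_iff.mpr hx
  have h1 : Q t x = ‖x‖ • Q t (‖x‖⁻¹ • x) := by
    rw [← h.homog t ⟨ht.1, ht.2.trans_lt ht₁⟩ _ hr _ (smul_ne_zero (inv_ne_zero hr.ne') hx),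
      smul_inv_smul₀ hr.ne']
  have h2 := hab t ht (‖x‖⁻¹ • x) (by rw [norm_smul, norm_inv, norm_norm, inv_mul_cancel₀ hr.ne'])
  rw [h1, norm_smul, norm_norm, mul_comm a, mul_comm b]
  exact ⟨by gcongr; exact h2.1, by gcongr; exact h2.2⟩

theorem contDiffAt {t : ℝ} (ht : t ∈ Ico 0 τ) {x : E} (hx : x ≠ 0) : ContDiffAt ℝ ∞ (Q t) x :=
  (contDiffOn_slice h.smooth ht).contDiffAt (isOpen_compl_singleton.mem_nhds hx)

theorem map_nhds {t : ℝ} (ht : t ∈ Ico 0 τ) {x : E} (hx : x ≠ 0) :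
    map (Q t) (𝓝 x) = 𝓝 (Q t x) := by
  obtain ⟨e, he⟩ := exists_equiv_of_injective (h.inj_deriv t ht x hx)
  have h1 := (h.contDiffAt ht hx).hasStrictFDerivAt (by simp)
  rw [← he] at h1
  exact h1.map_nhds_eq_of_equiv

/-- The image is open by the inverse function theorem and closed in the punctured space by the
two-sided bounds. The punctured space is connected because the real dimension exceeds one. -/
theorem surjective (hdim : 1 < Module.rank ℝ E) {t : ℝ} (ht : t ∈ Ico 0 τ) {x : E} (hx : x ≠ 0) :
    ∃ y, y ≠ 0 ∧ Q t y = x := by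
  have hconn : IsPreconnected ({0}ᶜ : Set E) :=
    (isConnected_compl_singleton_of_one_lt_rank hdim 0).isPreconnected
  have hopen : IsOpen (Q t '' {0}ᶜ) := by
    rw [isOpen_iff_mem_nhds]
    rintro _ ⟨y, hy, rfl⟩
    rw [← h.map_nhds ht hy]
    exact image_mem_map (isOpen_compl_singleton.mem_nhds hy)
  obtain ⟨a, b, ha, hb, hab⟩ := h.exists_bounds ht.2
  have hcl : closure (Q t '' {0}ᶜ) ∩ {0}ᶜ ⊆ Q t '' {0}ᶜ := by
    rintro w ⟨hw, hw0⟩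
    have hw0 : 0 < ‖w‖ := norm_pos_iff.mpr hw0
    obtain ⟨u, hu, hlim⟩ := mem_closure_iff_seq_limit.mp hw
    choose y hy hyu using hu
    set K : Set E := {y | ‖w‖ / (2 * b) ≤ ‖y‖} ∩ Metric.closedBall 0 (2 * ‖w‖ / a) with hK
    have hKc : IsCompact K :=
      (isCompact_closedBall _ _).inter_left (isClosed_le continuous_const continuous_norm)
    have hev : ∀ᶠ k in atTop, y k ∈ K := by
      have h1 := hlim.norm.eventually_lt_const (show ‖w‖ < 2 * ‖w‖ by linarith)
      have h2 := hlim.norm.eventually_const_lt (show ‖w‖ / 2 < ‖w‖ by linarith)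
      filter_upwards [h1, h2] with k h1 h2
      have h3 := hab t ⟨ht.1, le_rfl⟩ (y k) (hy k)
      rw [hyu k] at h3
      refine ⟨?_, ?_⟩
      · change ‖w‖ / (2 * b) ≤ ‖y k‖
        rw [div_le_iff₀ (by positivity)]
        linarith [h3.2]
      · rw [mem_closedBall_zero_iff, le_div_iff₀ ha]
        linarith [h3.1]
    obtain ⟨y₀, hy₀, s, hs, hys⟩ := hKc.tendsto_subseq' hev.frequently
    have hy₀' : y₀ ≠ 0 := by
      rintro rfl
      have : ‖w‖ / (2 * b) ≤ ‖(0 : E)‖ := hy₀.1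
      rw [norm_zero] at this
      have h2 : 0 < ‖w‖ / (2 * b) := by positivity
      linarith
    refine ⟨y₀, hy₀', ?_⟩
    have h1 : Tendsto (fun k => Q t (y (s k))) atTop (𝓝 (Q t y₀)) :=
      (h.contDiffAt ht hy₀').continuousAt.tendsto.comp hys
    simp only [hyu] at h1
    exact tendsto_nhds_unique h1 (hlim.comp hs.tendsto_atTop)
  obtain ⟨y, hy, hyx⟩ := hconn.subset_of_closure_inter_subset hopen
    ⟨Q t x, h.ne_zero t ht x hx, mem_image_of_mem _ hx⟩ hcl hx
  exact ⟨y, hy, hyx⟩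

/-- A map whose derivative stays close to a fixed isomorphism on a ball is injective there.
Uniformity in t prevents pairs of distinct points with equal images from merging in a limit. -/
theorem locally_injective {t₀ : ℝ} (ht₀ : t₀ ∈ Ico 0 τ) {y₀ : E} (hy₀ : y₀ ≠ 0) :
    ∃ δ > 0, ∀ t ∈ Ico 0 τ, |t - t₀| < δ → ∀ y₁ ∈ Metric.ball y₀ δ, ∀ y₂ ∈ Metric.ball y₀ δ,
      Q t y₁ = Q t y₂ → y₁ = y₂ := by
  obtain ⟨e, he⟩ := exists_equiv_of_injective (h.inj_deriv t₀ ht₀ y₀ hy₀)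
  set c := ‖(e.symm : E →L[ℝ] E)‖ + 1 with hc
  have hc0 : 0 < c := by positivity
  have hanti : ∀ v, ‖v‖ ≤ c * ‖e v‖ := fun v => by
    have h1 := (e.symm : E →L[ℝ] E).le_opNorm (e v)
    simp only [ContinuousLinearEquiv.coe_coe, ContinuousLinearEquiv.symm_apply_apply] at h1
    refine h1.trans ?_
    gcongr
    rw [hc]; linarith
  have hcont := (contDiffOn_fderiv_snd (uniqueDiffOn_Ico 0 τ) isOpen_compl_singleton
    h.smooth).continuousOn (t₀, y₀) ⟨ht₀, hy₀⟩
  have h1 := Metric.continuousWithinAt_iff.mp hcont (1 / (2 * c)) (by positivity)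
  obtain ⟨δ, hδ, h1⟩ := h1
  refine ⟨min δ ‖y₀‖, lt_min hδ (norm_pos_iff.mpr hy₀), fun t ht htt y₁ hy₁ y₂ hy₂ heq => ?_⟩
  have hne : ∀ y ∈ Metric.ball y₀ (min δ ‖y₀‖), y ≠ 0 := by
    rintro y hy rfl
    rw [Metric.mem_ball, dist_comm, dist_zero_right] at hy
    exact (hy.trans_le (min_le_right _ _)).false
  have hder : ∀ y ∈ Metric.ball y₀ (min δ ‖y₀‖), HasFDerivWithinAt (Q t) (fderiv ℝ (Q t) y)
      (Metric.ball y₀ (min δ ‖y₀‖)) y := fun y hy =>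
    ((h.contDiffAt ht (hne y hy)).differentiableAt (by simp)).hasFDerivAt.hasFDerivWithinAt
  have hbd : ∀ y ∈ Metric.ball y₀ (min δ ‖y₀‖), ‖fderiv ℝ (Q t) y - e‖ ≤ 1 / (2 * c) := by
    intro y hy
    have h2 := @h1 (t, y) ⟨ht, hne y hy⟩ (by
      rw [Prod.dist_eq]
      exact max_lt (by rw [Real.dist_eq]; exact htt.trans_le (min_le_left _ _))
        ((Metric.mem_ball.mp hy).trans_le (min_le_left _ _)))
    rw [dist_eq_norm] at h2
    rw [he]
    exact h2.le
  have h3 := (convex_ball y₀ (min δ ‖y₀‖)).norm_image_sub_le_of_norm_hasFDerivWithin_le' hder hbd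
    hy₁ hy₂
  rw [heq, sub_self, zero_sub, norm_neg] at h3
  have h4 := hanti (y₂ - y₁)
  have h5 : ‖y₂ - y₁‖ ≤ 1 / 2 * ‖y₂ - y₁‖ := by
    refine h4.trans ?_
    calc c * ‖e (y₂ - y₁)‖ ≤ c * (1 / (2 * c) * ‖y₂ - y₁‖) := by gcongr; exact h3
      _ = 1 / 2 * ‖y₂ - y₁‖ := by field_simp
  have h6 : ‖y₂ - y₁‖ = 0 := le_antisymm (by linarith) (norm_nonneg _)
  exact (sub_eq_zero.mp (norm_eq_zero.mp h6)).symm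

theorem smooth_graph : ContDiffOn ℝ ∞ (fun p : ℝ × E => (p.1, Q p.1 p.2)) (Ico 0 τ ×ˢ {0}ᶜ) :=
  contDiff_fst.contDiffOn.prodMk h.smooth

/-- The derivative is block triangular with the identity in the time slot, so injectivity of the
space derivative suffices. -/
theorem exists_equiv_graph {p : ℝ × E} (hp : p ∈ Ico 0 τ ×ˢ ({0}ᶜ : Set E)) :
    ∃ e : (ℝ × E) ≃L[ℝ] (ℝ × E), (e : (ℝ × E) →L[ℝ] (ℝ × E)) =
      fderivWithin ℝ (fun p : ℝ × E => (p.1, Q p.1 p.2)) (Ico 0 τ ×ˢ {0}ᶜ) p := by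
  refine exists_equiv_of_injective ?_
  have hu : UniqueDiffWithinAt ℝ (Ico 0 τ ×ˢ ({0}ᶜ : Set E)) p :=
    ((uniqueDiffOn_Ico 0 τ).prod isOpen_compl_singleton.uniqueDiffOn) p hp
  have h1 : HasFDerivWithinAt (uncurry Q) (fderivWithin ℝ (uncurry Q) (Ico 0 τ ×ˢ {0}ᶜ) p)
      (Ico 0 τ ×ˢ {0}ᶜ) p := (h.smooth.differentiableOn (by simp) p hp).hasFDerivWithinAt
  have h2 : HasFDerivWithinAt (fun p : ℝ × E => (p.1, Q p.1 p.2)) _ (Ico 0 τ ×ˢ {0}ᶜ) p :=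
    hasFDerivWithinAt_fst.prodMk h1
  rintro ⟨s, v⟩ hv
  rw [h2.fderivWithin hu] at hv
  obtain ⟨hs, hv⟩ := Prod.mk.inj hv
  have hs : s = 0 := hs
  subst hs
  have h3 := (hasFDerivAt_snd_of_contDiffOn isOpen_compl_singleton h.smooth hp.1 hp.2).fderiv
  have h4 := h.inj_deriv p.1 hp.1 p.2 hp.2 v (by rw [h3]; exact hv)
  rw [h4]
  rfl

/-- Continuity in time: double points normalized by homogeneity form a compact set, so there is a
first time at which they occur. It is positive, and the inverse function theorem continues the
double point to slightly earlier times, a contradiction. -/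
theorem injective {t : ℝ} (ht : t ∈ Ico 0 τ) {x y : E} (hx : x ≠ 0) (hy : y ≠ 0)
    (hxy : Q t x = Q t y) : x = y := by
  by_contra hne
  obtain ⟨a, b, ha, hb, hab⟩ := h.exists_bounds ht.2
  set S : Set (ℝ × E × E) := Icc 0 t ×ˢ (Metric.sphere (0 : E) 1 ×ˢ
    ({y | a / b ≤ ‖y‖} ∩ Metric.closedBall 0 (b / a))) with hS
  have hSc : IsCompact S := isCompact_Icc.prod ((isCompact_sphere 0 1).prod
    ((isCompact_closedBall _ _).inter_left (isClosed_le continuous_const continuous_norm)))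
  have hI : ∀ s ∈ Icc 0 t, s ∈ Ico 0 τ := fun s hs => ⟨hs.1, hs.2.trans_lt ht.2⟩
  have hne1 : ∀ p ∈ S, p.2.1 ≠ 0 := by
    intro p hp h0
    have := hp.2.1
    rw [h0] at this
    simp at this
  have hne2 : ∀ p ∈ S, p.2.2 ≠ 0 := by
    intro p hp h0
    have : a / b ≤ ‖p.2.2‖ := hp.2.2.1
    rw [h0, norm_zero] at this
    have h2 : 0 < a / b := by positivity
    linarith
  have hmemS : ∀ s ∈ Icc 0 t, ∀ y₁ y₂ : E, ‖y₁‖ = 1 → y₂ ≠ 0 → Q s y₁ = Q s y₂ →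
      (s, y₁, y₂) ∈ S := by
    intro s hs y₁ y₂ h1 h2 heq
    have h3 := hab s hs y₁ (by rintro rfl; simp at h1)
    have h4 := hab s hs y₂ h2
    rw [h1, heq] at h3
    refine ⟨hs, by simpa using h1, ?_, ?_⟩
    · change a / b ≤ ‖y₂‖
      rw [div_le_iff₀ hb]
      linarith [h3.1, h4.2]
    · rw [mem_closedBall_zero_iff, le_div_iff₀ ha]
      linarith [h3.2, h4.1]
  set K : Set (ℝ × E × E) := {p | p ∈ S ∧ Q p.1 p.2.1 = Q p.1 p.2.2 ∧ p.2.1 ≠ p.2.2} with hK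
  have hKc : IsCompact K := by
    refine hSc.of_isClosed_subset (IsSeqClosed.isClosed ?_) fun p hp => hp.1
    intro u p hu hlim
    have hpS : p ∈ S := hSc.isClosed.mem_of_tendsto hlim (Eventually.of_forall fun k => (hu k).1)
    have h1 : Tendsto (fun k => (u k).1) atTop (𝓝 p.1) := (continuous_fst.tendsto p).comp hlim
    have h2 : Tendsto (fun k => (u k).2.1) atTop (𝓝 p.2.1) :=
      ((continuous_fst.comp continuous_snd).tendsto p).comp hlim
    have h3 : Tendsto (fun k => (u k).2.2) atTop (𝓝 p.2.2) :=
      ((continuous_snd.comp continuous_snd).tendsto p).comp hlim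
    have h4 : Tendsto (fun k => Q (u k).1 (u k).2.1) atTop (𝓝 (Q p.1 p.2.1)) :=
      (h.smooth.continuousOn (p.1, p.2.1) ⟨hI _ hpS.1, hne1 p hpS⟩).tendsto.comp
        (tendsto_nhdsWithin_iff.mpr ⟨h1.prodMk_nhds h2, Eventually.of_forall fun k =>
          ⟨hI _ (hu k).1.1, hne1 _ (hu k).1⟩⟩)
    have h5 : Tendsto (fun k => Q (u k).1 (u k).2.2) atTop (𝓝 (Q p.1 p.2.2)) :=
      (h.smooth.continuousOn (p.1, p.2.2) ⟨hI _ hpS.1, hne2 p hpS⟩).tendsto.comp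
        (tendsto_nhdsWithin_iff.mpr ⟨h1.prodMk_nhds h3, Eventually.of_forall fun k =>
          ⟨hI _ (hu k).1.1, hne2 _ (hu k).1⟩⟩)
    refine ⟨hpS, tendsto_nhds_unique h4 (h5.congr fun k => (hu k).2.1.symm), fun heq => ?_⟩
    obtain ⟨δ, hδ, hloc⟩ := h.locally_injective (hI _ hpS.1) (hne1 p hpS)
    rw [← heq] at h3
    have e1 := Metric.tendsto_nhds.mp h1 δ hδ
    have e2 := Metric.tendsto_nhds.mp h2 δ hδ
    have e3 := Metric.tendsto_nhds.mp h3 δ hδ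
    obtain ⟨k, e1, e2, e3⟩ := (e1.and (e2.and e3)).exists
    exact (hu k).2.2 (hloc _ (hI _ (hu k).1.1) (by rwa [Real.dist_eq] at e1) _ e2 _ e3 (hu k).2.1)
  have hBc : IsCompact (Prod.fst '' K) := hKc.image continuous_fst
  have hBne : (Prod.fst '' K).Nonempty := by
    have hr : 0 < ‖x‖ := norm_pos_iff.mpr hx
    have hr' : 0 < ‖x‖⁻¹ := inv_pos.mpr hr
    have heq : Q t (‖x‖⁻¹ • x) = Q t (‖x‖⁻¹ • y) := by
      rw [h.homog t ht _ hr' x hx, h.homog t ht _ hr' y hy, hxy]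
    refine ⟨t, (t, ‖x‖⁻¹ • x, ‖x‖⁻¹ • y), ⟨hmemS t ⟨ht.1, le_rfl⟩ _ _ ?_
      (smul_ne_zero hr'.ne' hy) heq, heq, fun he => hne (smul_right_injective E hr'.ne' he)⟩, rfl⟩
    rw [norm_smul, norm_inv, norm_norm, inv_mul_cancel₀ hr.ne']
  obtain ⟨⟨s, y₁, y₂⟩, hp, hs⟩ := hBc.sInf_mem hBne
  obtain ⟨hpS, heq, hdiff⟩ := hp
  have hs' : s = sInf (Prod.fst '' K) := hs
  have hsI : s ∈ Ico 0 τ := hI s hpS.1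
  have hy₁ : y₁ ≠ 0 := hne1 _ hpS
  have hy₂ : y₂ ≠ 0 := hne2 _ hpS
  have heq : Q s y₁ = Q s y₂ := heq
  have hdiff : y₁ ≠ y₂ := hdiff
  have hs0 : 0 < s := by
    refine lt_of_le_of_ne hsI.1 fun h0 => hdiff ?_
    rw [← h0] at heq
    exact h.inj_zero _ _ hy₁ hy₂ heq
  -- At the first bad time the space-time map is open near (s, y₂), so it reaches Q r y₁ for r
  -- slightly below s from a point that is still different from y₁.
  have hnhds : Ico 0 τ ×ˢ ({0}ᶜ : Set E) ∈ 𝓝 (s, y₂) :=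
    prod_mem_nhds (Ico_mem_nhds hs0 hsI.2) (isOpen_compl_singleton.mem_nhds hy₂)
  obtain ⟨e, he⟩ := h.exists_equiv_graph (p := (s, y₂)) ⟨hsI, hy₂⟩
  have hstrict := (h.smooth_graph.contDiffAt hnhds).hasStrictFDerivAt (by simp)
  rw [← fderivWithin_of_mem_nhds hnhds, ← he] at hstrict
  have hmap := hstrict.map_nhds_eq_of_equiv
  have hU : {p : ℝ × E | p.2 ≠ 0 ∧ p.2 ≠ y₁} ∈ 𝓝 (s, y₂) :=
    (continuous_snd.continuousAt.eventually_ne hy₂).and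
      (continuous_snd.continuousAt.eventually_ne hdiff.symm)
  have himg := image_mem_map (m := fun p : ℝ × E => (p.1, Q p.1 p.2)) hU
  rw [hmap] at himg
  have hc1 : Tendsto (fun r : ℝ => (r, Q r y₁)) (𝓝 s) (𝓝 (s, Q s y₂)) := by
    rw [← heq]
    have hnh : Ico 0 τ ×ˢ ({0}ᶜ : Set E) ∈ 𝓝 (s, y₁) :=
      prod_mem_nhds (Ico_mem_nhds hs0 hsI.2) (isOpen_compl_singleton.mem_nhds hy₁)
    have h1 : ContinuousAt (uncurry Q) (s, y₁) := (h.smooth.contDiffAt hnh).continuousAt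
    have h2 : Tendsto (fun r : ℝ => (r, y₁)) (𝓝 s) (𝓝 (s, y₁)) :=
      tendsto_id.prodMk_nhds tendsto_const_nhds
    exact tendsto_id.prodMk_nhds (h1.tendsto.comp h2)
  have hev : ∀ᶠ r in 𝓝[<] s, (r, Q r y₁) ∈ (fun p : ℝ × E => (p.1, Q p.1 p.2)) ''
      {p : ℝ × E | p.2 ≠ 0 ∧ p.2 ≠ y₁} := nhdsWithin_le_nhds (hc1 himg)
  have hev' : ∀ᶠ r in 𝓝[<] s, r < s := self_mem_nhdsWithin
  have hev'' : ∀ᶠ r in 𝓝[<] s, 0 < r := nhdsWithin_le_nhds (eventually_gt_nhds hs0)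
  obtain ⟨r, hr, hrs, hr0⟩ := (hev.and (hev'.and hev'')).exists
  obtain ⟨⟨r', y'⟩, ⟨hy'0, hy'⟩, hry⟩ := hr
  obtain ⟨h1, h2⟩ := Prod.mk.inj hry
  have h1 : r' = r := h1
  subst h1
  have hrs : r' < s := hrs
  have hrI : r' ∈ Icc 0 t := ⟨hr0.le, hrs.le.trans hpS.1.2⟩
  have hmem : r' ∈ Prod.fst '' K :=
    ⟨(r', y₁, y'), ⟨hmemS r' hrI y₁ y' (by simpa using hpS.2.1) hy'0 h2.symm, h2.symm,
      fun he => hy' he.symm⟩, rfl⟩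
  have := csInf_le hBc.bddBelow hmem
  linarith

/-- The inverse family is smooth. -/
theorem exists_inverse (hdim : 1 < Module.rank ℝ E) :
    ∃ P : ℝ → E → E, ContDiffOn ℝ ∞ (uncurry P) (Ico 0 τ ×ˢ {0}ᶜ) ∧
      (∀ t ∈ Ico 0 τ, ∀ x, x ≠ 0 → P t x ≠ 0 ∧ Q t (P t x) = x) ∧
      ∀ t ∈ Ico 0 τ, ∀ y, y ≠ 0 → P t (Q t y) = y := by
  have hex : ∀ t x, ∃ y, t ∈ Ico 0 τ → x ≠ 0 → y ≠ 0 ∧ Q t y = x := by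
    intro t x
    by_cases ht : t ∈ Ico 0 τ
    · by_cases hx : x ≠ 0
      · obtain ⟨y, hy⟩ := h.surjective hdim ht hx
        exact ⟨y, fun _ _ => hy⟩
      · exact ⟨0, fun _ h0 => absurd h0 hx⟩
    · exact ⟨0, fun h0 => absurd h0 ht⟩
  choose P hP using hex
  have hP' : ∀ t ∈ Ico 0 τ, ∀ x, x ≠ 0 → P t x ≠ 0 ∧ Q t (P t x) = x := fun t ht x hx =>
    hP t x ht hx
  have hcont : ContinuousOn (uncurry P) (Ico 0 τ ×ˢ {0}ᶜ) := by
    rintro ⟨t₀, x₀⟩ ⟨ht₀, hx₀⟩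
    have hx₀ : x₀ ≠ 0 := hx₀
    have hn : 0 < ‖x₀‖ := norm_pos_iff.mpr hx₀
    obtain ⟨t₁, ht₁, ht₁τ⟩ := exists_between ht₀.2
    obtain ⟨a, b, ha, hb, hab⟩ := h.exists_bounds ht₁τ
    have hKc : IsCompact ({y : E | ‖x₀‖ / (2 * b) ≤ ‖y‖} ∩ Metric.closedBall 0 (2 * ‖x₀‖ / a)) :=
      (isCompact_closedBall _ _).inter_left (isClosed_le continuous_const continuous_norm)
    have hbase : ∀ᶠ p : ℝ × E in 𝓝[Ico 0 τ ×ˢ {0}ᶜ] (t₀, x₀), p ∈ Ico 0 τ ×ˢ ({0}ᶜ : Set E) :=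
      self_mem_nhdsWithin
    have hmem : ∀ᶠ p : ℝ × E in 𝓝[Ico 0 τ ×ˢ {0}ᶜ] (t₀, x₀), uncurry P p ∈
        {y : E | ‖x₀‖ / (2 * b) ≤ ‖y‖} ∩ Metric.closedBall 0 (2 * ‖x₀‖ / a) := by
      have e1 : ∀ᶠ p : ℝ × E in 𝓝 (t₀, x₀), p.1 < t₁ :=
        (continuous_fst.tendsto (t₀, x₀)).eventually_lt_const ht₁
      have e2 : ∀ᶠ p : ℝ × E in 𝓝 (t₀, x₀), ‖p.2‖ < 2 * ‖x₀‖ :=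
        (continuous_snd.norm.tendsto (t₀, x₀)).eventually_lt_const (by change ‖x₀‖ < _; linarith)
      have e3 : ∀ᶠ p : ℝ × E in 𝓝 (t₀, x₀), ‖x₀‖ / 2 < ‖p.2‖ :=
        (continuous_snd.norm.tendsto (t₀, x₀)).eventually_const_lt (by change _ < ‖x₀‖; linarith)
      filter_upwards [hbase, nhdsWithin_le_nhds e1, nhdsWithin_le_nhds e2, nhdsWithin_le_nhds e3]
        with p hp e1 e2 e3
      obtain ⟨h1, h2⟩ := hP' p.1 hp.1 p.2 hp.2
      have h3 := hab p.1 ⟨hp.1.1, e1.le⟩ _ h1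
      rw [h2] at h3
      refine ⟨?_, ?_⟩
      · change ‖x₀‖ / (2 * b) ≤ ‖P p.1 p.2‖
        rw [div_le_iff₀ (by positivity)]
        linarith [h3.2]
      · rw [mem_closedBall_zero_iff, le_div_iff₀ ha]
        change ‖P p.1 p.2‖ * a ≤ _
        linarith [h3.1]
    -- The inverse values stay in a compact annulus near the base point, and every cluster value is
    -- mapped by Q t₀ to x₀. Injectivity leaves only one candidate.
    refine hKc.tendsto_nhds_of_unique_mapClusterPt hmem fun y hy hcl => ?_
    have hy0 : y ≠ 0 := by
      rintro rfl
      have : ‖x₀‖ / (2 * b) ≤ ‖(0 : E)‖ := hy.1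
      rw [norm_zero] at this
      have h2 : 0 < ‖x₀‖ / (2 * b) := by positivity
      linarith
    obtain ⟨U, hU, hUy⟩ := mapClusterPt_iff_ultrafilter.mp hcl
    have hbaseU := hU hbase
    have hU0 : Tendsto id (U : Filter (ℝ × E)) (𝓝 (t₀, x₀)) := hU.trans nhdsWithin_le_nhds
    have hU1 : Tendsto (fun p : ℝ × E => p.1) U (𝓝 t₀) := (continuous_fst.tendsto _).comp hU0
    have hU2 : Tendsto (fun p : ℝ × E => p.2) U (𝓝 x₀) := (continuous_snd.tendsto _).comp hU0
    have h1 : Tendsto (fun p : ℝ × E => Q p.1 (P p.1 p.2)) U (𝓝 (Q t₀ y)) :=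
      (h.smooth.continuousOn (t₀, y) ⟨ht₀, hy0⟩).tendsto.comp
        (tendsto_nhdsWithin_iff.mpr ⟨hU1.prodMk_nhds hUy,
          mem_of_superset hbaseU fun p hp => ⟨hp.1, (hP' p.1 hp.1 p.2 hp.2).1⟩⟩)
    have h2 : Q t₀ y = x₀ := tendsto_nhds_unique h1 (hU2.congr'
      (mem_of_superset hbaseU fun p hp => ((hP' p.1 hp.1 p.2 hp.2).2).symm))
    obtain ⟨h3, h4⟩ := hP' t₀ ht₀ x₀ hx₀
    exact h.injective ht₀ hy0 h3 (h2.trans h4.symm)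
  -- The inverse is taken in space-time, which gives joint smoothness up to the initial time.
  have hsm := contDiffOn_of_left_inverse (f := fun p : ℝ × E => (p.1, Q p.1 p.2))
    (g := fun p : ℝ × E => (p.1, P p.1 p.2)) (s := Ico 0 τ ×ˢ {0}ᶜ)
    ((uniqueDiffOn_Ico 0 τ).prod isOpen_compl_singleton.uniqueDiffOn) h.smooth_graph
    (fun p hp => h.exists_equiv_graph hp) (continuous_fst.continuousOn.prodMk hcont)
    (fun p hp => ⟨hp.1, (hP' p.1 hp.1 p.2 hp.2).1⟩)
    (fun p hp => Prod.ext rfl (hP' p.1 hp.1 p.2 hp.2).2)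
  refine ⟨P, contDiff_snd.comp_contDiffOn hsm, hP', fun t ht y hy => ?_⟩
  obtain ⟨h1, h2⟩ := hP' t ht _ (h.ne_zero t ht y hy)
  exact h.injective ht h1 hy h2

end IsConeIsotopy

end ConeIsotopy

end CHFlow

namespace CHFlow

open scoped ContDiff Topology RealInnerProductSpace
open Set Filter Function

/-! ### Homogeneity of the graph operator -/

section GraphHomogeneity

variable {E ι : Type*} [NormedAddCommGroup E] [InnerProductSpace ℝ E] [Fintype ι]

theorem graphV_smul (J : E →L[ℝ] E) (ρ : ℝ) (p x : E) {c : ℝ} (hc : 0 < c) :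
    graphV J ρ (c⁻¹ • p) (c • x) = graphV J ρ p x := by
  simp only [graphV, norm_smul, map_smul, inner_smul_left, inner_smul_right, conj_trivial,
    Real.norm_of_nonneg hc.le, Real.norm_of_nonneg (inv_nonneg.mpr hc.le)]
  field_simp

theorem graphQ_smul (J : E →L[ℝ] E) (ρ : ℝ) (p x : E) {c : ℝ} (hc : 0 < c) :
    graphQ J ρ (c⁻¹ • p) (c • x) = c • graphQ J ρ p x := by
  simp only [graphQ, norm_smul, map_smul, inner_smul_left, inner_smul_right, conj_trivial,
    Real.norm_of_nonneg hc.le, smul_sub, smul_smul]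
  congr 2 <;> field_simp

theorem graphG_smul (J : E →L[ℝ] E) (b : OrthonormalBasis ι ℝ E) (ρ : ℝ) (p : E) (A : E →L[ℝ] E)
    (x : E) {c : ℝ} (hc : 0 < c) :
    graphG J b ρ (c⁻¹ • p) ((c ^ 2)⁻¹ • A) (c • x) = graphG J b ρ p A x := by
  rw [graphG, graphG, graphV_smul _ _ _ _ hc, graphQ_smul _ _ _ _ hc, basisTrace_smul]
  simp only [norm_smul, map_smul, inner_smul_left, inner_smul_right, conj_trivial, smul_apply,
    Real.norm_of_nonneg hc.le]
  field_simp

end GraphHomogeneity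

/-! ### From the flow to the graph equation -/

section Flow

variable {n : ℕ}

theorem fderiv_ext_smul {F : USphere n → CSpace n} (hF : ContDiffOn ℝ ∞ (ext F) {0}ᶜ) {c : ℝ}
    (hc : 0 < c) {x : CSpace n} (hx : x ≠ 0) (v : CSpace n) :
    c • fderiv ℝ (ext F) (c • x) v = fderiv ℝ (ext F) x v := by
  have hcx : c • x ≠ 0 := smul_ne_zero hc.ne' hx
  have hd : ∀ y : CSpace n, y ≠ 0 → HasFDerivAt (ext F) (fderiv ℝ (ext F) y) y := fun y hy =>
    ((hF.contDiffAt (isOpen_compl_singleton.mem_nhds hy)).differentiableAt (by simp)).hasFDerivAt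
  have h1 : HasFDerivAt (fun y => ext F (c • y)) ((fderiv ℝ (ext F) (c • x)).comp
      (c • ContinuousLinearMap.id ℝ (CSpace n))) x :=
    (hd _ hcx).comp x ((hasFDerivAt_id x).const_smul c)
  have h2 : HasFDerivAt (fun y => ext F (c • y)) (fderiv ℝ (ext F) x) x :=
    (hd x hx).congr_of_eventuallyEq ((eventually_ne_nhds hx).mono fun y hy => ext_smul F hc hy)
  have h3 := congrArg (fun T => T v) (h1.unique h2)
  simpa using h3

theorem fderiv_ext_self {F : USphere n → CSpace n} (hF : ContDiffOn ℝ ∞ (ext F) {0}ᶜ)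
    {x : CSpace n} (hx : x ≠ 0) : fderiv ℝ (ext F) x x = 0 := by
  have hd : HasFDerivAt (ext F) (fderiv ℝ (ext F) x) ((1 : ℝ) • x) := by
    rw [one_smul]
    exact ((hF.contDiffAt
      (isOpen_compl_singleton.mem_nhds hx)).differentiableAt (by simp)).hasFDerivAt
  have hc : HasDerivAt (fun s : ℝ => s • x) x 1 := by
    simpa using (hasDerivAt_id (1 : ℝ)).smul_const x
  have h1 : HasDerivAt (fun s : ℝ => ext F (s • x)) (fderiv ℝ (ext F) x x) 1 :=
    HasFDerivAt.comp_hasDerivAt (f := fun s : ℝ => s • x) (1 : ℝ) hd hc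
  have h2 : HasDerivAt (fun s : ℝ => ext F (s • x)) 0 1 :=
    (hasDerivAt_const (1 : ℝ) (ext F x)).congr_of_eventuallyEq
      ((eventually_gt_nhds one_pos).mono fun s hs => ext_smul F hs hx)
  exact h1.unique h2

theorem norm_smul_toSphere {x : CSpace n} (hx : x ≠ 0) : ‖x‖ • (toSphere x hx : CSpace n) = x := by
  change ‖x‖ • (‖x‖⁻¹ : ℝ) • x = x
  rw [smul_inv_smul₀ (norm_ne_zero_iff.mpr hx)]

/-- A solution of inverse mean curvature flow on `[0, τ)` that is mean convex and transversal to
the radial direction. -/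
structure IsTransversalFlow (ρ₀ : USphere n → ℝ) (τ : ℝ) (F ν : ℝ → USphere n → CSpace n) :
    Prop where
  smooth : ContDiffOn ℝ ∞ (uncurry fun t y => ext (F t) y) (Ico 0 τ ×ˢ {0}ᶜ)
  immersion : ∀ t ∈ Ico 0 τ, IsImmersive (F t)
  initial : F 0 = radialGraph ρ₀
  initial_pos : ∀ z, 0 < ρ₀ z
  ne_zero : ∀ t ∈ Ico 0 τ, ∀ z, F t z ≠ 0
  outward : ∀ t ∈ Ico 0 τ, ∀ z, IsOutwardNormal (F t) z (ν t z)
  curvature_pos : ∀ t ∈ Ico 0 τ, ∀ z, 0 < meanCurvature (F t) (ν t z) z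
  flow : ∀ t ∈ Ico 0 τ, ∀ z, HasDerivWithinAt (fun s => F s z)
    ((meanCurvature (F t) (ν t z) z)⁻¹ • ν t z) (Ico 0 τ) t

namespace IsTransversalFlow

variable {ρ₀ : USphere n → ℝ} {τ : ℝ} {F ν : ℝ → USphere n → CSpace n}
  (h : IsTransversalFlow ρ₀ τ F ν)
include h

/-- Transversality says that the position vector is not tangent to the hypersurface. Radial and
tangential derivatives of the degree-one extension are therefore independent. At time zero the
extension is x ↦ ρ₀(x/‖x‖) x, which preserves rays. -/
theorem isConeIsotopy : IsConeIsotopy τ fun t y => ‖y‖ • ext (F t) y where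
  smooth := by
    have h1 : ContDiffOn ℝ ∞ (fun p : ℝ × CSpace n => ‖p.2‖) (Ico 0 τ ×ˢ {0}ᶜ) :=
      contDiff_snd.contDiffOn.norm ℝ fun p hp => hp.2
    exact h1.smul h.smooth
  homog t ht c hc x hx := by
    rw [ext_smul _ hc hx, norm_smul, Real.norm_of_nonneg hc.le, smul_smul]
  ne_zero t ht x hx := by
    rw [ext_of_ne _ hx]
    exact smul_ne_zero (norm_ne_zero_iff.mpr hx) (h.ne_zero t ht _)
  inj_deriv t ht x hx v hv := by
    have hF : ContDiffOn ℝ ∞ (ext (F t)) {0}ᶜ := contDiffOn_slice h.smooth ht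
    have hr : 0 < ‖x‖ := norm_pos_iff.mpr hx
    set z := toSphere x hx with hz
    have hxz : ‖x‖ • (z : CSpace n) = x := norm_smul_toSphere hx
    have h1 : HasFDerivAt (fun y => ‖y‖ • ext (F t) y) _ x :=
      (hasFDerivAt_norm_of_ne hx).fun_smul ((hF.contDiffAt
        (isOpen_compl_singleton.mem_nhds hx)).differentiableAt (by simp)).hasFDerivAt
    rw [h1.fderiv] at hv
    have h2 : ‖x‖ • fderiv ℝ (ext (F t)) x v = pushforward (F t) z v := by
      rw [pushforward, ← fderiv_ext_smul hF hr (coe_sphere_ne_zero z), hxz]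
    have h3 : ⟪x, v⟫ = ‖x‖ * ⟪(z : CSpace n), v⟫ := by
      rw [← real_inner_smul_left, hxz]
    simp only [add_apply, smul_apply, ContinuousLinearMap.smulRight_apply, innerSL_apply_apply,
      smul_eq_mul, h2, h3, inv_mul_cancel_left₀ hr.ne', ext_of_ne _ hx, ← hz] at hv
    set s := ⟪(z : CSpace n), v⟫ with hs
    -- Split v into its tangential part X and its radial part s. Pairing the vanishing derivative
    -- with the normal kills the tangential part and gives s = 0; the immersion property then gives
    -- X = 0.
    set X := v - s • (z : CSpace n) with hX
    have hXt : X ∈ sphereTangent z := by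
      rw [mem_sphereTangent, hX, inner_sub_right, real_inner_smul_right,
        real_inner_self_eq_norm_sq, norm_coe_sphere, ← hs]
      ring
    have hpX : pushforward (F t) z X = pushforward (F t) z v := by
      rw [hX, pushforward, map_sub, map_smul, fderiv_ext_self hF (coe_sphere_ne_zero z), smul_zero,
        sub_zero]
      rfl
    obtain ⟨⟨_, hN⟩, hNx⟩ := h.outward t ht z
    have h4 := hN X hXt
    rw [hpX] at h4
    have h0 := h.ne_zero t ht z
    rw [hypMetric_eq h0] at h4 hNx
    have h5 : s * ambientMetric (hopfJ n) (F t z) (ν t z) (F t z) = 0 := by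
      have h6 : ambientForm (hopfJ n) (F t z) (ν t z) (pushforward (F t) z v + s • F t z) = 0 := by
        rw [hv, map_zero]
      rw [map_add, map_smul, ambientForm_apply, h4, zero_add, smul_eq_mul] at h6
      exact h6
    have hs0 : s = 0 := (mul_eq_zero.mp h5).resolve_right hNx.ne'
    rw [hs0, zero_smul, add_zero, ← hpX] at hv
    have hX0 := h.immersion t ht z X hXt hv
    rw [hX, hs0, zero_smul, sub_zero] at hX0
    exact hX0
  inj_zero x y hx hy hxy := by
    have hF0 : ∀ x : CSpace n, ∀ hx : x ≠ 0, ‖x‖ • ext (F 0) x = ρ₀ (toSphere x hx) • x := by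
      intro x hx
      rw [ext_of_ne _ hx, h.initial, radialGraph, smul_comm, norm_smul_toSphere hx]
    simp only [hF0 x hx, hF0 y hy] at hxy
    have hc : 0 < ρ₀ (toSphere y hy) / ρ₀ (toSphere x hx) :=
      div_pos (h.initial_pos _) (h.initial_pos _)
    have hxc : x = (ρ₀ (toSphere y hy) / ρ₀ (toSphere x hx)) • y := by
      rw [div_eq_inv_mul, mul_smul, ← hxy, inv_smul_smul₀ (h.initial_pos _).ne']
    have hs : toSphere x hx = toSphere y hy := by
      rw [← toSphere_smul hc hy (smul_ne_zero hc.ne' hy)]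
      congr 1
    rw [hs] at hxy
    exact smul_right_injective _ (h.initial_pos _).ne' hxy

/-- The hypersurfaces are graphs whose radial functions solve the graph equation. -/
theorem exists_graphSolution (hn : 1 ≤ n) {ι : Type*} [Fintype ι]
    (b : OrthonormalBasis ι ℝ (CSpace n)) :
    ∃ R : ℝ → CSpace n → ℝ, IsGraphSolution (hopfJ n) b τ R ∧
      (∀ t ∈ Ico 0 τ, ∀ z, R t (F t z) = ‖F t z‖) ∧
      (∀ t ∈ Ico 0 τ, ∀ x, x ≠ 0 → ∃ c : ℝ, 0 < c ∧ ∃ z, x = c • F t z) ∧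
      ∀ t ∈ Ico 0 τ, ∀ z, hypMetric (F t z) (ν t z) (F t z) = ‖F t z‖ /
        √(graphV (hopfJ n) ‖F t z‖ (gradient (fun y => potential (R t y)) (F t z)) (F t z)) := by
  have hJ := isOrthComplex_hopfJ n
  have hdim : 1 < Module.rank ℝ (CSpace n) := by
    rw [← Module.finrank_eq_rank, finrank_real_CSpace]
    have : 1 < 2 * n := by omega
    exact_mod_cast this
  obtain ⟨P, hPs, hP, hPQ⟩ := h.isConeIsotopy.exists_inverse hdim
  -- As x = ‖P t x‖ F t (P t x / ‖P t x‖), this quotient is the distance from the origin at which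
  -- the ray of x meets the hypersurface.
  set R : ℝ → CSpace n → ℝ := fun t x => ‖x‖ / ‖P t x‖ with hR
  have hRF : ∀ t ∈ Ico 0 τ, ∀ z, R t (F t z) = ‖F t z‖ := by
    intro t ht z
    have h1 := hPQ t ht z (coe_sphere_ne_zero z)
    rw [norm_coe_sphere, one_smul, ext_coe] at h1
    simp only [hR, h1, norm_coe_sphere, div_one]
  have hrep : ∀ t ∈ Ico 0 τ, ∀ x, x ≠ 0 → ∃ c : ℝ, 0 < c ∧ ∃ z, x = c • F t z := by
    intro t ht x hx
    obtain ⟨h1, h2⟩ := hP t ht x hx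
    refine ⟨‖P t x‖, norm_pos_iff.mpr h1, toSphere (P t x) h1, ?_⟩
    rw [← ext_of_ne (F t) h1]
    exact h2.symm
  have hsmooth : ContDiffOn ℝ ∞ (uncurry R) (Ico 0 τ ×ˢ {0}ᶜ) :=
    (contDiff_snd.contDiffOn.norm ℝ fun p hp => hp.2).div
      (hPs.norm ℝ fun p hp => (hP p.1 hp.1 p.2 hp.2).1)
      fun p hp => norm_ne_zero_iff.mpr (hP p.1 hp.1 p.2 hp.2).1
  have hpos : ∀ t ∈ Ico 0 τ, ∀ x, x ≠ 0 → 0 < R t x := fun t ht x hx =>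
    div_pos (norm_pos_iff.mpr hx) (norm_pos_iff.mpr (hP t ht x hx).1)
  have hhom : ∀ t ∈ Ico 0 τ, ∀ c : ℝ, 0 < c → ∀ x, x ≠ 0 → R t (c • x) = R t x := by
    intro t ht c hc x hx
    obtain ⟨h1, h2⟩ := hP t ht x hx
    have h3 := hPQ t ht (c • P t x) (smul_ne_zero hc.ne' h1)
    rw [h.isConeIsotopy.homog t ht c hc _ h1, h2] at h3
    simp only [hR, h3, norm_smul]
    rw [mul_div_mul_left _ _ (norm_ne_zero_iff.mpr hc.ne')]
  have hΦs : ContDiffOn ℝ ∞ (uncurry fun t x => potential (R t x)) (Ico 0 τ ×ˢ {0}ᶜ) :=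
    contDiffOn_potential.comp hsmooth fun p hp => hpos p.1 hp.1 p.2 hp.2
  have hcone : ∀ t ∈ Ico 0 τ, IsSmoothConic fun x => potential (R t x) := fun t ht =>
    ⟨contDiffOn_slice hΦs ht, fun c hc x hx => by rw [hhom t ht c hc x hx]⟩
  have hgeo : ∀ t ∈ Ico 0 τ, ∀ z, _ := fun t ht z =>
    normal_and_meanCurvature b (hcone t ht)
      (((contDiffOn_slice h.smooth ht).contDiffAt
        (isOpen_compl_singleton.mem_nhds (coe_sphere_ne_zero z))).of_le (by norm_cast))
      (h.ne_zero t ht z)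
      ((eventually_ne_nhds (coe_sphere_ne_zero z)).mono fun y hy => by
        rw [ext_of_ne _ hy, hRF t ht])
      (h.immersion t ht z) (h.outward t ht z)
  have hden : ∀ t ∈ Ico 0 τ, ∀ z, 0 < graphG (hopfJ n) b ‖F t z‖
      (gradient (fun y => potential (R t y)) (F t z))
      (hessOp (fun y => potential (R t y)) (F t z)) (F t z) := by
    intro t ht z
    have h1 := h.curvature_pos t ht z
    rw [(hgeo t ht z).2] at h1
    have hs : 0 < Real.sinh ‖F t z‖ := Real.sinh_pos_iff.mpr (norm_pos_iff.mpr (h.ne_zero t ht z))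
    by_contra! hle
    exact absurd h1 (not_lt.mpr (div_nonpos_of_nonpos_of_nonneg hle (by positivity)))
  refine ⟨R, ⟨hsmooth, hpos, hhom, ?_, ?_⟩, hRF, hrep, ?_⟩
  · intro t ht x hx
    -- Every ray meets the hypersurface, and the terms are invariant under scaling, so points of the
    -- hypersurface suffice.
    obtain ⟨c, hc, z, rfl⟩ := hrep t ht x hx
    have h0 := h.ne_zero t ht z
    rw [hhom t ht c hc _ h0, (hcone t ht).gradient_smul hc h0, (hcone t ht).hessOp_smul hc h0,
      graphG_smul _ _ _ _ _ _ hc, hRF t ht]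
    exact hden t ht z
  · intro t ht x hx
    obtain ⟨c, hc, z, rfl⟩ := hrep t ht x hx
    have h0 := h.ne_zero t ht z
    rw [hhom t ht c hc _ h0, (hcone t ht).gradient_smul hc h0, (hcone t ht).hessOp_smul hc h0,
      graphG_smul _ _ _ _ _ _ hc, graphV_smul _ _ _ _ hc, hRF t ht]
    have hmain : HasDerivWithinAt (fun s => potential (R s (F t z)))
        (graphV (hopfJ n) ‖F t z‖ (gradient (fun y => potential (R t y)) (F t z)) (F t z) /
        graphG (hopfJ n) b ‖F t z‖ (gradient (fun y => potential (R t y)) (F t z))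
          (hessOp (fun y => potential (R t y)) (F t z)) (F t z)) (Ico 0 τ) t := by
      have hu : UniqueDiffWithinAt ℝ (Ico 0 τ) t := uniqueDiffOn_Ico 0 τ t ht
      obtain ⟨hν, hH⟩ := hgeo t ht z
      have hpx := (hcone t ht).inner_gradient_self h0
      set x := F t z with hx
      set p := gradient (fun y => potential (R t y)) x with hp
      have hV := one_le_graphV hJ ‖x‖ p x
      have hG := hden t ht z
      have hr : 0 < ‖x‖ := norm_pos_iff.mpr h0
      have hs : 0 < Real.sinh ‖x‖ := Real.sinh_pos_iff.mpr hr
      have hflow := h.flow t ht z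
      rw [← hx] at hG
      set V := graphV (hopfJ n) ‖x‖ p x with hVdef
      set G := graphG (hopfJ n) b ‖x‖ p (hessOp (fun y => potential (R t y)) x) x with hGdef
      set v := (meanCurvature (F t) (ν t z) z)⁻¹ • ν t z with hv
      have hD : HasFDerivWithinAt (uncurry fun t x => potential (R t x))
          (fderivWithin ℝ (uncurry fun t x => potential (R t x)) (Ico 0 τ ×ˢ {0}ᶜ) (t, x))
          (Ico 0 τ ×ˢ {0}ᶜ) (t, x) :=
        (hΦs.differentiableOn (by simp) (t, x) ⟨ht, h0⟩).hasFDerivWithinAt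
      set D := fderivWithin ℝ (uncurry fun t x => potential (R t x)) (Ico 0 τ ×ˢ {0}ᶜ) (t, x)
      have hDv : ∀ w, D (0, w) = ⟪p, w⟫ := by
        intro w
        rw [hp, inner_gradient,
          (hasFDerivAt_snd_of_contDiffOn isOpen_compl_singleton hΦs ht h0).fderiv]
        rfl
      have h1 : HasDerivWithinAt (fun s => potential (R s x)) (D (1, 0)) (Ico 0 τ) t := by
        have hc : HasDerivWithinAt (fun s : ℝ => (s, x)) ((1 : ℝ), (0 : CSpace n)) (Ico 0 τ) t :=
          (hasDerivWithinAt_id t _).prodMk (hasDerivWithinAt_const t _ x)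
        have hm : MapsTo (fun s : ℝ => (s, x)) (Ico 0 τ) (Ico 0 τ ×ˢ {0}ᶜ) := fun s hs => ⟨hs, h0⟩
        exact hD.comp_hasDerivWithinAt t hc hm
      have h2 : HasDerivWithinAt (fun s => potential (R s (F s z))) (D (1, v)) (Ico 0 τ) t := by
        have hc : HasDerivWithinAt (fun s : ℝ => (s, F s z)) ((1 : ℝ), v) (Ico 0 τ) t :=
          (hasDerivWithinAt_id t _).prodMk hflow
        have hm : MapsTo (fun s : ℝ => (s, F s z)) (Ico 0 τ) (Ico 0 τ ×ˢ {0}ᶜ) :=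
          fun s hs => ⟨hs, h.ne_zero s hs z⟩
        exact hD.comp_hasDerivWithinAt t hc hm
      have h3 : HasDerivWithinAt (fun s => potential (R s (F s z)))
          (1 / (‖x‖ * Real.sinh ‖x‖) * ⟪x, v⟫) (Ico 0 τ) t := by
        have h4 := (hasFDerivAt_radial h0 (hasDerivAt_potential hr)).comp_hasDerivWithinAt t hflow
        refine (h4.congr_deriv ?_).congr (fun s hs => by rw [hRF s hs z]; rfl)
          (by rw [hRF t ht z]; rfl)
        rw [smul_apply, innerSL_apply_apply, smul_eq_mul, div_div, mul_comm (Real.sinh _)]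
      -- The identity R s (F s z) = ‖F s z‖ is differentiated in time in two ways. The time
      -- derivative of φ at a fixed point is what remains of the normal motion, the pairing of v
      -- with the metric gradient of the level function.
      have h5 : D (1, v) = 1 / (‖x‖ * Real.sinh ‖x‖) * ⟪x, v⟫ := hu.eq_deriv _ h2 h3
      have h6 : D (1, v) = D (1, 0) + D (0, v) := by
        rw [← map_add, Prod.mk_add_mk, add_zero, zero_add]
      refine h1.congr_deriv ?_
      have h7 : D (1, 0) = ambientMetric (hopfJ n) x (levelGrad (hopfJ n) p x) v := by
        rw [ambientMetric_levelGrad hJ h0 hpx, ← h5, h6, hDv]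
        ring
      have h8 : ambientMetric (hopfJ n) x (levelGrad (hopfJ n) p x) v =
          (Real.sinh ‖x‖ * √V / G) * (Real.sinh ‖x‖ / √V) *
          ambientMetric (hopfJ n) x (levelGrad (hopfJ n) p x) (levelGrad (hopfJ n) p x) := by
        rw [hv, hH, hν, inv_div, smul_smul]
        exact (ambientForm (hopfJ n) x (levelGrad (hopfJ n) p x)).map_smul _ _
      rw [h7, h8, ambientMetric_levelGrad_self hJ h0 hpx, ← hVdef]
      have hV0 : 0 < √V := Real.sqrt_pos.mpr (by linarith)
      field_simp
    exact hmain.congr (fun s hs => by rw [hhom s hs c hc _ h0]) (by rw [hhom t ht c hc _ h0])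
  · intro t ht z
    have h0 := h.ne_zero t ht z
    have hpx := (hcone t ht).inner_gradient_self h0
    have hr : 0 < ‖F t z‖ := norm_pos_iff.mpr h0
    have hs : 0 < Real.sinh ‖F t z‖ := Real.sinh_pos_iff.mpr hr
    have h1 : ∀ a : ℝ, ∀ u w, ambientMetric (hopfJ n) (F t z) (a • u) w =
        a * ambientMetric (hopfJ n) (F t z) u w := fun a u w => by
      have := congrArg (fun T => T w) ((ambientForm (hopfJ n) (F t z)).map_smul a u)
      exact this
    conv_lhs => rw [(hgeo t ht z).1]
    rw [hypMetric_eq h0, h1, ambientMetric_levelGrad hJ h0 hpx, hpx, sub_zero,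
      real_inner_self_eq_norm_sq]
    field_simp

end IsTransversalFlow

end Flow

end CHFlow

namespace CHFlow

open scoped ContDiff Topology RealInnerProductSpace
open Set Filter Function

/-! ### Estimates along the flow -/

section Estimates

variable {n : ℕ}

theorem hasDerivAt_circle (x : CSpace n) (θ : ℝ) :
    HasDerivAt (fun θ : ℝ => Complex.exp (θ * Complex.I) • x)
      (hopfJ n (Complex.exp (θ * Complex.I) • x)) θ := by
  have h1 : HasDerivAt (fun θ : ℝ => Complex.exp (θ * Complex.I))
      (Complex.exp (θ * Complex.I) * (1 * Complex.I)) θ :=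
    ((Complex.ofRealCLM.hasDerivAt (x := θ)).mul_const Complex.I).cexp
  refine (h1.smul_const x).congr_deriv ?_
  rw [hopfJ_apply, smul_smul, one_mul, mul_comm]

theorem norm_exp_mul_I_smul (x : CSpace n) (θ : ℝ) : ‖Complex.exp (θ * Complex.I) • x‖ = ‖x‖ := by
  rw [norm_smul, Complex.norm_exp_ofReal_mul_I, one_mul]

/-- The Gauss lemma: against the position vector the metric is Euclidean. Being outward can thus be
tested by the continuous function ⟪F, ν⟫, even where F might pass through the origin. -/
theorem hypMetric_radial (x u : CSpace n) : hypMetric x u x = ⟪x, u⟫ := by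
  rcases eq_or_ne x 0 with rfl | hx
  · simp [hypMetric, euc]
  · have hr : 0 < ‖x‖ := norm_pos_iff.mpr hx
    rw [hypMetric_eq hx, ambientMetric, (isOrthComplex_hopfJ n).inner_self,
      real_inner_self_eq_norm_sq, real_inner_comm x u]
    field_simp
    ring

namespace IsTransversalFlow

variable {ρ₀ : USphere n → ℝ} {τ : ℝ} {F ν : ℝ → USphere n → CSpace n}
  (h : IsTransversalFlow ρ₀ τ F ν)
include h

/-- The lower bound for ⟪F, ν⟫ does not depend on τ; it is what excludes a loss of transversality at
the end of the interval. -/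
theorem estimates (hn : 1 ≤ n) (hinv : CircleInvariant ρ₀) {c m : ℝ}
    (hc : ∀ z : USphere n, ‖gradient (fun y => potential (ext ρ₀ y)) (z : CSpace n)‖ ^ 2 ≤ c)
    (hm : ∀ z, m ≤ ρ₀ z) {t : ℝ} (ht : t ∈ Ico 0 τ) :
    (∃ ρ : USphere n → ℝ, IsStarShaped (F t) ρ ∧ CircleInvariant ρ ∧
      ∀ φ : ℝ → ℝ, (∀ r : ℝ, 0 < r → HasDerivAt φ (1 / Real.sinh r) r) →
        ∀ z, gradNormSq (fun w => φ (ρ w)) z ≤ c * Real.exp (-t / n)) ∧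
    ∀ z, m / √(1 + c) ≤ ⟪F t z, ν t z⟫ := by
  have hJ := isOrthComplex_hopfJ n
  obtain ⟨R, hR, hRF, hrep, hangle⟩ := h.exists_graphSolution hn (stdOrthonormalBasis ℝ (CSpace n))
  have h0τ : (0 : ℝ) ∈ Ico 0 τ := ⟨le_rfl, ht.1.trans_lt ht.2⟩
  have hR0 : ∀ x, x ≠ 0 → R 0 x = ext ρ₀ x := by
    intro x hx
    obtain ⟨a, ha, z, rfl⟩ := hrep 0 h0τ x hx
    have h1 := h.initial_pos z
    rw [hR.homog 0 h0τ a ha _ (h.ne_zero 0 h0τ z), ext_smul _ ha (h.ne_zero 0 h0τ z),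
      hRF 0 h0τ, h.initial, radialGraph, ext_smul _ h1 (coe_sphere_ne_zero z), ext_coe, norm_smul,
      norm_coe_sphere, mul_one, Real.norm_of_nonneg h1.le]
  have hpot0 : ∀ x, x ≠ 0 →
      gradient (fun y => potential (R 0 y)) x = gradient (fun y => potential (ext ρ₀ y)) x := by
    intro x hx
    have he : (fun y => potential (R 0 y)) =ᶠ[𝓝 x] fun y => potential (ext ρ₀ y) :=
      (eventually_ne_nhds hx).mono fun y hy => by simp only [hR0 y hy]
    simp only [gradient, he.fderiv_eq]
  have hcircle : ∀ s ∈ Ico 0 τ, ∀ x : CSpace n, x ≠ 0 → ∀ θ : ℝ,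
      HasDerivAt (fun θ : ℝ => potential (R s (Complex.exp (θ * Complex.I) • x)))
        ⟪gradient (fun y => potential (R s y)) (Complex.exp (θ * Complex.I) • x),
          hopfJ n (Complex.exp (θ * Complex.I) • x)⟫ θ := by
    intro s hs x hx θ
    rw [inner_gradient]
    exact ((hR.isSmoothConic hs).hasFDerivAt
      (smul_ne_zero (Complex.exp_ne_zero _) hx)).comp_hasDerivAt θ (hasDerivAt_circle x θ)
  have hhopf0 : ∀ x, x ≠ 0 → ⟪gradient (fun y => potential (R 0 y)) x, hopfJ n x⟫ = 0 := by
    intro x hx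
    have h1 := hcircle 0 h0τ x hx 0
    simp only [Complex.ofReal_zero, zero_mul, Complex.exp_zero, one_smul] at h1
    refine h1.unique ((hasDerivAt_const (0 : ℝ) (potential (R 0 x))).congr_of_eventuallyEq
      (Eventually.of_forall fun θ => ?_))
    have hx' : Complex.exp (θ * Complex.I) • x ≠ 0 := smul_ne_zero (Complex.exp_ne_zero _) hx
    simp only [hR0 _ hx', hR0 x hx, ext_of_ne _ hx', ext_of_ne _ hx]
    congr 1
    refine hinv (Complex.exp (θ * Complex.I)) _ _ (Complex.norm_exp_ofReal_mul_I θ) ?_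
    simp only [toSphere]
    rw [norm_exp_mul_I_smul, smul_comm]
  have hhopf := hR.hopfDeriv_eq_zero hJ hhopf0
  have hgrad := hR.gradSq_le hJ hhopf0 (c := c) (fun x hx => by
    have hx0 : x ≠ 0 := by rintro rfl; simp at hx
    rw [hpot0 x hx0]
    exact hc ⟨x, by simpa using hx⟩) t ht
  have hn0 : (n : ℝ) ≠ 0 := by positivity
  -- The real dimension is 2n, so the rate 2/m of the graph equation is 1/n.
  have hexp : -(2 / (Fintype.card (Fin (Module.finrank ℝ (CSpace n))) : ℝ)) * t = -t / n := by
    rw [Fintype.card_fin, finrank_real_CSpace]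
    push_cast
    field_simp
  rw [hexp] at hgrad
  have hext : ∀ {x : CSpace n} (hx : x ≠ 0), R t (toSphere x hx) = R t x := by
    intro x hx
    exact hR.homog t ht _ (inv_pos.mpr (norm_pos_iff.mpr hx)) x hx
  refine ⟨⟨fun z => R t z, ⟨⟨?_, fun z => hR.pos t ht _ (coe_sphere_ne_zero z)⟩, ?_⟩, ?_, ?_⟩, ?_⟩
  · refine (contDiffOn_slice hR.smooth ht).congr fun x hx => ?_
    exact (ext_of_ne _ hx).trans (hext hx)
  · refine Subset.antisymm ?_ ?_
    · rintro _ ⟨z, rfl⟩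
      refine ⟨toSphere (F t z) (h.ne_zero t ht z), ?_⟩
      rw [radialGraph, hext, hRF t ht, norm_smul_toSphere]
    · rintro _ ⟨w, rfl⟩
      obtain ⟨a, ha, z, hz⟩ := hrep t ht w (coe_sphere_ne_zero w)
      refine ⟨z, ?_⟩
      have h1 : R t w = ‖F t z‖ := by rw [hz, hR.homog t ht a ha _ (h.ne_zero t ht z), hRF t ht]
      have h2 : ‖F t z‖ * a = 1 := by
        have := norm_coe_sphere w
        rw [hz, norm_smul, Real.norm_of_nonneg ha.le] at this
        linarith
      rw [radialGraph, h1, hz, smul_smul, h2, one_smul]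
  · intro a z w ha hw
    have hz := coe_sphere_ne_zero z
    -- A vanishing Hopf derivative makes the function constant on circle orbits; compare the angles
    -- arg a and 0.
    have hconst := is_const_of_deriv_eq_zero (𝕜 := ℝ)
      (fun θ => (hcircle t ht z hz θ).differentiableAt) (fun θ => by
        rw [(hcircle t ht z hz θ).deriv,
          hhopf t ht _ (smul_ne_zero (Complex.exp_ne_zero _) hz)]) (Complex.arg a) 0
    have hexpa : Complex.exp (Complex.arg a * Complex.I) = a := by
      have := Complex.norm_mul_exp_arg_mul_I a
      rwa [ha, Complex.ofReal_one, one_mul] at this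
    simp only [hexpa, Complex.ofReal_zero, zero_mul, Complex.exp_zero, one_smul, ← hw] at hconst
    exact strictMonoOn_potential.injOn (hR.pos t ht _ (coe_sphere_ne_zero w))
      (hR.pos t ht _ hz) hconst
  · intro φ hφ z
    have hz := coe_sphere_ne_zero z
    have hpos := hR.pos t ht _ hz
    have he : ext (fun w : USphere n => φ (R t w)) =ᶠ[𝓝 (z : CSpace n)] fun y => φ (R t y) :=
      (eventually_ne_nhds hz).mono fun y hy => by rw [ext_of_ne _ hy, hext]
    have h1 := ((hφ _ hpos).comp_hasFDerivAt (z : CSpace n) (hR.hasFDerivAt_radius ht hz)).fderiv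
    have h2 : fderiv ℝ (ext fun w : USphere n => φ (R t w)) (z : CSpace n) =
        fderiv ℝ (fun y => potential (R t y)) (z : CSpace n) := by
      rw [he.fderiv_eq]
      refine Eq.trans h1 ?_
      rw [smul_smul, one_div_mul_cancel (Real.sinh_pos_iff.mpr hpos).ne', one_smul]
    rw [gradNormSq, gradient, h2]
    exact hgrad z (norm_coe_sphere z)
  · intro z
    have h0 := h.ne_zero t ht z
    have hr : 0 < ‖F t z‖ := norm_pos_iff.mpr h0
    have hc0 : 0 ≤ c := (sq_nonneg _).trans (hc z)
    rw [← hypMetric_radial, hangle t ht z]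
    set x := F t z with hx
    set p := gradient (fun y => potential (R t y)) x with hp
    have h1 : ‖x‖ ^ 2 * ‖p‖ ^ 2 ≤ c := by
      have h2 := hgrad (‖x‖⁻¹ • x) (by rw [norm_smul, norm_inv, norm_norm, inv_mul_cancel₀ hr.ne'])
      rw [(hR.isSmoothConic ht).gradient_smul (inv_pos.mpr hr) h0, inv_inv, norm_smul, norm_norm,
        mul_pow] at h2
      refine h2.trans (mul_le_of_le_one_right hc0 (Real.exp_le_one_iff.mpr ?_))
      exact div_nonpos_of_nonpos_of_nonneg (by linarith [ht.1]) (Nat.cast_nonneg n)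
    have hV : graphV (hopfJ n) ‖x‖ p x ≤ 1 + c := by
      rw [graphV]
      have : 0 ≤ Real.sinh ‖x‖ ^ 2 / Real.cosh ‖x‖ ^ 2 * ⟪p, hopfJ n x⟫ ^ 2 := by positivity
      linarith
    have hV1 := one_le_graphV hJ ‖x‖ p x
    have hmx : m ≤ ‖x‖ := by
      have h2 := hR.radius_mono hJ ht h0
      rw [hRF t ht, hR0 _ h0, ext_of_ne _ h0] at h2
      exact (hm _).trans h2
    have hs : 0 < √(graphV (hopfJ n) ‖x‖ p x) := Real.sqrt_pos.mpr (by linarith)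
    exact div_le_div₀ hr.le hmx hs (Real.sqrt_le_sqrt hV)

end IsTransversalFlow

end Estimates

/-! ### Transversality is preserved -/

section Preservation

variable {n : ℕ} {ρ₀ : USphere n → ℝ} {T : EReal} {F ν : ℝ → USphere n → CSpace n}

/-- Mean convexity refers to some outward normal while the flow carries its own; the explicit
formula identifies the two. -/
theorem outward_normal_unique {F : USphere n → CSpace n} {z : USphere n} {N N' : CSpace n}
    {φ : CSpace n → ℝ} (hφ : IsSmoothConic φ) (hF : ContDiffAt ℝ 2 (ext F) z) (h0 : F z ≠ 0)
    (hlev : ∀ᶠ y in 𝓝 (z : CSpace n), potential ‖ext F y‖ = φ (ext F y))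
    (himm : ∀ X ∈ sphereTangent z, pushforward F z X = 0 → X = 0)
    (hN : IsOutwardNormal F z N) (hN' : IsOutwardNormal F z N') : N = N' := by
  rw [(normal_and_meanCurvature (stdOrthonormalBasis ℝ (CSpace n)) hφ hF h0 hlev himm hN).1,
    (normal_and_meanCurvature (stdOrthonormalBasis ℝ (CSpace n)) hφ hF h0 hlev himm hN').1]

theorem isSmoothConic_radial (hρ₀ : IsRadialFunction ρ₀) :
    IsSmoothConic fun y => potential (ext ρ₀ y) where
  smooth := contDiffOn_potential.comp hρ₀.1 fun x hx => by
    rw [ext_of_ne _ hx]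
    exact hρ₀.2 _
  homog c hc x hx := by rw [ext_smul _ hc hx]

namespace IsIMCF

variable (h : IsIMCF ρ₀ T F ν)
include h

theorem initial_curvature_pos (hρ₀ : IsRadialFunction ρ₀) (hconv : IsMeanConvexGraph ρ₀)
    (h0 : (0 : ℝ) ∈ timeInterval T) (z : USphere n) : 0 < meanCurvature (F 0) (ν 0 z) z := by
  obtain ⟨N, hN, hH⟩ := hconv z
  rw [← h.initial] at hN hH
  have hF0 : ∀ w, F 0 w = ρ₀ w • (w : CSpace n) := fun w => by rw [h.initial, radialGraph]
  have hne : ∀ w, F 0 w ≠ 0 := fun w => by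
    rw [hF0]
    exact smul_ne_zero (hρ₀.2 w).ne' (coe_sphere_ne_zero w)
  rw [outward_normal_unique (isSmoothConic_radial hρ₀)
    (((contDiffOn_slice (g := fun t y => ext (F t) y) h.smooth h0).contDiffAt
      (isOpen_compl_singleton.mem_nhds (coe_sphere_ne_zero z))).of_le (by norm_cast)) (hne z)
    ((eventually_ne_nhds (coe_sphere_ne_zero z)).mono fun y hy => ?_) (h.immersion 0 h0 z)
    (h.outward z) hN]
  · exact hH
  · rw [ext_of_ne _ hy, hF0, ext_smul _ (hρ₀.2 _) (coe_sphere_ne_zero _), ext_coe, norm_smul,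
      norm_coe_sphere, mul_one, Real.norm_of_nonneg (hρ₀.2 _).le]

/-- Transversality on the interval is assumed; what has to be proved is that the mean curvature
keeps its sign, starting from mean convexity. -/
theorem isTransversalFlow (hρ₀ : IsRadialFunction ρ₀) (hconv : IsMeanConvexGraph ρ₀) {τ : ℝ}
    (hτ : Ico 0 τ ⊆ timeInterval T) (hpos : ∀ t ∈ Ico 0 τ, ∀ z, 0 < ⟪F t z, ν t z⟫) :
    IsTransversalFlow ρ₀ τ F ν where
  smooth := h.smooth.mono (prod_mono hτ Subset.rfl)
  immersion t ht := h.immersion t (hτ ht)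
  initial := h.initial
  initial_pos := hρ₀.2
  ne_zero t ht z h0 := by
    have := hpos t ht z
    rw [h0, inner_zero_left] at this
    exact this.false
  outward t ht z := ⟨h.unit_normal t (hτ ht) z, by rw [hypMetric_radial]; exact hpos t ht z⟩
  flow t ht z := (h.flow t (hτ ht) z).mono hτ
  curvature_pos t ht z := by
    have hνne : ∀ s ∈ Ico 0 τ, ν s z ≠ 0 := by
      intro s hs h0
      have := hpos s hs z
      rw [h0, inner_zero_right] at this
      exact this.false
    have hder : ∀ s ∈ Ico 0 τ, derivWithin (fun s => F s z) (Ico 0 τ) s =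
        (meanCurvature (F s) (ν s z) z)⁻¹ • ν s z := fun s hs =>
      ((h.flow s (hτ hs) z).mono hτ).derivWithin (uniqueDiffOn_Ico 0 τ s hs)
    have hsm : ContDiffOn ℝ ∞ (fun s => F s z) (Ico 0 τ) := by
      have h1 : ContDiffOn ℝ ∞ (fun s : ℝ => ext (F s) (z : CSpace n)) (Ico 0 τ) :=
        h.smooth.comp (f := fun s : ℝ => (s, (z : CSpace n)))
          (contDiff_id.prodMk contDiff_const).contDiffOn
          fun s hs => ⟨hτ hs, coe_sphere_ne_zero z⟩
      exact h1.congr fun s hs => (ext_coe (F s) z).symm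
    -- Pairing ∂F/∂t with ν gives ‖ν‖²/H. It is continuous because F is smooth, so the intermediate
    -- value theorem applies without a separate proof that H is continuous in time.
    have hcont : ContinuousOn (fun s => ⟪derivWithin (fun s => F s z) (Ico 0 τ) s, ν s z⟫)
        (Ico 0 τ) := by
      refine (hsm.continuousOn_derivWithin (uniqueDiffOn_Ico 0 τ) (by simp)).inner (𝕜 := ℝ) ?_
      exact h.normal_continuous.comp (f := fun s : ℝ => (s, z))
        (continuous_id.prodMk continuous_const).continuousOn fun s hs => ⟨hτ hs, mem_univ z⟩
    have hval : ∀ s ∈ Ico 0 τ, ⟪derivWithin (fun s => F s z) (Ico 0 τ) s, ν s z⟫ =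
        (meanCurvature (F s) (ν s z) z)⁻¹ * ‖ν s z‖ ^ 2 := fun s hs => by
      rw [hder s hs, real_inner_smul_left, real_inner_self_eq_norm_sq]
    by_contra! hle
    have hlt : meanCurvature (F t) (ν t z) z < 0 := lt_of_le_of_ne hle (h.curvature_ne_zero t (hτ ht) z)
    have h0τ : (0 : ℝ) ∈ Ico 0 τ := ⟨le_rfl, ht.1.trans_lt ht.2⟩
    have hsub : Icc 0 t ⊆ Ico 0 τ := fun s hs => ⟨hs.1, hs.2.trans_lt ht.2⟩
    have h1 : 0 < ⟪derivWithin (fun s => F s z) (Ico 0 τ) 0, ν 0 z⟫ := by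
      rw [hval 0 h0τ]
      have := norm_pos_iff.mpr (hνne 0 h0τ)
      have := h.initial_curvature_pos hρ₀ hconv (hτ h0τ) z
      positivity
    have h2 : ⟪derivWithin (fun s => F s z) (Ico 0 τ) t, ν t z⟫ < 0 := by
      rw [hval t ht]
      have := norm_pos_iff.mpr (hνne t ht)
      exact mul_neg_of_neg_of_pos (inv_lt_zero.mpr hlt) (by positivity)
    obtain ⟨s, hs, hs0⟩ := intermediate_value_Icc' ht.1 (hcont.mono hsub) ⟨h2.le, h1.le⟩
    have h3 := hval s (hsub hs)
    simp only at hs0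
    rw [hs0] at h3
    have h4 := norm_pos_iff.mpr (hνne s (hsub hs))
    exact (mul_ne_zero (inv_ne_zero (h.curvature_ne_zero s (hτ (hsub hs)) z)) (by positivity)) h3.symm

theorem continuousOn_support :
    ContinuousOn (fun p : ℝ × USphere n => ⟪F p.1 p.2, ν p.1 p.2⟫) (timeInterval T ×ˢ univ) := by
  refine ContinuousOn.inner (𝕜 := ℝ) ?_ h.normal_continuous
  have h1 : ContinuousOn (fun p : ℝ × USphere n => ext (F p.1) (p.2 : CSpace n))
      (timeInterval T ×ˢ univ) :=
    h.smooth.continuousOn.comp (f := fun p : ℝ × USphere n => (p.1, (p.2 : CSpace n)))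
      (continuous_fst.prodMk (continuous_subtype_val.comp continuous_snd)).continuousOn
      fun p hp => ⟨hp.1, coe_sphere_ne_zero p.2⟩
  exact h1.congr fun p hp => (ext_coe (F p.1) p.2).symm

/-- A continuity argument: before the first failure the flow consists of graphs, the estimates give
a uniform positive lower bound, and this bound passes to the limit. -/
theorem support_pos (hn : 1 ≤ n) (hρ₀ : IsRadialFunction ρ₀) (hinv : CircleInvariant ρ₀)
    (hconv : IsMeanConvexGraph ρ₀) {c m : ℝ}
    (hc : ∀ z : USphere n, ‖gradient (fun y => potential (ext ρ₀ y)) (z : CSpace n)‖ ^ 2 ≤ c)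
    (hm0 : 0 < m) (hm : ∀ z, m ≤ ρ₀ z) : ∀ t ∈ timeInterval T, ∀ z, 0 < ⟪F t z, ν t z⟫ := by
  intro t ht z
  by_contra! hle
  have hsub : Icc 0 t ⊆ timeInterval T := fun s hs =>
    ⟨hs.1, (EReal.coe_le_coe_iff.mpr hs.2).trans_lt ht.2⟩
  set S : Set (ℝ × USphere n) := Icc 0 t ×ˢ univ with hS
  have hSc : IsCompact S := isCompact_Icc.prod isCompact_univ
  have hcont : ContinuousOn (fun p : ℝ × USphere n => ⟪F p.1 p.2, ν p.1 p.2⟫) S :=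
    h.continuousOn_support.mono (prod_mono hsub Subset.rfl)
  -- Compactness of the set where positivity fails yields an earliest failure time, attained at some
  -- point.
  have hK : IsCompact (S ∩ (fun p : ℝ × USphere n => ⟪F p.1 p.2, ν p.1 p.2⟫) ⁻¹' Iic 0) :=
    hSc.of_isClosed_subset (hcont.preimage_isClosed_of_isClosed hSc.isClosed isClosed_Iic)
      inter_subset_left
  have hB := hK.image continuous_fst
  obtain ⟨⟨τ, w⟩, ⟨hτS, hτw⟩, hτ⟩ := hB.sInf_mem ⟨t, (t, z), ⟨⟨⟨ht.1, le_rfl⟩, mem_univ z⟩, hle⟩, rfl⟩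
  have hτS : τ ∈ Icc 0 t := hτS.1
  have hτw : ⟪F τ w, ν τ w⟫ ≤ 0 := hτw
  have hτ : τ = sInf _ := hτ
  have h0T : (0 : ℝ) ∈ timeInterval T := hsub ⟨le_rfl, ht.1⟩
  have hτ0 : 0 < τ := by
    refine lt_of_le_of_ne hτS.1 fun h0 => ?_
    rw [← h0] at hτw
    have := (h.outward w).2
    rw [hypMetric_radial] at this
    linarith
  have hIco : Ico 0 τ ⊆ timeInterval T := fun s hs => hsub ⟨hs.1, hs.2.le.trans hτS.2⟩
  have hpos : ∀ s ∈ Ico 0 τ, ∀ z, 0 < ⟪F s z, ν s z⟫ := by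
    intro s hs z'
    by_contra! hle'
    have hmem := csInf_le hB.bddBelow ⟨(s, z'), ⟨⟨⟨hs.1, hs.2.le.trans hτS.2⟩, mem_univ z'⟩, hle'⟩, rfl⟩
    rw [← hτ] at hmem
    exact absurd hs.2 (not_lt.mpr hmem)
  have hflow := h.isTransversalFlow hρ₀ hconv hIco hpos
  have hc0 : 0 ≤ c := (sq_nonneg _).trans (hc z)
  have hlim : Tendsto (fun s => ⟪F s w, ν s w⟫) (𝓝[<] τ) (𝓝 ⟪F τ w, ν τ w⟫) := by
    have h1 : ContinuousWithinAt (fun s => ⟪F s w, ν s w⟫) (Icc 0 t) τ :=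
      (hcont.comp (f := fun s : ℝ => (s, w)) (s := Icc 0 t)
        (continuous_id.prodMk continuous_const).continuousOn fun s hs => ⟨hs, mem_univ w⟩) τ hτS
    have h2 : ContinuousWithinAt (fun s => ⟪F s w, ν s w⟫) (Ico 0 τ) τ :=
      h1.mono fun s hs => ⟨hs.1, hs.2.le.trans hτS.2⟩
    have h3 := h2.tendsto
    rwa [nhdsWithin_Ico_eq_nhdsLT hτ0] at h3
  have hge : m / √(1 + c) ≤ ⟪F τ w, ν τ w⟫ := by
    refine ge_of_tendsto hlim ?_
    filter_upwards [Ico_mem_nhdsLT hτ0] with s hs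
    exact (hflow.estimates hn hinv hc hm hs).2 w
  have : 0 < m / √(1 + c) := div_pos hm0 (Real.sqrt_pos.mpr (by linarith))
  linarith

end IsIMCF

theorem exists_gradient_bound (hn : 1 ≤ n) (hρ₀ : IsRadialFunction ρ₀) :
    ∃ c m : ℝ, 0 < c ∧ 0 < m ∧
      (∀ z : USphere n, ‖gradient (fun y => potential (ext ρ₀ y)) (z : CSpace n)‖ ^ 2 ≤ c) ∧
      ∀ z, m ≤ ρ₀ z := by
  have hcoe : ContinuousOn (fun z : USphere n => (z : CSpace n)) univ :=
    continuous_subtype_val.continuousOn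
  have hcont : ContinuousOn
      (fun z : USphere n => ‖gradient (fun y => potential (ext ρ₀ y)) (z : CSpace n)‖ ^ 2) univ := by
    have h1 : ContinuousOn (gradient fun y => potential (ext ρ₀ y)) ({0}ᶜ : Set (CSpace n)) :=
      fun x hx => ((isSmoothConic_radial hρ₀).contDiffAt_gradient hx).continuousAt.continuousWithinAt
    exact ((h1.comp hcoe fun z _ => coe_sphere_ne_zero z).norm).pow 2
  have hcontρ : ContinuousOn ρ₀ univ :=
    (hρ₀.1.continuousOn.comp hcoe fun z _ => coe_sphere_ne_zero z).congr fun z _ =>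
      (ext_coe ρ₀ z).symm
  obtain ⟨C, hC⟩ := isCompact_univ.exists_bound_of_continuousOn hcont
  have hne : (univ : Set (USphere n)).Nonempty := by
    have : Nontrivial (CSpace n) := by
      rw [← Module.finrank_pos_iff (R := ℝ), finrank_real_CSpace]
      omega
    obtain ⟨x, hx⟩ := exists_ne (0 : CSpace n)
    exact ⟨toSphere x hx, mem_univ _⟩
  obtain ⟨z₀, -, hz₀⟩ := isCompact_univ.exists_isMinOn hne hcontρ
  refine ⟨|C| + 1, ρ₀ z₀, by positivity, hρ₀.2 z₀, fun z => ?_, fun z => hz₀ (mem_univ z)⟩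
  have := (le_abs_self _).trans ((hC z (mem_univ z)).trans (le_abs_self C))
  linarith

end Preservation

end CHFlow

theorem proposition5p1 (n : ℕ) (hn : 2 ≤ n) (ρ₀ : CHFlow.USphere n → ℝ)
    (hρ₀ : CHFlow.IsRadialFunction ρ₀) (hinv : CHFlow.CircleInvariant ρ₀)
    (hconv : CHFlow.IsMeanConvexGraph ρ₀) :
    ∃ c : ℝ, 0 < c ∧
      ∀ (T : EReal) (F ν : ℝ → CHFlow.USphere n → CHFlow.CSpace n), CHFlow.IsIMCF ρ₀ T F ν →
        ∀ t ∈ CHFlow.timeInterval T,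
          ∃ ρ : CHFlow.USphere n → ℝ,
            CHFlow.IsStarShaped (F t) ρ ∧ CHFlow.CircleInvariant ρ ∧
            ∀ φ : ℝ → ℝ, (∀ r : ℝ, 0 < r → HasDerivAt φ (1 / Real.sinh r) r) →
              ∀ z, CHFlow.gradNormSq (fun w => φ (ρ w)) z ≤ c * Real.exp (-t / n) := by
  obtain ⟨c, m, hc, hm, hcb, hmb⟩ := CHFlow.exists_gradient_bound (by omega) hρ₀
  refine ⟨c, hc, fun T F ν h t ht => ?_⟩
  -- A finite τ beyond t puts t in the half-open interval on which the estimates hold, also when T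
  -- is infinite; c is independent of τ.
  obtain ⟨τ, htτ, hτT⟩ := EReal.lt_iff_exists_real_btwn.mp ht.2
  have hsub : Set.Ico 0 τ ⊆ CHFlow.timeInterval T := fun s hs =>
    ⟨hs.1, (EReal.coe_lt_coe_iff.mpr hs.2).trans hτT⟩
  have hpos := h.support_pos (by omega) hρ₀ hinv hconv hcb hm hmb
  exact ((h.isTransversalFlow hρ₀ hconv hsub fun s hs => hpos s (hsub hs)).estimates (by omega)
    hinv hcb hmb ⟨ht.1, EReal.coe_lt_coe_iff.mp htτ⟩).1
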